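/- Let $N\ge 2$, $\mathcal V=\{1,\dots,N\}$. Let $\mathcal A(k)=[a_{ij}(k)]$, $k\ge 0$, be random real $N\times N$ matrices (weights of either sign), defining weighted digraphs $\mathcal G(k)$ with an edge $(j,i)$ from $j$ to $i$ iff $a_{ij}(k)\neq 0$, edge set $\mathcal E(k)$, neighbourhoods $N_i(k)=\{j: a_{ij}(k)\ne0\}$, generalized Laplacian $L(k)=\mathrm{diag}\big(\sum_j a_{1j}(k),\dots,\sum_j a_{Nj}(k)\big)-\mathcal A(k)$ and $\hat L(k)=\frac{L(k)+L(k)^T}{2}$. For a deterministic $X(0)\in\mathbb R^N$ let $X(k)=(x_1(k),\dots,x_N(k))^T$ be given by $$x_i(k+1)=x_i(k)+c(k)\sum_{j\in N_i(k)}a_{ij}(k)\big(y_{ji}(k)-x_i(k)\big),\qquad y_{ji}(k)=x_j(k)+f_{ji}\big(x_j(k)-x_i(k)\big)\,\xi_{ji}(k).$$ Put $P=I-\frac1N\mathbf 1\mathbf 1^T$, $\delta(k)=PX(k)$, $V(k)=\|\delta(k)\|^2$; $\|\cdot\|$ is the Euclidean norm of vectors and the 2-norm of matrices; $\lambda_2$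 denotes the second smallest eigenvalue of a symmetric matrix. Assume: * The flow $\{\mathcal A(k)\}_{k\ge 0}$ is i.i.d., $E[\mathcal A(0)]$ is entrywise nonnegative, and its digraph is balanced ($\sum_j E[a_{ij}(0)]=\sum_j E[a_{ji}(0)]$ for all $i$). * (A1) $f_{ji}:\mathbb R\to\mathbb R$ are Borel and there are constants $\sigma_{ji},b_{ji}>0$ with $|f_{ji}(x)|\le\sigma_{ji}|x|+b_{ji}$ for all $x$. * (A2) $\xi(k)=(\xi_{ji}(k))_{j,i}$ is a vector-valued martingale difference sequence for its own filtration $\mathcal F_\xi(k)=\sigma(\xi(0),\dots,\xi(k))$ ($\mathcal F_\xi(-1)$ trivial), and $\sup_k E[\|\xi(k)\|^2\,|\,\mathcal F_\xi(k-1)]\le\beta$ a.s. for a constant $\beta>0$. * (A3) $c(k)>0$, $\sum_k c(k)=\infty$, $\sum_k c^2(k)<\infty$. (A4) $c(k)\downarrow 0$ and $c(k)=O(c(k+h))$ as $k\to\infty$ for each $h>0$. * (A5) The processes $\{\mathcal A(k)\}$ and $\{\xi(k)\}$ are independent. * The digraph associated with the Laplacian $E[L(0)]$ has a (directed) spanning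 tree. * $E\|L(0)\|^2<\infty$; and, if self-loops are allowed, $E[a_{ii}(0)^2]<\infty$ for all $i$. Write $$c=\sum_k c^2(k),\quad \tilde c=\sum_k c^2(k)E[V(k)],\quad \sigma=\max_{i,j}\sigma_{ji},\quad b=\max_{i,j}b_{ji},\quad \rho_0^2=E\|L(0)\|^2,$$ $$\bar\rho_1=E\Big[|\mathcal E(0)|\max_{i,j}a_{ij}^2(0)\Big],\qquad \bar\rho_2=\max_i E\Big[\Big(\sum_j a_{ij}(0)-\sum_j a_{ji}(0)\Big)^2\Big],$$ $$q_v=e^{c(\rho_0^2+4\bar\rho_1\beta\sigma^2)}\big(V(0)+2c\beta\bar\rho_1 b^2\big),\qquad q_x=e^{c\rho_0^2}\big(\|X(0)\|^2+2c\beta\bar\rho_1(2\sigma^2q_v+b^2)\big).$$ Then the constants $\bar\rho_1,\bar\rho_2,\tilde c$ are finite, all $x_i(k)$ are square integrable, and: 1. There is a random variable $x^*$ with $E[(x_i(k)-x^*)^2]\to0$ and $x_i(k)\to x^*$ a.s. for all $i$, $E(x^*)=\frac1N\sum_j x_j(0)$, and $$\mathrm{Var}(x^*)\le\frac{4c\beta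 b^2\bar\rho_1}{N^2}+\frac{8\tilde c\beta\sigma^2\bar\rho_1}{N^2}+\frac{2c\bar\rho_2q_x}{N}<\infty.$$ 2. $\displaystyle\frac1n\sum_{k=0}^n\|\delta(k)\|=o\Big(\frac1{\sqrt{c(n)n}}\Big)$ almost surely. 3. If $\displaystyle c(0)<\frac{2\lambda_2(E[\hat L(0)])}{E\|L(0)\|^2+4\sigma^2\beta\bar\rho_1}$, then $$\tilde c\le\frac{c(0)E[V(0)]+2b^2\beta\bar\rho_1\sum_{k=0}^\infty c^3(k)}{2\lambda_2(E[\hat L(0)])-\big(E\|L(0)\|^2+4\sigma^2\beta\bar\rho_1\big)c(0)}.$$ -/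

import Mathlib

open MeasureTheory ProbabilityTheory Filter Topology Asymptotics
open scoped ENNReal

noncomputable section

namespace Consensus

variable {N : ℕ} {Ω : Type*} [MeasurableSpace Ω]

/-! ### Weighted digraphs

A weighted digraph on the nodes `Fin N` is determined by its generalized weighted adjacency matrix
`A` (weights of either sign): there is an edge `(j, i)` from `j` to `i` iff `A i j ≠ 0`. -/

/-- The neighbourhood of node `i`: the nodes `j` with an edge `(j, i)`. -/
def nbrs (A : Matrix (Fin N) (Fin N) ℝ) (i : Fin N) : Finset (Fin N) :=
  Finset.univ.filter fun j => A i j ≠ 0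

/-- The edge set: pairs `(j, i)` with `j` a neighbour of `i`. -/
def edges (A : Matrix (Fin N) (Fin N) ℝ) : Finset (Fin N × Fin N) :=
  Finset.univ.filter fun p => A p.2 p.1 ≠ 0

/-- In-degree of node `i`. -/
def degIn (A : Matrix (Fin N) (Fin N) ℝ) (i : Fin N) : ℝ := ∑ j, A i j

/-- Out-degree of node `i`. -/
def degOut (A : Matrix (Fin N) (Fin N) ℝ) (i : Fin N) : ℝ := ∑ j, A j i

/-- The digraph is balanced: in-degree equals out-degree at each node. -/
def Balanced (A : Matrix (Fin N) (Fin N) ℝ) : Prop := ∀ i, degIn A i = degOut A i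

/-- The generalized Laplacian matrix. -/
def laplacian (A : Matrix (Fin N) (Fin N) ℝ) : Matrix (Fin N) (Fin N) ℝ :=
  Matrix.diagonal (degIn A) - A

/-- The symmetric part `(M + Mᵀ) / 2`. -/
def symPart (M : Matrix (Fin N) (Fin N) ℝ) : Matrix (Fin N) (Fin N) ℝ :=
  (1 / 2 : ℝ) • (M + M.transpose)

/-- The digraph relation associated with a Laplacian matrix `L`: an edge from `j` to `i ≠ j` iff
the `(i, j)` entry (minus the weight of that edge) is nonzero. -/
def laplacianEdge (L : Matrix (Fin N) (Fin N) ℝ) (j i : Fin N) : Prop := j ≠ i ∧ L i j ≠ 0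

/-- A digraph `E` (with `E j i` meaning an edge from `j` to `i`) has a spanning tree: a subgraph
`T` and a root `r` without parent in `T`, such that every other node has exactly one parent in `T`
and every node is reached from `r` by a directed path in `T`. -/
def HasSpanningTree {V : Type*} (E : V → V → Prop) : Prop :=
  ∃ (T : V → V → Prop) (r : V), (∀ j i, T j i → E j i) ∧ (∀ j, ¬ T j r) ∧
    (∀ i, i ≠ r → ∃! j, T j i) ∧ ∀ i, Relation.ReflTransGen T r i

/-- The entrywise (product Borel) σ-algebra on matrices. -/
instance matrixMeasurableSpace : MeasurableSpace (Matrix (Fin N) (Fin N) ℝ) :=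
  inferInstanceAs (MeasurableSpace (Fin N → Fin N → ℝ))

/-- The 2-norm (operator norm for the Euclidean norm) of a matrix. -/
def norm2 (M : Matrix (Fin N) (Fin N) ℝ) : ℝ :=
  ‖Matrix.toEuclideanCLM (n := Fin N) (𝕜 := ℝ) M‖

/-- The second smallest eigenvalue, counted with multiplicity, of a real symmetric matrix
(Mathlib's `eigenvalues₀` lists the eigenvalues in decreasing order). -/
def lambda2 (hN : 2 ≤ N) {M : Matrix (Fin N) (Fin N) ℝ} (hM : M.IsHermitian) : ℝ :=
  hM.eigenvalues₀ ⟨N - 2, by rw [Fintype.card_fin]; omega⟩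

/-- The matrix `P = I - (1/N) 1 1ᵀ`. -/
def projMatrix (N : ℕ) : Matrix (Fin N) (Fin N) ℝ :=
  1 - (1 / (N : ℝ)) • Matrix.of fun _ _ => 1

/-- Entrywise expectation of a random matrix. -/
def meanMatrix (μ : Measure Ω) (M : Ω → Matrix (Fin N) (Fin N) ℝ) : Matrix (Fin N) (Fin N) ℝ :=
  Matrix.of fun i j => ∫ ω, M ω i j ∂μ

/-- The expectation of the symmetrized Laplacian of a random digraph. -/
def meanSymLaplacian (μ : Measure Ω) (A : Ω → Matrix (Fin N) (Fin N) ℝ) :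
    Matrix (Fin N) (Fin N) ℝ :=
  meanMatrix μ fun ω => symPart (laplacian (A ω))

theorem meanSymLaplacian_isHermitian (μ : Measure Ω) (A : Ω → Matrix (Fin N) (Fin N) ℝ) :
    (meanSymLaplacian μ A).IsHermitian := by
  ext i j
  simp [meanSymLaplacian, meanMatrix, symPart, add_comm]

/-! ### The algorithm -/

/-- The measurement `y_{ji} = x_j + f_{ji}(x_j - x_i) ξ_{ji}` of the state of `j` by node `i`. -/
def measurement (f : Fin N → Fin N → ℝ → ℝ) (x : Fin N → ℝ)
    (ξ : EuclideanSpace ℝ (Fin N × Fin N)) (j i : Fin N) : ℝ :=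
  x j + f j i (x j - x i) * ξ (j, i)

/-- The states `x_i(k)` of the distributed averaging algorithm
`x_i(k+1) = x_i(k) + c(k) ∑_{j ∈ N_i(k)} a_{ij}(k) (y_{ji}(k) - x_i(k))`. -/
def state (c : ℕ → ℝ) (f : Fin N → Fin N → ℝ → ℝ) (A : ℕ → Ω → Matrix (Fin N) (Fin N) ℝ)
    (ξ : ℕ → Ω → EuclideanSpace ℝ (Fin N × Fin N)) (X0 : Fin N → ℝ) : ℕ → Ω → Fin N → ℝ
  | 0, _ => X0
  | k + 1, ω => fun i =>
      state c f A ξ X0 k ω i + c k * ∑ j ∈ nbrs (A k ω) i,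
        A k ω i j * (measurement f (state c f A ξ X0 k ω) (ξ k ω) j i - state c f A ξ X0 k ω i)

/-- The consensus error `P x` of a state vector. -/
def consensusError (x : Fin N → ℝ) : EuclideanSpace ℝ (Fin N) :=
  WithLp.toLp 2 ((projMatrix N).mulVec x)

/-- The energy `‖P x‖²` of a state vector. -/
def energy (x : Fin N → ℝ) : ℝ := ‖consensusError x‖ ^ 2

/-! ### Assumptions -/

/-- Linear growth of the (Borel) noise intensity functions, with positive constants. -/
def IntensityGrowth (f : Fin N → Fin N → ℝ → ℝ) (σ b : Fin N → Fin N → ℝ) : Prop :=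
  ∀ j i, Measurable (f j i) ∧ 0 < σ j i ∧ 0 < b j i ∧ ∀ x, |f j i x| ≤ σ j i * |x| + b j i

/-- The σ-algebra generated by `ξ 0, …, ξ (k - 1)`; it is trivial for `k = 0`. -/
abbrev past {E : Type*} [MeasurableSpace E] (ξ : ℕ → Ω → E) (k : ℕ) : MeasurableSpace Ω :=
  ⨆ j ∈ Finset.range k, MeasurableSpace.comap (ξ j) inferInstance

/-- The noise is a vector-valued martingale difference sequence for its own filtration, with
conditional second moments bounded by the positive constant `β`. -/
def NoiseMDS (μ : Measure Ω) (ξ : ℕ → Ω → EuclideanSpace ℝ (Fin N × Fin N)) (β : ℝ) : Prop :=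
  0 < β ∧ ∀ k, Measurable (ξ k) ∧ Integrable (ξ k) μ ∧ μ[ξ k | past ξ k] =ᵐ[μ] 0 ∧
    Integrable (fun ω => ‖ξ k ω‖ ^ 2) μ ∧
    ∀ᵐ ω ∂μ, (μ[fun ω => ‖ξ k ω‖ ^ 2 | past ξ k]) ω ≤ β

/-- Positive gains with divergent sum and convergent sum of squares. -/
def GainSums (c : ℕ → ℝ) : Prop :=
  (∀ k, 0 < c k) ∧ Tendsto (fun n => ∑ k ∈ Finset.range n, c k) atTop atTop ∧
    Summable fun k => c k ^ 2

/-- The gains decrease to `0`, and `c(k) = O(c(k+h))` for every `h > 0`. -/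
def GainDecay (c : ℕ → ℝ) : Prop :=
  Antitone c ∧ Tendsto c atTop (𝓝 0) ∧ ∀ h : ℕ, 0 < h → c =O[atTop] fun k => c (k + h)

/-- The graph flow and the noise process are independent (as processes). -/
def FlowNoiseIndep (μ : Measure Ω) (A : ℕ → Ω → Matrix (Fin N) (Fin N) ℝ)
    (ξ : ℕ → Ω → EuclideanSpace ℝ (Fin N × Fin N)) : Prop :=
  IndepFun (fun ω k => A k ω) (fun ω k => ξ k ω) μ

/-- I.i.d. graph flows whose mean adjacency matrix is (entrywise) nonnegative and balanced. -/
def IIDBalancedFlow (μ : Measure Ω) (A : ℕ → Ω → Matrix (Fin N) (Fin N) ℝ) : Prop :=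
  (∀ k, Measurable (A k)) ∧ iIndepFun A μ ∧ (∀ k, IdentDistrib (A k) (A 0) μ μ) ∧
    (∀ i j, Integrable (fun ω => A 0 ω i j) μ) ∧
    (∀ i j, 0 ≤ meanMatrix μ (A 0) i j) ∧ Balanced (meanMatrix μ (A 0))

/-! ### Constants -/

/-- The maximum of a finite family indexed by pairs of nodes. -/
def maxPair (s : Fin N → Fin N → ℝ) : ℝ := ⨆ p : Fin N × Fin N, s p.1 p.2

/-- The random variable `|E_G| max_{i,j} a_{ij}²`. -/
def edgeWeight (A : Matrix (Fin N) (Fin N) ℝ) : ℝ :=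
  ((edges A).card : ℝ) * maxPair fun i j => A i j ^ 2

/-- `E ‖L_G‖²`. -/
def lapSq (μ : Measure Ω) (A : Ω → Matrix (Fin N) (Fin N) ℝ) : ℝ :=
  ∫ ω, norm2 (laplacian (A ω)) ^ 2 ∂μ

/-- `ρ̄₁ = E[|E_G| max_{i,j} a_{ij}²]`. -/
def rho1 (μ : Measure Ω) (A : Ω → Matrix (Fin N) (Fin N) ℝ) : ℝ :=
  ∫ ω, edgeWeight (A ω) ∂μ

/-- `ρ̄₂ = max_i E[(∑_j a_{ij} - ∑_j a_{ji})²]`. -/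
def rho2 (μ : Measure Ω) (A : Ω → Matrix (Fin N) (Fin N) ℝ) : ℝ :=
  ⨆ i, ∫ ω, (degIn (A ω) i - degOut (A ω) i) ^ 2 ∂μ

/-- `∑_k c(k)²`. -/
def gainSq (c : ℕ → ℝ) : ℝ := ∑' k, c k ^ 2

/-- `q_v = exp(c (E‖L‖² + 4 ρ̄₁ β σ²)) (‖P X(0)‖² + 2 c β ρ̄₁ b²)`. -/
def qv (c : ℕ → ℝ) (lsq ρ₁ β σ b : ℝ) (X0 : Fin N → ℝ) : ℝ :=
  Real.exp (gainSq c * (lsq + 4 * ρ₁ * β * σ ^ 2)) *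
    (energy X0 + 2 * gainSq c * β * ρ₁ * b ^ 2)

/-- `q_x = exp(c E‖L‖²) (‖X(0)‖² + 2 c β ρ̄₁ (2 σ² q_v + b²))`. -/
def qx (c : ℕ → ℝ) (lsq ρ₁ β σ b : ℝ) (X0 : Fin N → ℝ) : ℝ :=
  Real.exp (gainSq c * lsq) *
    (‖(WithLp.toLp 2 X0 : EuclideanSpace ℝ (Fin N))‖ ^ 2 +
      2 * gainSq c * β * ρ₁ * (2 * σ ^ 2 * qv c lsq ρ₁ β σ b X0 + b ^ 2))

/-- `c̃ = ∑_k c(k)² E[V(k)]` for a random state sequence `x`. -/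
def gainEnergy (μ : Measure Ω) (c : ℕ → ℝ) (x : ℕ → Ω → Fin N → ℝ) : ℝ :=
  ∑' k, c k ^ 2 * ∫ ω, energy (x k ω) ∂μ

end Consensus

end

noncomputable section

namespace Consensus

/-! ### Independence and conditional expectation -/

section Independence

variable {Ω : Type*} {m m₁ m₂ m₃ p mΩ : MeasurableSpace Ω} {μ : Measure Ω}

/-! Write `w` for the noise vector, so that X(k+1) = X − c L X + c w. The state X(k) is adapted to
two filtrations at once: G_k (`noiseFiltration`), which knows the whole graph flow and the noise
before time k, and H_k (`flowFiltration`), which knows the whole noise and the graphs before time k.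
Independence of flow and noise keeps ξ(k) a martingale difference for G_k, with the same bound β
(`condExp_noiseFiltration`), and makes A(k) independent of H_k (`indep_flow`). So scalar products of
`w` with G_k-measurable vectors average to zero, while under conditioning on H_k the random
Laplacian is replaced by its mean.

Expanding ‖PX(k+1)‖² and using LP = L gives, with v = E V, the recursion v(k+1) ≤ (1 − 2λ₂c + Mc²)
v(k) + ec², where M = ρ₀² + 4ρ̄₁βσ² and e = 2βρ̄₁b² (`integral_energy_succ_le`). Here λ₂ > 0: by
balance the form of E[L] is half the sum of E[a_ij](u_i − u_j)², and the spanning tree leaves only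
constants in its kernel. The recursion bounds v by q_v, makes ∑ c v converge and forces v → 0.
Multiplied by c(k) and telescoped, it gives the bound on c̃. Expanding ‖X(k+1)‖² in the same way
gives q_x.

Pathwise, V(n) = V(0) + ∑ r + ∑ m with m a martingale difference for G and ∑ E|r| finite, because
E|r| is of order c v + c². The martingale is then bounded in L¹, so V converges almost surely; since
∑ c V is finite and ∑ c diverges, the limit is 0 (`ae_tendsto_energy`). The rate follows from ∑ c V
< ∞ by Cauchy–Schwarz and Kronecker's lemma.

The mean of the states is its initial value plus two sums: the flow part −(c/N) 1ᵀLX, a martingale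
difference for H because E[A] is balanced, and the noise part (c/N) 1ᵀw, a martingale difference for
G. Both converge in L² and almost surely, and their limits give x* (`exists_average_consensus`). -/

theorem sup_eq_generateFrom_inter (m₁ m₂ : MeasurableSpace Ω) :
    m₁ ⊔ m₂ = MeasurableSpace.generateFrom
      {s | ∃ a b, MeasurableSet[m₁] a ∧ MeasurableSet[m₂] b ∧ s = a ∩ b} := by
  apply le_antisymm
  · refine sup_le (fun s hs => ?_) (fun s hs => ?_)
    · exact MeasurableSpace.measurableSet_generateFrom
        ⟨s, Set.univ, hs, MeasurableSet.univ, by simp⟩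
    · exact MeasurableSpace.measurableSet_generateFrom
        ⟨Set.univ, s, MeasurableSet.univ, hs, by simp⟩
  · refine MeasurableSpace.generateFrom_le ?_
    rintro _ ⟨a, b, ha, hb, rfl⟩
    exact MeasurableSet.inter ((le_sup_left : m₁ ≤ m₁ ⊔ m₂) a ha)
      ((le_sup_right : m₂ ≤ m₁ ⊔ m₂) b hb)

theorem isPiSystem_inter (m₁ m₂ : MeasurableSpace Ω) :
    IsPiSystem {s | ∃ a b, MeasurableSet[m₁] a ∧ MeasurableSet[m₂] b ∧ s = a ∩ b} := by
  rintro _ ⟨a, b, ha, hb, rfl⟩ _ ⟨a', b', ha', hb', rfl⟩ _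
  exact ⟨a ∩ a', b ∩ b', MeasurableSet.inter ha ha', MeasurableSet.inter hb hb',
    Set.inter_inter_inter_comm a b a' b'⟩

/-- On rectangles, P(a∩b∩c) = P(a∩b)P(c) = P(a)P(b)P(c) = P(a)P(b∩c). It is applied to the current
graph, the past graphs and the noise. -/
theorem indep_sup_of_indep_sup [IsProbabilityMeasure μ]
    (h₁ : m₁ ≤ mΩ) (h₂ : m₂ ≤ mΩ) (h₃ : m₃ ≤ mΩ) (h₁₂ : Indep m₁ m₂ μ)
    (h : Indep (m₁ ⊔ m₂) m₃ μ) : Indep m₁ (m₂ ⊔ m₃) μ := by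
  refine IndepSets.indep h₁ (sup_le h₂ h₃) (@MeasurableSpace.isPiSystem_measurableSet _ m₁)
    (isPiSystem_inter m₂ m₃) (@MeasurableSpace.generateFrom_measurableSet _ m₁).symm
    (sup_eq_generateFrom_inter m₂ m₃) ?_
  rw [IndepSets_iff]
  rintro a _ ha ⟨b, c, hb, hc, rfl⟩
  rw [Indep_iff] at h h₁₂
  have hab : MeasurableSet[m₁ ⊔ m₂] (a ∩ b) :=
    MeasurableSet.inter ((le_sup_left : m₁ ≤ m₁ ⊔ m₂) a ha) ((le_sup_right : m₂ ≤ m₁ ⊔ m₂) b hb)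
  rw [← Set.inter_assoc, h _ _ hab hc, h₁₂ _ _ ha hb,
    h _ _ ((le_sup_right : m₂ ≤ m₁ ⊔ m₂) b hb) hc, mul_assoc]

theorem setIntegral_of_indep [IsProbabilityMeasure μ]
    (h₁ : m₁ ≤ mΩ) (h₂ : m₂ ≤ mΩ) (h : Indep m₁ m₂ μ) {f : Ω → ℝ}
    (hfm : StronglyMeasurable[m₂] f) (hf : Integrable f μ) {a : Set Ω} (ha : MeasurableSet[m₁] a) :
    ∫ ω in a, f ω ∂μ = μ.real a * ∫ ω, f ω ∂μ := by
  rw [← setIntegral_condExp h₁ hf ha,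
    integral_congr_ae (ae_restrict_of_ae (condExp_indep_eq h₂ h₁ hfm h.symm))]
  simp

/-- Enlarging the conditioning σ-algebra by an independent one does not change the conditional
expectation. -/
theorem condExp_sup_of_indep [IsProbabilityMeasure μ]
    (h₁ : m₁ ≤ mΩ) (h₂ : m₂ ≤ mΩ) (hp : p ≤ m₂) (h : Indep m₁ m₂ μ) {f : Ω → ℝ}
    (hfm : StronglyMeasurable[m₂] f) (hf : Integrable f μ) :
    μ[f | m₁ ⊔ p] =ᵐ[μ] μ[f | p] := by
  have hle : m₁ ⊔ p ≤ mΩ := sup_le h₁ (hp.trans h₂)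
  have hpΩ : p ≤ mΩ := hp.trans h₂
  symm
  refine ae_eq_condExp_of_forall_setIntegral_eq hle hf
    (fun s _ _ => integrable_condExp.integrableOn) ?_
    (stronglyMeasurable_condExp.mono (le_sup_right : p ≤ m₁ ⊔ p)).aestronglyMeasurable
  intro s hs _
  revert s
  refine MeasurableSpace.induction_on_inter
    (C := fun s _ => μ s < ∞ → ∫ ω in s, (μ[f | p]) ω ∂μ = ∫ ω in s, f ω ∂μ)
    (sup_eq_generateFrom_inter m₁ p) (isPiSystem_inter m₁ p) ?_ ?_ ?_ ?_
  · simp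
  · rintro _ ⟨a, b, ha, hb, rfl⟩ _
    -- On a rectangle the `m₁`-set splits off as a factor, both for `f` and for its conditional
    -- expectation, since both are `m₂`-measurable. What remains is the defining property of the
    -- conditional expectation on `b`.
    have key : ∀ g : Ω → ℝ, StronglyMeasurable[m₂] g → Integrable g μ →
        ∫ ω in a ∩ b, g ω ∂μ = μ.real a * ∫ ω in b, g ω ∂μ := by
      intro g hgm hg
      rw [← setIntegral_indicator (hpΩ b hb),
        setIntegral_of_indep h₁ h₂ h (hgm.indicator (hp b hb)) (hg.indicator (hpΩ b hb)) ha,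
        integral_indicator (hpΩ b hb)]
    rw [key _ (stronglyMeasurable_condExp.mono hp) integrable_condExp, key _ hfm hf,
      setIntegral_condExp hpΩ hf hb]
  · intro t ht ih _
    rw [setIntegral_compl (hle t ht) integrable_condExp, setIntegral_compl (hle t ht) hf,
      ih (measure_lt_top _ _), integral_condExp hpΩ]
  · intro t hd ht ih _
    rw [integral_iUnion (fun i => hle _ (ht i)) hd integrable_condExp.integrableOn,
      integral_iUnion (fun i => hle _ (ht i)) hd hf.integrableOn]
    exact tsum_congr fun i => ih i (measure_lt_top _ _)

/-- The conditional bound says that the measure with density `h` is at most `β • μ` on `m`.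
Comparing the trimmed measures avoids assuming that the product is integrable. -/
theorem lintegral_mul_le_of_condExp_le [IsProbabilityMeasure μ]
    (hm : m ≤ mΩ) {h : Ω → ℝ} {β : ℝ} (hβ : 0 ≤ β) (h0 : ∀ ω, 0 ≤ h ω) (hmeas : Measurable h)
    (hint : Integrable h μ) (hle : ∀ᵐ ω ∂μ, (μ[h | m]) ω ≤ β) {g : Ω → ℝ≥0∞}
    (hg : Measurable[m] g) :
    ∫⁻ ω, g ω * ENNReal.ofReal (h ω) ∂μ ≤ ENNReal.ofReal β * ∫⁻ ω, g ω ∂μ := by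
  have hd : Measurable fun ω => ENNReal.ofReal (h ω) := hmeas.ennreal_ofReal
  have key : (μ.withDensity fun ω => ENNReal.ofReal (h ω)).trim hm ≤
      (ENNReal.ofReal β • μ).trim hm := by
    refine @Measure.le_intro _ m _ _ fun s hs _ => ?_
    rw [trim_measurableSet_eq hm hs, trim_measurableSet_eq hm hs, withDensity_apply _ (hm s hs),
      ← ofReal_integral_eq_lintegral_ofReal hint.integrableOn (ae_of_all _ h0),
      ← setIntegral_condExp hm hint hs]
    have : ∫ ω in s, (μ[h | m]) ω ∂μ ≤ ∫ _ in s, β ∂μ :=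
      integral_mono_ae integrable_condExp.integrableOn (integrable_const _).integrableOn
        (ae_restrict_of_ae hle)
    rw [setIntegral_const, smul_eq_mul] at this
    refine (ENNReal.ofReal_le_ofReal this).trans ?_
    rw [mul_comm, ENNReal.ofReal_mul hβ, ofReal_measureReal]
    simp
  calc ∫⁻ ω, g ω * ENNReal.ofReal (h ω) ∂μ
      = ∫⁻ ω, g ω ∂(μ.withDensity fun ω => ENNReal.ofReal (h ω)) := by
        rw [lintegral_withDensity_eq_lintegral_mul _ hd (hg.mono hm le_rfl)]
        simp [mul_comm]
    _ = ∫⁻ ω, g ω ∂((μ.withDensity fun ω => ENNReal.ofReal (h ω)).trim hm) :=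
        (lintegral_trim hm hg).symm
    _ ≤ ∫⁻ ω, g ω ∂((ENNReal.ofReal β • μ).trim hm) := lintegral_mono' key le_rfl
    _ = ENNReal.ofReal β * ∫⁻ ω, g ω ∂μ := by
        rw [lintegral_trim hm hg, lintegral_smul_measure, smul_eq_mul]

theorem integral_mul_le_of_condExp_le [IsProbabilityMeasure μ]
    (hm : m ≤ mΩ) {h : Ω → ℝ} {β : ℝ} (hβ : 0 ≤ β) (h0 : ∀ ω, 0 ≤ h ω) (hmeas : Measurable h)
    (hint : Integrable h μ) (hle : ∀ᵐ ω ∂μ, (μ[h | m]) ω ≤ β) {g : Ω → ℝ}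
    (hg : Measurable[m] g) (hg0 : ∀ ω, 0 ≤ g ω) (hgi : Integrable g μ) :
    Integrable (fun ω => g ω * h ω) μ ∧ ∫ ω, g ω * h ω ∂μ ≤ β * ∫ ω, g ω ∂μ := by
  have hgm : Measurable g := hg.mono hm le_rfl
  have key := lintegral_mul_le_of_condExp_le hm hβ h0 hmeas hint hle hg.ennreal_ofReal
  simp_rw [← ENNReal.ofReal_mul (hg0 _)] at key
  rw [← ofReal_integral_eq_lintegral_ofReal hgi (ae_of_all _ hg0), ← ENNReal.ofReal_mul hβ] at key
  have hi : Integrable (fun ω => g ω * h ω) μ := by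
    refine ⟨(hgm.mul hmeas).aestronglyMeasurable, ?_⟩
    rw [hasFiniteIntegral_iff_ofReal (ae_of_all _ fun ω => mul_nonneg (hg0 ω) (h0 ω))]
    exact key.trans_lt ENNReal.ofReal_lt_top
  refine ⟨hi, ?_⟩
  rw [← ofReal_integral_eq_lintegral_ofReal hi
    (ae_of_all _ fun ω => mul_nonneg (hg0 ω) (h0 ω))] at key
  exact (ENNReal.ofReal_le_ofReal_iff
    (mul_nonneg hβ (integral_nonneg hg0))).1 key

theorem indepFun_of_indep {E F : Type*} [MeasurableSpace E] [MeasurableSpace F]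
    {m₁ m₂ : MeasurableSpace Ω} (h : Indep m₁ m₂ μ) {f : Ω → E} {g : Ω → F}
    (hf : Measurable[m₁] f) (hg : Measurable[m₂] g) : IndepFun f g μ :=
  (IndepFun_iff_Indep f g μ).2 (indep_of_indep_of_le_left
    (indep_of_indep_of_le_right h hg.comap_le) hf.comap_le)

end Independence

/-! ### Real sequences -/

section Sequences

/-- Discrete Grönwall inequality, from 1 + a ≤ exp a. It produces the constants `qv` and `qx`. -/
theorem le_exp_of_recursive_bound {v a e : ℕ → ℝ} (ha : ∀ k, 0 ≤ a k) (he : ∀ k, 0 ≤ e k)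
    (has : Summable a) (hes : Summable e) (hv : ∀ k, 0 ≤ v k)
    (h : ∀ k, v (k + 1) ≤ (1 + a k) * v k + e k) (n : ℕ) :
    v n ≤ Real.exp (∑' k, a k) * (v 0 + ∑' k, e k) := by
  have key : ∀ n, v n ≤ Real.exp (∑ k ∈ Finset.range n, a k) *
      (v 0 + ∑ k ∈ Finset.range n, e k) := by
    intro n
    induction n with
    | zero => simp
    | succ n ih =>
      have h1 : 1 + a n ≤ Real.exp (a n) := by linarith [Real.add_one_le_exp (a n)]
      have h2 : (1 + a n) * v n ≤ Real.exp (a n) *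
          (Real.exp (∑ k ∈ Finset.range n, a k) * (v 0 + ∑ k ∈ Finset.range n, e k)) :=
        mul_le_mul h1 ih (hv n) (Real.exp_pos _).le
      have h3 : e n ≤ Real.exp (a n) * Real.exp (∑ k ∈ Finset.range n, a k) * e n := by
        refine le_mul_of_one_le_left (he n) ?_
        rw [← Real.exp_add]
        exact Real.one_le_exp (add_nonneg (ha n) (Finset.sum_nonneg fun k _ => ha k))
      rw [Finset.sum_range_succ, Finset.sum_range_succ, Real.exp_add]
      calc v (n + 1) ≤ _ := h n
        _ ≤ _ := add_le_add h2 h3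
        _ = _ := by ring
  refine (key n).trans (mul_le_mul ?_ ?_ ?_ (Real.exp_pos _).le)
  · exact Real.exp_le_exp.2 (has.sum_le_tsum _ fun k _ => ha k)
  · gcongr
    exact hes.sum_le_tsum _ fun k _ => he k
  · exact add_nonneg (hv 0) (Finset.sum_nonneg fun k _ => he k)

/-- With a limit l > 0, eventually c ≤ (2/l) c v, so ∑ c would converge. It serves both for the
expected energy and for the energy along a path. -/
theorem eq_zero_of_tendsto_of_summable_mul {c v : ℕ → ℝ} {l : ℝ} (hc : ∀ k, 0 < c k)
    (hdiv : Tendsto (fun n => ∑ k ∈ Finset.range n, c k) atTop atTop) (hv : ∀ k, 0 ≤ v k)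
    (hs : Summable fun k => c k * v k) (hl : Tendsto v atTop (𝓝 l)) : l = 0 := by
  by_contra hne
  have hl0 : 0 < l := lt_of_le_of_ne (ge_of_tendsto' hl hv) (Ne.symm hne)
  have hev : ∀ᶠ k in atTop, l / 2 ≤ v k := (hl.eventually (lt_mem_nhds (half_lt_self hl0))).mono
    fun k hk => hk.le
  have hcs : Summable c := by
    refine (hs.mul_left (2 / l)).of_norm_bounded_eventually_nat ?_
    filter_upwards [hev] with k hk
    rw [Real.norm_of_nonneg (hc k).le]
    have : c k * (l / 2) ≤ c k * v k := mul_le_mul_of_nonneg_left hk (hc k).le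
    calc c k = 2 / l * (c k * (l / 2)) := by field_simp
      _ ≤ _ := by gcongr
  exact not_tendsto_nhds_of_tendsto_atTop hdiv _ hcs.hasSum.tendsto_sum_nat

theorem exists_tendsto_of_le_add_summable {v e : ℕ → ℝ} (he : ∀ k, 0 ≤ e k) (hes : Summable e)
    (hv : ∀ k, 0 ≤ v k) (h : ∀ k, v (k + 1) ≤ v k + e k) : ∃ l, Tendsto v atTop (𝓝 l) := by
  have hanti : Antitone fun n => v n - ∑ k ∈ Finset.range n, e k := by
    refine antitone_nat_of_succ_le fun n => ?_
    rw [Finset.sum_range_succ]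
    linarith [h n]
  have hbdd : BddBelow (Set.range fun n => v n - ∑ k ∈ Finset.range n, e k) := by
    refine ⟨-∑' k, e k, ?_⟩
    rintro _ ⟨n, rfl⟩
    have := hes.sum_le_tsum (Finset.range n) fun k _ => he k
    have := hv n
    simp only
    linarith
  have h1 := (tendsto_atTop_ciInf hanti hbdd).add hes.hasSum.tendsto_sum_nat
  exact ⟨_, by simpa using h1⟩

/-- Kronecker's lemma for nonnegative terms. -/
theorem tendsto_mul_sum_of_summable {c a : ℕ → ℝ} (hc : ∀ k, 0 < c k) (hanti : Antitone c)
    (h0 : Tendsto c atTop (𝓝 0)) (ha : ∀ k, 0 ≤ a k) (hs : Summable fun k => c k * a k) :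
    Tendsto (fun n => c n * ∑ k ∈ Finset.range (n + 1), a k) atTop (𝓝 0) := by
  -- Dominated convergence for series: for k ≤ n the k-th term is at most c k * a k because `c` is
  -- antitone, and for fixed k it tends to 0 with c n.
  have h := tendsto_tsum_of_dominated_convergence (𝓕 := atTop)
    (f := fun n k => if k ∈ Finset.range (n + 1) then c n * a k else 0) (g := fun _ => (0 : ℝ))
    hs (fun k => ?_) (.of_forall fun n k => ?_)
  · rw [tsum_zero] at h
    refine h.congr fun n => ?_
    rw [tsum_eq_sum (s := Finset.range (n + 1)) (fun k hk => if_neg hk), Finset.mul_sum]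
    exact Finset.sum_congr rfl fun k hk => if_pos hk
  · have h1 : Tendsto (fun n => c n * a k) atTop (𝓝 0) := by simpa using h0.mul_const (a k)
    refine h1.congr' ?_
    filter_upwards [eventually_ge_atTop k] with n hn
    rw [if_pos (by simp; omega)]
  · split_ifs with hk
    · rw [Real.norm_of_nonneg (mul_nonneg (hc n).le (ha k))]
      exact mul_le_mul_of_nonneg_right (hanti (by simp at hk; omega)) (ha k)
    · simpa using mul_nonneg (hc k).le (ha k)

end Sequences

/-! ### Convergence of martingales given by their differences -/

section Martingale

variable {Ω : Type*} {mΩ : MeasurableSpace Ω} {μ : Measure Ω}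

theorem integrable_and_integral_le_of_ae_tendsto {g : ℕ → Ω → ℝ} {h : Ω → ℝ} {C : ℝ}
    (hg0 : ∀ n ω, 0 ≤ g n ω) (hg : ∀ n, Integrable (g n) μ) (hh : AEStronglyMeasurable h μ)
    (hlim : ∀ᵐ ω ∂μ, Tendsto (fun n => g n ω) atTop (𝓝 (h ω)))
    (hC : ∀ᶠ n in atTop, ∫ ω, g n ω ∂μ ≤ C) :
    Integrable h μ ∧ ∫ ω, h ω ∂μ ≤ C := by
  have hh0 : ∀ᵐ ω ∂μ, 0 ≤ h ω := by
    filter_upwards [hlim] with ω hω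
    exact ge_of_tendsto' hω fun n => hg0 n ω
  have hC0 : 0 ≤ C := by
    obtain ⟨n, hn⟩ := hC.exists
    exact (integral_nonneg (hg0 n)).trans hn
  have key : ∫⁻ ω, ENNReal.ofReal (h ω) ∂μ ≤ ENNReal.ofReal C := by
    calc ∫⁻ ω, ENNReal.ofReal (h ω) ∂μ
        = ∫⁻ ω, liminf (fun n => ENNReal.ofReal (g n ω)) atTop ∂μ := by
          refine lintegral_congr_ae ?_
          filter_upwards [hlim] with ω hω
          exact ((ENNReal.continuous_ofReal.tendsto _).comp hω).liminf_eq.symm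
      _ ≤ liminf (fun n => ∫⁻ ω, ENNReal.ofReal (g n ω) ∂μ) atTop :=
          lintegral_liminf_le' fun n => (hg n).aemeasurable.ennreal_ofReal
      _ ≤ ENNReal.ofReal C := by
          refine liminf_le_of_frequently_le' (hC.mono fun n hn => ?_).frequently
          rw [← ofReal_integral_eq_lintegral_ofReal (hg n) (ae_of_all _ (hg0 n))]
          exact ENNReal.ofReal_le_ofReal hn
  have hi : Integrable h μ :=
    ⟨hh, by
      rw [hasFiniteIntegral_iff_ofReal hh0]
      exact key.trans_lt ENNReal.ofReal_lt_top⟩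
  refine ⟨hi, ?_⟩
  rw [← ofReal_integral_eq_lintegral_ofReal hi hh0] at key
  exact (ENNReal.ofReal_le_ofReal_iff hC0).1 key

variable [IsProbabilityMeasure μ] {𝒢 : Filtration ℕ mΩ} {D : ℕ → Ω → ℝ}

theorem martingale_sum_range (hD : ∀ k, StronglyMeasurable[𝒢 (k + 1)] (D k))
    (hint : ∀ k, Integrable (D k) μ) (h0 : ∀ k, μ[D k | 𝒢 k] =ᵐ[μ] 0) :
    Martingale (fun n ω => ∑ k ∈ Finset.range n, D k ω) 𝒢 μ := by
  refine martingale_of_condExp_sub_eq_zero_nat (fun n => ?_)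
    (fun n => integrable_finsetSum _ fun k _ => hint k) (fun n => ?_)
  · refine Finset.stronglyMeasurable_fun_sum _ fun k hk => (hD k).mono (𝒢.mono ?_)
    exact Finset.mem_range.1 hk
  · have : (fun ω => ∑ k ∈ Finset.range (n + 1), D k ω) -
        (fun ω => ∑ k ∈ Finset.range n, D k ω) = D n := by
      ext ω
      simp [Finset.sum_range_succ]
    rw [this]
    exact h0 n

/-- Doob's theorem in its L¹ form: the martingale part of the energy is built from products of
square integrable factors, so L² bounds are not available for it. -/
theorem exists_tendsto_sum_of_integral_abs_le (hD : ∀ k, StronglyMeasurable[𝒢 (k + 1)] (D k))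
    (hint : ∀ k, Integrable (D k) μ) (h0 : ∀ k, μ[D k | 𝒢 k] =ᵐ[μ] 0) {R : ℝ}
    (hR : ∀ n, ∫ ω, |∑ k ∈ Finset.range n, D k ω| ∂μ ≤ R) :
    ∃ Z : Ω → ℝ, Measurable Z ∧
      ∀ᵐ ω ∂μ, Tendsto (fun n => ∑ k ∈ Finset.range n, D k ω) atTop (𝓝 (Z ω)) := by
  have hmart := martingale_sum_range hD hint h0
  have hi : ∀ n, Integrable (fun ω => ∑ k ∈ Finset.range n, D k ω) μ := fun n =>
    integrable_finsetSum _ fun k _ => hint k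
  have hconv := hmart.submartingale.exists_ae_tendsto_of_bdd (R := R.toNNReal) fun n => by
    rw [eLpNorm_one_eq_lintegral_enorm, ← ofReal_integral_norm_eq_lintegral_enorm (hi n)]
    exact ENNReal.ofReal_le_ofReal (hR n)
  exact measurable_limit_of_tendsto_metrizable_ae (fun n => (hi n).1.aemeasurable) hconv

/-- Orthogonality of martingale differences. Blocks from m to n rather than initial sums are needed
to estimate the tails. -/
theorem integral_sq_sum_Ico (hD : ∀ k, StronglyMeasurable[𝒢 (k + 1)] (D k))
    (hL2 : ∀ k, MemLp (D k) 2 μ) (h0 : ∀ k, μ[D k | 𝒢 k] =ᵐ[μ] 0) {m n : ℕ} (hmn : m ≤ n) :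
    ∫ ω, (∑ k ∈ Finset.Ico m n, D k ω) ^ 2 ∂μ = ∑ k ∈ Finset.Ico m n, ∫ ω, D k ω ^ 2 ∂μ := by
  induction n, hmn using Nat.le_induction with
  | base => simp
  | succ n hmn ih =>
    have hS : MemLp (fun ω => ∑ k ∈ Finset.Ico m n, D k ω) 2 μ :=
      memLp_finsetSum _ fun k _ => hL2 k
    have hSm : StronglyMeasurable[𝒢 n] fun ω => ∑ k ∈ Finset.Ico m n, D k ω :=
      Finset.stronglyMeasurable_fun_sum _ fun k hk =>
        (hD k).mono (𝒢.mono (Finset.mem_Ico.1 hk).2)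
    have hSD : Integrable ((fun ω => ∑ k ∈ Finset.Ico m n, D k ω) * D n) μ :=
      hS.integrable_mul (hL2 n)
    have hcross : ∫ ω, ((fun ω => ∑ k ∈ Finset.Ico m n, D k ω) * D n) ω ∂μ = 0 := by
      rw [← integral_condExp (𝒢.le n)]
      have h1 := condExp_mul_of_stronglyMeasurable_left hSm hSD
        ((hL2 n).integrable (by norm_num))
      rw [integral_congr_ae (h1.trans ((h0 n).mono fun ω hω => by
        show _ * _ = (0 : ℝ)
        rw [hω]; simp))]
      simp
    have hsq : ∀ ω, (∑ k ∈ Finset.Ico m (n + 1), D k ω) ^ 2 =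
        (∑ k ∈ Finset.Ico m n, D k ω) ^ 2 +
        2 * ((fun ω => ∑ k ∈ Finset.Ico m n, D k ω) * D n) ω + D n ω ^ 2 := by
      intro ω
      rw [Finset.sum_Ico_succ_top hmn, Pi.mul_apply]
      ring
    have hsum : Integrable (fun ω => (∑ k ∈ Finset.Ico m n, D k ω) ^ 2 +
        2 * ((fun ω => ∑ k ∈ Finset.Ico m n, D k ω) * D n) ω) μ :=
      hS.integrable_sq.add (hSD.const_mul 2)
    simp_rw [hsq]
    rw [integral_add hsum (hL2 n).integrable_sq,
      integral_add hS.integrable_sq (hSD.const_mul 2), integral_const_mul, hcross, ih,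
      Finset.sum_Ico_succ_top hmn]
    ring

theorem sq_integral_le_integral_sq {g : Ω → ℝ} (hg : MemLp g 2 μ) :
    (∫ ω, g ω ∂μ) ^ 2 ≤ ∫ ω, g ω ^ 2 ∂μ := by
  have h := variance_nonneg g μ
  rw [variance_eq_sub hg] at h
  simpa using h

/-- A martingale whose differences have summable second moments converges almost surely and in
`L²`. -/
theorem exists_tendsto_sum_of_summable_sq (hD : ∀ k, StronglyMeasurable[𝒢 (k + 1)] (D k))
    (hL2 : ∀ k, MemLp (D k) 2 μ) (h0 : ∀ k, μ[D k | 𝒢 k] =ᵐ[μ] 0) {s : ℕ → ℝ}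
    (hs : Summable s) (hle : ∀ k, ∫ ω, D k ω ^ 2 ∂μ ≤ s k) :
    ∃ Z : Ω → ℝ, Measurable Z ∧ MemLp Z 2 μ ∧
      (∀ᵐ ω ∂μ, Tendsto (fun n => ∑ k ∈ Finset.range n, D k ω) atTop (𝓝 (Z ω))) ∧
      Tendsto (fun n => ∫ ω, (∑ k ∈ Finset.range n, D k ω - Z ω) ^ 2 ∂μ) atTop (𝓝 0) ∧
      ∫ ω, Z ω ∂μ = 0 ∧ ∫ ω, Z ω ^ 2 ∂μ ≤ ∑' k, s k := by
  have hs0 : ∀ k, 0 ≤ s k := fun k => (integral_nonneg fun ω => sq_nonneg _).trans (hle k)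
  have hint : ∀ k, Integrable (D k) μ := fun k => (hL2 k).integrable (by norm_num)
  have hS : ∀ n, MemLp (fun ω => ∑ k ∈ Finset.range n, D k ω) 2 μ := fun n =>
    memLp_finsetSum _ fun k _ => hL2 k
  have hbd : ∀ n, ∫ ω, (∑ k ∈ Finset.range n, D k ω) ^ 2 ∂μ ≤ ∑' k, s k := by
    intro n
    have := integral_sq_sum_Ico hD hL2 h0 (Nat.zero_le n)
    rw [← Finset.range_eq_Ico] at this
    rw [this]
    exact (Finset.sum_le_sum fun k _ => hle k).trans (hs.sum_le_tsum _ fun k _ => hs0 k)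
  obtain ⟨Z, hZm, hZ⟩ := exists_tendsto_sum_of_integral_abs_le hD hint h0
    -- The L¹ bound comes from |S| ≤ 1 + S².
    (R := 1 + ∑' k, s k) (fun n => by
      calc ∫ ω, |∑ k ∈ Finset.range n, D k ω| ∂μ
          ≤ ∫ ω, (1 + (∑ k ∈ Finset.range n, D k ω) ^ 2) ∂μ := by
            refine integral_mono ((hS n).integrable (by norm_num)).abs
              ((integrable_const _).add (hS n).integrable_sq) fun ω => ?_
            show |_| ≤ 1 + _
            rw [abs_le]
            constructor <;>
              nlinarith [sq_nonneg (∑ k ∈ Finset.range n, D k ω - 1),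
                sq_nonneg (∑ k ∈ Finset.range n, D k ω + 1),
                sq_nonneg (∑ k ∈ Finset.range n, D k ω)]
        _ ≤ _ := by
            rw [integral_add (integrable_const _) (hS n).integrable_sq]
            simpa using hbd n)
  -- Fatou in n at fixed m bounds the squared L² distance from the limit by a tail of ∑ s. The case
  -- m = 0 bounds the second moment of `Z`, and m → ∞ gives L² convergence.
  have hfatou : ∀ m, Integrable (fun ω => (Z ω - ∑ k ∈ Finset.range m, D k ω) ^ 2) μ ∧
      ∫ ω, (Z ω - ∑ k ∈ Finset.range m, D k ω) ^ 2 ∂μ ≤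
        ∑' k, s k - ∑ k ∈ Finset.range m, s k := by
    intro m
    refine integrable_and_integral_le_of_ae_tendsto
      (g := fun n ω => (∑ k ∈ Finset.range n, D k ω - ∑ k ∈ Finset.range m, D k ω) ^ 2)
      (fun n ω => sq_nonneg _) (fun n => ((hS n).sub (hS m)).integrable_sq)
      ((hZm.aestronglyMeasurable.sub (hS m).1).pow 2) ?_ ?_
    · filter_upwards [hZ] with ω hω
      exact (hω.sub_const _).pow 2
    · filter_upwards [eventually_ge_atTop m] with n hn
      simp_rw [← Finset.sum_Ico_eq_sub _ hn]
      rw [integral_sq_sum_Ico hD hL2 h0 hn]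
      refine (Finset.sum_le_sum fun k _ => hle k).trans ?_
      rw [Finset.sum_Ico_eq_sub _ hn]
      exact sub_le_sub_right (hs.sum_le_tsum _ fun k _ => hs0 k) _
  have hZL2 : MemLp Z 2 μ := by
    rw [memLp_two_iff_integrable_sq hZm.aestronglyMeasurable]
    simpa using (hfatou 0).1
  have hL2lim : Tendsto (fun n => ∫ ω, (∑ k ∈ Finset.range n, D k ω - Z ω) ^ 2 ∂μ)
      atTop (𝓝 0) := by
    have h1 : Tendsto (fun m => ∑' k, s k - ∑ k ∈ Finset.range m, s k) atTop (𝓝 0) := by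
      simpa using hs.hasSum.tendsto_sum_nat.const_sub (∑' k, s k)
    refine squeeze_zero (fun n => integral_nonneg fun ω => sq_nonneg _) (fun n => ?_) h1
    refine le_trans (le_of_eq ?_) (hfatou n).2
    exact integral_congr_ae (ae_of_all _ fun ω => sub_sq_comm _ _)
  refine ⟨Z, hZm, hZL2, hZ, hL2lim, ?_, by simpa using (hfatou 0).2⟩
  have hmean : ∀ n, ∫ ω, (∑ k ∈ Finset.range n, D k ω - Z ω) ∂μ = -∫ ω, Z ω ∂μ := by
    intro n
    rw [integral_sub ((hS n).integrable (by norm_num)) (hZL2.integrable (by norm_num)),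
      integral_finsetSum _ fun k _ => hint k]
    have : ∀ k, ∫ ω, D k ω ∂μ = 0 := fun k => by
      rw [← integral_condExp (𝒢.le k), integral_congr_ae (h0 k)]
      simp
    simp [this]
  -- The partial sums have mean zero, so (E Z)² = (E[S_n − Z])² ≤ E[(S_n − Z)²] → 0.
  have hsq : (∫ ω, Z ω ∂μ) ^ 2 ≤ 0 := by
    refine ge_of_tendsto' hL2lim fun n => ?_
    have := sq_integral_le_integral_sq ((hS n).sub hZL2)
    simp only [Pi.sub_apply] at this
    rwa [hmean, neg_sq] at this
  exact pow_eq_zero_iff (two_ne_zero) |>.1 (le_antisymm hsq (sq_nonneg _))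

end Martingale

/-! ### Linear algebra of the averaging algorithm -/

section Deterministic

variable {N : ℕ}

/-- The Euclidean vector with coordinates `x`. -/
abbrev toE (x : Fin N → ℝ) : EuclideanSpace ℝ (Fin N) := WithLp.toLp 2 x

/-- The operator on Euclidean space given by a matrix. -/
abbrev opE (M : Matrix (Fin N) (Fin N) ℝ) :
    EuclideanSpace ℝ (Fin N) →L[ℝ] EuclideanSpace ℝ (Fin N) :=
  Matrix.toEuclideanCLM (n := Fin N) (𝕜 := ℝ) M

/-- The noise vector `∑_j a_{ij} f_{ji}(x_j - x_i) ξ_{ji}` entering the state recursion. -/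
def noise (f : Fin N → Fin N → ℝ → ℝ) (A : Matrix (Fin N) (Fin N) ℝ) (x : Fin N → ℝ)
    (z : EuclideanSpace ℝ (Fin N × Fin N)) : Fin N → ℝ :=
  fun i => ∑ j, A i j * f j i (x j - x i) * z (j, i)

theorem laplacian_mulVec (A : Matrix (Fin N) (Fin N) ℝ) (x : Fin N → ℝ) (i : Fin N) :
    (laplacian A).mulVec x i = ∑ j, A i j * (x i - x j) := by
  rw [laplacian, Matrix.sub_mulVec, Pi.sub_apply, Matrix.mulVec_diagonal, degIn, Finset.sum_mul]
  simp only [Matrix.mulVec, dotProduct, mul_sub, Finset.sum_sub_distrib]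

/-- The vector form of the algorithm. Sums over neighbours extend to all nodes because the other
weights vanish, and the differences x_j − x_i assemble into −L X. -/
theorem toE_state_succ {Ω : Type*} (c : ℕ → ℝ) (f : Fin N → Fin N → ℝ → ℝ)
    (A : ℕ → Ω → Matrix (Fin N) (Fin N) ℝ) (ξ : ℕ → Ω → EuclideanSpace ℝ (Fin N × Fin N))
    (X0 : Fin N → ℝ) (k : ℕ) (ω : Ω) :
    toE (state c f A ξ X0 (k + 1) ω) = toE (state c f A ξ X0 k ω) -
      c k • opE (laplacian (A k ω)) (toE (state c f A ξ X0 k ω)) +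
      c k • toE (noise f (A k ω) (state c f A ξ X0 k ω) (ξ k ω)) := by
  ext i
  rw [Matrix.toEuclideanCLM_toLp]
  simp only [PiLp.add_apply, PiLp.sub_apply, PiLp.smul_apply, smul_eq_mul, laplacian_mulVec,
    state, noise, measurement]
  have h : ∀ g : Fin N → ℝ, ∑ j ∈ nbrs (A k ω) i, A k ω i j * g j = ∑ j, A k ω i j * g j := by
    intro g
    refine Finset.sum_subset (Finset.subset_univ _) fun j _ hj => ?_
    have : A k ω i j = 0 := by simpa [nbrs] using hj
    simp [this]
  rw [h, sub_add, ← mul_sub, ← Finset.sum_sub_distrib, sub_eq_add_neg, ← mul_neg,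
    ← Finset.sum_neg_distrib]
  congr 2
  refine Finset.sum_congr rfl fun j _ => ?_
  ring

theorem norm_opE_le (M : Matrix (Fin N) (Fin N) ℝ) (u : EuclideanSpace ℝ (Fin N)) :
    ‖opE M u‖ ≤ norm2 M * ‖u‖ :=
  (opE M).le_opNorm u

theorem abs_apply_le_norm {ι : Type*} [Fintype ι] (u : EuclideanSpace ℝ ι) (i : ι) :
    |u i| ≤ ‖u‖ := by
  simpa using PiLp.norm_apply_le u i

theorem abs_entry_le_norm2 (M : Matrix (Fin N) (Fin N) ℝ) (i j : Fin N) : |M i j| ≤ norm2 M := by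
  have h := norm_opE_le M (EuclideanSpace.single j (1 : ℝ))
  rw [PiLp.norm_single, norm_one, mul_one] at h
  refine le_trans (le_of_eq ?_) ((abs_apply_le_norm _ i).trans h)
  simp [opE, Matrix.ofLp_toEuclideanCLM]

theorem inner_eq_sum (u v : EuclideanSpace ℝ (Fin N)) : inner ℝ u v = ∑ i, u i * v i := by
  simp [PiLp.inner_apply, mul_comm]

theorem opE_apply (M : Matrix (Fin N) (Fin N) ℝ) (u : EuclideanSpace ℝ (Fin N)) (i : Fin N) :
    opE M u i = ∑ j, M i j * u j := rfl

theorem inner_opE (M : Matrix (Fin N) (Fin N) ℝ) (u v : EuclideanSpace ℝ (Fin N)) :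
    inner ℝ u (opE M v) = ∑ i, ∑ j, u i * v j * M i j := by
  rw [inner_eq_sum]
  refine Finset.sum_congr rfl fun i _ => ?_
  rw [opE_apply, Finset.mul_sum]
  exact Finset.sum_congr rfl fun j _ => by ring

/-- An orthogonal projection that is absorbed by all generalized Laplacians. -/
structure IsAveraging (Q : EuclideanSpace ℝ (Fin N) →L[ℝ] EuclideanSpace ℝ (Fin N)) : Prop where
  inner_comm : ∀ u v, inner ℝ (Q u) v = inner ℝ u (Q v)
  idem : ∀ u, Q (Q u) = Q u
  laplacian_apply : ∀ A u, opE (laplacian A) (Q u) = opE (laplacian A) u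

/-- This trivial choice lets the same one-step expansion govern ‖X‖² as well as ‖PX‖². -/
theorem isAveraging_id :
    IsAveraging (ContinuousLinearMap.id ℝ (EuclideanSpace ℝ (Fin N))) :=
  ⟨fun _ _ => rfl, fun _ => rfl, fun _ _ => rfl⟩

theorem opE_projMatrix_apply (u : EuclideanSpace ℝ (Fin N)) (i : Fin N) :
    opE (projMatrix N) u i = u i - (1 / (N : ℝ)) * ∑ j, u j := by
  rw [opE_apply]
  simp [projMatrix, sub_mul, Finset.sum_sub_distrib, Matrix.one_apply, Finset.mul_sum]

theorem sum_opE_projMatrix (hN : N ≠ 0) (u : EuclideanSpace ℝ (Fin N)) :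
    ∑ i, opE (projMatrix N) u i = 0 := by
  have : (N : ℝ) ≠ 0 := Nat.cast_ne_zero.2 hN
  simp only [opE_projMatrix_apply, Finset.sum_sub_distrib, Finset.sum_const, Finset.card_univ,
    Fintype.card_fin, nsmul_eq_mul]
  field_simp
  ring

/-- The rows of a generalized Laplacian sum to zero, so it sees only differences of coordinates, and
`P` does not change these. -/
theorem isAveraging_projMatrix (hN : N ≠ 0) : IsAveraging (opE (projMatrix N)) where
  inner_comm u v := by
    simp only [inner_eq_sum, opE_projMatrix_apply, sub_mul, mul_sub, Finset.sum_sub_distrib]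
    rw [← Finset.mul_sum, ← Finset.sum_mul]
    ring
  idem u := by
    ext i
    rw [opE_projMatrix_apply, sum_opE_projMatrix hN]
    simp
  laplacian_apply A u := by
    ext i
    show (laplacian A).mulVec (opE (projMatrix N) u) i = (laplacian A).mulVec u i
    rw [laplacian_mulVec, laplacian_mulVec]
    simp [opE_projMatrix_apply]

theorem IsAveraging.inner_self {Q : EuclideanSpace ℝ (Fin N) →L[ℝ] EuclideanSpace ℝ (Fin N)}
    (hQ : IsAveraging Q) (u v : EuclideanSpace ℝ (Fin N)) :
    inner ℝ (Q u) (Q v) = inner ℝ (Q u) v := by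
  rw [← hQ.inner_comm, hQ.idem]

theorem IsAveraging.norm_le {Q : EuclideanSpace ℝ (Fin N) →L[ℝ] EuclideanSpace ℝ (Fin N)}
    (hQ : IsAveraging Q) (u : EuclideanSpace ℝ (Fin N)) : ‖Q u‖ ≤ ‖u‖ := by
  have h : ‖Q u‖ ^ 2 ≤ ‖Q u‖ * ‖u‖ := by
    rw [← real_inner_self_eq_norm_sq, hQ.inner_self]
    exact real_inner_le_norm _ _
  rcases (norm_nonneg (Q u)).eq_or_lt with h0 | h0
  · rw [← h0]; exact norm_nonneg u
  · rw [sq] at h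
    exact le_of_mul_le_mul_left h h0

/-- The one-step expansion of the squared norm of the averaged state. -/
theorem IsAveraging.norm_sq_step {Q : EuclideanSpace ℝ (Fin N) →L[ℝ] EuclideanSpace ℝ (Fin N)}
    (hQ : IsAveraging Q) (A : Matrix (Fin N) (Fin N) ℝ) (c : ℝ)
    (x w : EuclideanSpace ℝ (Fin N)) :
    ‖Q (x - c • opE (laplacian A) x + c • w)‖ ^ 2 =
      ‖Q x‖ ^ 2 - 2 * c * inner ℝ (Q x) (opE (laplacian A) (Q x)) +
      c ^ 2 * ‖Q (opE (laplacian A) (Q x))‖ ^ 2 + c ^ 2 * ‖Q w‖ ^ 2 +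
      2 * c * inner ℝ (Q x - c • Q (opE (laplacian A) (Q x))) w := by
  rw [← hQ.laplacian_apply A x]
  have h1 : Q (x - c • opE (laplacian A) (Q x) + c • w) =
      (Q x - c • Q (opE (laplacian A) (Q x))) + c • Q w := by
    simp [map_add, map_sub]
  -- The first argument lies in the range of `Q`, so self-adjointness and idempotence remove `Q`
  -- from the noise.
  have h2 : inner ℝ (Q x - c • Q (opE (laplacian A) (Q x))) (Q w) =
      inner ℝ (Q x - c • Q (opE (laplacian A) (Q x))) w := by
    rw [inner_sub_left, inner_sub_left, hQ.inner_self, real_inner_smul_left, real_inner_smul_left,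
      hQ.inner_self]
  rw [h1, norm_add_sq_real, real_inner_smul_right, h2, norm_sub_sq_real, real_inner_smul_right,
    hQ.inner_self, norm_smul, norm_smul, mul_pow, mul_pow, Real.norm_eq_abs, sq_abs]
  ring

theorem energy_eq (x : Fin N → ℝ) : energy x = ‖opE (projMatrix N) (toE x)‖ ^ 2 := rfl

theorem energy_nonneg (x : Fin N → ℝ) : 0 ≤ energy x := sq_nonneg _

/-- Two coordinates of PX contribute at most the energy, and (s − t)² ≤ 2(s² + t²). This 2, together
with the one from squaring σ|x| + b, makes the 4σ² of the theorem. -/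
theorem sq_sub_le_energy (x : Fin N → ℝ) (i j : Fin N) : (x j - x i) ^ 2 ≤ 2 * energy x := by
  by_cases hij : i = j
  · subst hij
    simpa using energy_nonneg x
  have h1 : x j - x i = opE (projMatrix N) (toE x) j - opE (projMatrix N) (toE x) i := by
    rw [opE_projMatrix_apply, opE_projMatrix_apply, sub_sub_sub_cancel_right]
  have h2 : opE (projMatrix N) (toE x) i ^ 2 + opE (projMatrix N) (toE x) j ^ 2 ≤ energy x := by
    rw [energy_eq, EuclideanSpace.real_norm_sq_eq, ← Finset.sum_pair hij
      (f := fun i => opE (projMatrix N) (toE x) i ^ 2)]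
    exact Finset.sum_le_sum_of_subset_of_nonneg (Finset.subset_univ _) fun _ _ _ => sq_nonneg _
  rw [h1]
  nlinarith [sq_nonneg (opE (projMatrix N) (toE x) j + opE (projMatrix N) (toE x) i)]

theorem le_maxPair (s : Fin N → Fin N → ℝ) (i j : Fin N) : s i j ≤ maxPair s :=
  le_ciSup (f := fun p : Fin N × Fin N => s p.1 p.2) (Set.finite_range _).bddAbove (i, j)

theorem maxPair_sq_nonneg (A : Matrix (Fin N) (Fin N) ℝ) : 0 ≤ maxPair fun i j => A i j ^ 2 :=
  Real.iSup_nonneg fun _ => sq_nonneg _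

theorem edgeWeight_nonneg (A : Matrix (Fin N) (Fin N) ℝ) : 0 ≤ edgeWeight A :=
  mul_nonneg (Nat.cast_nonneg _) (maxPair_sq_nonneg A)

/-- Bound for the noise intensity on the states of energy `V`. -/
theorem sq_intensity_le {f : Fin N → Fin N → ℝ → ℝ} {σ b : Fin N → Fin N → ℝ}
    (hf : IntensityGrowth f σ b) (x : Fin N → ℝ) (i j : Fin N) :
    f j i (x j - x i) ^ 2 ≤ 4 * maxPair σ ^ 2 * energy x + 2 * maxPair b ^ 2 := by
  obtain ⟨-, hσ, hb, hle⟩ := hf j i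
  have h1 : |f j i (x j - x i)| ≤ maxPair σ * |x j - x i| + maxPair b :=
    (hle _).trans (add_le_add (mul_le_mul_of_nonneg_right (le_maxPair σ j i) (abs_nonneg _))
      (le_maxPair b j i))
  have h2 := pow_le_pow_left₀ (abs_nonneg _) h1 2
  rw [sq_abs] at h2
  have h3 := sq_sub_le_energy x i j
  have h4 : (maxPair σ * |x j - x i|) ^ 2 ≤ maxPair σ ^ 2 * (2 * energy x) := by
    rw [mul_pow, sq_abs]
    exact mul_le_mul_of_nonneg_left h3 (sq_nonneg _)
  nlinarith [sq_nonneg (maxPair σ * |x j - x i| - maxPair b)]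

/-! ### Pathwise bounds of the noise by edge count and largest squared weight -/

section NoiseBound

variable {f : Fin N → Fin N → ℝ → ℝ} {σ b : Fin N → Fin N → ℝ}

theorem sq_noise_term_le (hf : IntensityGrowth f σ b) (A : Matrix (Fin N) (Fin N) ℝ)
    (x : Fin N → ℝ) (z : EuclideanSpace ℝ (Fin N × Fin N)) (i j : Fin N) :
    (A i j * f j i (x j - x i) * z (j, i)) ^ 2 ≤
      (maxPair fun i j => A i j ^ 2) *
        (4 * maxPair σ ^ 2 * energy x + 2 * maxPair b ^ 2) * z (j, i) ^ 2 := by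
  rw [mul_pow, mul_pow]
  refine mul_le_mul_of_nonneg_right ?_ (sq_nonneg _)
  exact mul_le_mul (le_maxPair (fun i j => A i j ^ 2) i j) (sq_intensity_le hf x i j)
    (sq_nonneg _) (maxPair_sq_nonneg A)

theorem sum_sq_noise_term_le (hf : IntensityGrowth f σ b) (A : Matrix (Fin N) (Fin N) ℝ)
    (x : Fin N → ℝ) (z : EuclideanSpace ℝ (Fin N × Fin N)) :
    ∑ i, ∑ j, (A i j * f j i (x j - x i) * z (j, i)) ^ 2 ≤
      (maxPair fun i j => A i j ^ 2) *
        (4 * maxPair σ ^ 2 * energy x + 2 * maxPair b ^ 2) * ‖z‖ ^ 2 := by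
  have h : ‖z‖ ^ 2 = ∑ i, ∑ j, z (j, i) ^ 2 := by
    rw [EuclideanSpace.real_norm_sq_eq, Fintype.sum_prod_type_right]
  rw [h, Finset.mul_sum]
  refine Finset.sum_le_sum fun i _ => ?_
  rw [Finset.mul_sum]
  exact Finset.sum_le_sum fun j _ => sq_noise_term_le hf A x z i j

/-- A nonzero term comes from an edge, so the edge count is at least 1. Single terms thus share the
dominating function of the whole noise vector. -/
theorem sq_noise_term_le_edgeWeight (hf : IntensityGrowth f σ b) (A : Matrix (Fin N) (Fin N) ℝ)
    (x : Fin N → ℝ) (z : EuclideanSpace ℝ (Fin N × Fin N)) (i j : Fin N) :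
    (A i j * f j i (x j - x i) * z (j, i)) ^ 2 ≤
      edgeWeight A * ((4 * maxPair σ ^ 2 * energy x + 2 * maxPair b ^ 2) * ‖z‖ ^ 2) := by
  have hK : 0 ≤ (4 * maxPair σ ^ 2 * energy x + 2 * maxPair b ^ 2) * ‖z‖ ^ 2 := by
    have := energy_nonneg x
    positivity
  by_cases hA : A i j = 0
  · rw [hA]
    simpa using mul_nonneg (edgeWeight_nonneg A) hK
  have hcard : (1 : ℝ) ≤ (edges A).card := by
    have : 0 < (edges A).card := Finset.card_pos.2 ⟨(j, i), by simpa [edges] using hA⟩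
    exact_mod_cast this
  have h1 : (A i j * f j i (x j - x i) * z (j, i)) ^ 2 ≤
      ∑ i, ∑ j, (A i j * f j i (x j - x i) * z (j, i)) ^ 2 :=
    (Finset.single_le_sum (f := fun j => (A i j * f j i (x j - x i) * z (j, i)) ^ 2)
      (fun _ _ => sq_nonneg _) (Finset.mem_univ j)).trans
      (Finset.single_le_sum (f := fun i => ∑ j, (A i j * f j i (x j - x i) * z (j, i)) ^ 2)
        (fun _ _ => Finset.sum_nonneg fun _ _ => sq_nonneg _) (Finset.mem_univ i))
  refine h1.trans ((sum_sq_noise_term_le hf A x z).trans ?_)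
  rw [edgeWeight, mul_assoc (maxPair _), mul_assoc (Nat.cast _)]
  exact le_mul_of_one_le_left (mul_nonneg (maxPair_sq_nonneg A) hK) hcard

/-- Cauchy–Schwarz over the neighbours of each node, whose number is at most the number of edges. -/
theorem norm_sq_noise_le (hf : IntensityGrowth f σ b) (A : Matrix (Fin N) (Fin N) ℝ)
    (x : Fin N → ℝ) (z : EuclideanSpace ℝ (Fin N × Fin N)) :
    ‖toE (noise f A x z)‖ ^ 2 ≤
      edgeWeight A * ((4 * maxPair σ ^ 2 * energy x + 2 * maxPair b ^ 2) * ‖z‖ ^ 2) := by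
  have h1 : ‖toE (noise f A x z)‖ ^ 2 ≤ (edges A).card *
      ∑ i, ∑ j, (A i j * f j i (x j - x i) * z (j, i)) ^ 2 := by
    rw [EuclideanSpace.real_norm_sq_eq, Finset.mul_sum]
    refine Finset.sum_le_sum fun i _ => ?_
    have hcard : ((nbrs A i).card : ℝ) ≤ (edges A).card := by
      have : (nbrs A i).card ≤ (edges A).card :=
        Finset.card_le_card_of_injOn (fun j => (j, i)) (fun j hj => by
          simpa [nbrs, edges] using hj) fun j _ j' _ h => (Prod.mk.inj h).1
      exact_mod_cast this
    have hsum : noise f A x z i = ∑ j ∈ nbrs A i, A i j * f j i (x j - x i) * z (j, i) := by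
      refine (Finset.sum_subset (Finset.subset_univ _) fun j _ hj => ?_).symm
      have : A i j = 0 := by simpa [nbrs] using hj
      simp [this]
    show noise f A x z i ^ 2 ≤ _
    rw [hsum]
    refine sq_sum_le_card_mul_sum_sq.trans ?_
    refine mul_le_mul hcard ?_ (Finset.sum_nonneg fun _ _ => sq_nonneg _) (Nat.cast_nonneg _)
    exact Finset.sum_le_sum_of_subset_of_nonneg (Finset.subset_univ _) fun _ _ _ => sq_nonneg _
  refine h1.trans ?_
  rw [edgeWeight, mul_assoc, ← mul_assoc (maxPair _)]
  exact mul_le_mul_of_nonneg_left (sum_sq_noise_term_le hf A x z) (Nat.cast_nonneg _)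

/-- Cauchy–Schwarz is applied once, over all edges; passing through ‖w‖² would cost an additional
factor N in the variance bound. -/
theorem sq_sum_noise_le (hf : IntensityGrowth f σ b) (A : Matrix (Fin N) (Fin N) ℝ)
    (x : Fin N → ℝ) (z : EuclideanSpace ℝ (Fin N × Fin N)) :
    (∑ i, noise f A x z i) ^ 2 ≤
      edgeWeight A * ((4 * maxPair σ ^ 2 * energy x + 2 * maxPair b ^ 2) * ‖z‖ ^ 2) := by
  have hsum : ∑ i, noise f A x z i =
      ∑ p ∈ edges A, A p.2 p.1 * f p.1 p.2 (x p.1 - x p.2) * z (p.1, p.2) := by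
    have h : ∑ p ∈ edges A, A p.2 p.1 * f p.1 p.2 (x p.1 - x p.2) * z (p.1, p.2) =
        ∑ p : Fin N × Fin N, A p.2 p.1 * f p.1 p.2 (x p.1 - x p.2) * z (p.1, p.2) := by
      refine Finset.sum_subset (Finset.subset_univ _) fun p _ hp => ?_
      have : A p.2 p.1 = 0 := by simpa [edges] using hp
      simp [this]
    rw [h, Fintype.sum_prod_type_right]
    rfl
  rw [hsum]
  refine sq_sum_le_card_mul_sum_sq.trans ?_
  rw [edgeWeight, mul_assoc, ← mul_assoc (maxPair _)]
  refine mul_le_mul_of_nonneg_left ?_ (Nat.cast_nonneg _)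
  refine le_trans ?_ (sum_sq_noise_term_le hf A x z)
  rw [← Fintype.sum_prod_type_right
    (f := fun p : Fin N × Fin N => (A p.2 p.1 * f p.1 p.2 (x p.1 - x p.2) * z (p.1, p.2)) ^ 2)]
  exact Finset.sum_le_sum_of_subset_of_nonneg (Finset.subset_univ _) fun _ _ _ => sq_nonneg _

end NoiseBound

/-- Off-diagonal weights are entries of −L. Self-loops cancel in L, so their squares have to be
added separately. -/
theorem sq_entry_le (A : Matrix (Fin N) (Fin N) ℝ) (i j : Fin N) :
    A i j ^ 2 ≤ norm2 (laplacian A) ^ 2 + ∑ i, A i i ^ 2 := by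
  by_cases hij : i = j
  · subst hij
    exact (Finset.single_le_sum (f := fun i => A i i ^ 2) (fun _ _ => sq_nonneg _)
      (Finset.mem_univ i)).trans (le_add_of_nonneg_left (sq_nonneg _))
  · have h : laplacian A i j = -A i j := by simp [laplacian, Matrix.diagonal_apply_ne _ hij]
    have h2 := abs_entry_le_norm2 (laplacian A) i j
    rw [h, abs_neg] at h2
    have h3 := pow_le_pow_left₀ (abs_nonneg _) h2 2
    rw [sq_abs] at h3
    exact h3.trans (le_add_of_nonneg_right (Finset.sum_nonneg fun _ _ => sq_nonneg _))

theorem edgeWeight_le (A : Matrix (Fin N) (Fin N) ℝ) :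
    edgeWeight A ≤ (N : ℝ) ^ 2 * (norm2 (laplacian A) ^ 2 + ∑ i, A i i ^ 2) := by
  have h0 : 0 ≤ norm2 (laplacian A) ^ 2 + ∑ i, A i i ^ 2 :=
    add_nonneg (sq_nonneg _) (Finset.sum_nonneg fun _ _ => sq_nonneg _)
  refine mul_le_mul ?_ (Real.iSup_le (fun p => sq_entry_le A p.1 p.2) h0) (maxPair_sq_nonneg A)
    (sq_nonneg _)
  have : (edges A).card ≤ N ^ 2 := by
    refine (Finset.card_le_univ _).trans (le_of_eq ?_)
    simp [sq]
  exact_mod_cast this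

theorem sum_laplacian_col (A : Matrix (Fin N) (Fin N) ℝ) (j : Fin N) :
    ∑ i, laplacian A i j = degIn A j - degOut A j := by
  simp [laplacian, Finset.sum_sub_distrib, Matrix.diagonal_apply, degOut]

theorem sq_degIn_sub_degOut_le (A : Matrix (Fin N) (Fin N) ℝ) (i : Fin N) :
    (degIn A i - degOut A i) ^ 2 ≤ (N : ℝ) ^ 2 * norm2 (laplacian A) ^ 2 := by
  rw [← sum_laplacian_col, ← mul_pow, ← sq_abs]
  refine pow_le_pow_left₀ (abs_nonneg _) ((Finset.abs_sum_le_sum_abs _ _).trans ?_) 2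
  refine (Finset.sum_le_sum fun j _ => abs_entry_le_norm2 (laplacian A) j i).trans ?_
  simp

theorem sum_opE_laplacian (A : Matrix (Fin N) (Fin N) ℝ) (u : EuclideanSpace ℝ (Fin N)) :
    ∑ i, opE (laplacian A) u i = ∑ j, (degIn A j - degOut A j) * u j := by
  simp_rw [opE_apply]
  rw [Finset.sum_comm]
  exact Finset.sum_congr rfl fun j _ => by rw [← Finset.sum_mul, sum_laplacian_col]

theorem sq_sum_opE_laplacian_le (A : Matrix (Fin N) (Fin N) ℝ) (u : EuclideanSpace ℝ (Fin N)) :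
    (∑ i, opE (laplacian A) u i) ^ 2 ≤ (∑ j, (degIn A j - degOut A j) ^ 2) * ‖u‖ ^ 2 := by
  rw [sum_opE_laplacian, EuclideanSpace.real_norm_sq_eq]
  exact Finset.sum_mul_sq_le_sq_mul_sq _ _ _

end Deterministic

/-! ### The spectral gap of the mean Laplacian -/

section Spectral

variable {N : ℕ}

theorem transpose_eq_self {M : Matrix (Fin N) (Fin N) ℝ} (hM : M.IsHermitian) :
    M.transpose = M := by
  simpa [Matrix.IsHermitian] using hM

theorem inner_opE_comm {M : Matrix (Fin N) (Fin N) ℝ} (hM : M.IsHermitian)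
    (u v : EuclideanSpace ℝ (Fin N)) : inner ℝ u (opE M v) = inner ℝ (opE M u) v := by
  rw [real_inner_comm v (opE M u), inner_opE, inner_opE, Finset.sum_comm]
  refine Finset.sum_congr rfl fun i _ => Finset.sum_congr rfl fun j _ => ?_
  have : M j i = M i j := by
    conv_lhs => rw [← transpose_eq_self hM]
    rfl
  rw [this, mul_comm (u j)]

theorem opE_eigenvectorBasis {M : Matrix (Fin N) (Fin N) ℝ} (hM : M.IsHermitian) (i : Fin N) :
    opE M (hM.eigenvectorBasis i) = hM.eigenvalues i • hM.eigenvectorBasis i := by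
  ext j
  exact congrFun (hM.mulVec_eigenvectorBasis i) j

theorem inner_opE_eq_sum_eigenvalues {M : Matrix (Fin N) (Fin N) ℝ} (hM : M.IsHermitian)
    (u : EuclideanSpace ℝ (Fin N)) :
    inner ℝ u (opE M u) = ∑ i, hM.eigenvalues i * inner ℝ (hM.eigenvectorBasis i) u ^ 2 := by
  rw [← OrthonormalBasis.sum_inner_mul_inner hM.eigenvectorBasis]
  refine Finset.sum_congr rfl fun i _ => ?_
  rw [inner_opE_comm hM, opE_eigenvectorBasis, real_inner_smul_left,
    real_inner_comm]
  ring

theorem eigenvalues_eq_inner {M : Matrix (Fin N) (Fin N) ℝ} (hM : M.IsHermitian) (i : Fin N) :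
    hM.eigenvalues i = inner ℝ (hM.eigenvectorBasis i) (opE M (hM.eigenvectorBasis i)) := by
  rw [opE_eigenvectorBasis, real_inner_smul_right, real_inner_self_eq_norm_sq,
    hM.eigenvectorBasis.norm_eq_one]
  simp

section Gap

variable (hN : 2 ≤ N) {M : Matrix (Fin N) (Fin N) ℝ} (hM : M.IsHermitian)
  (hone : opE M (toE fun _ => 1) = 0) (hpos : ∀ u, 0 ≤ inner ℝ u (opE M u))
  (hker : ∀ u, inner ℝ u (opE M u) = 0 → ∀ i j, u i = u j)

include hpos hker in
-- If the second smallest eigenvalue vanished, two orthonormal eigenvectors would have zero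
-- quadratic form and hence be constant vectors; nonzero constant vectors are never orthogonal.
theorem lambda2_pos : 0 < lambda2 hN hM := by
  let e : Fin (Fintype.card (Fin N)) ≃ Fin N := Fintype.equivOfCardEq (Fintype.card_fin _)
  have hev : ∀ k, hM.eigenvalues (e k) = hM.eigenvalues₀ k := fun k => by
    simp [Matrix.IsHermitian.eigenvalues, e]
  have h0 : ∀ k, 0 ≤ hM.eigenvalues₀ k := fun k => by
    rw [← hev, eigenvalues_eq_inner]
    exact hpos _
  by_contra hle
  -- Eigenvalues are listed in decreasing order: index N − 2 is the second smallest, N − 1 the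
  -- smallest.
  let k₁ : Fin (Fintype.card (Fin N)) := ⟨N - 2, by rw [Fintype.card_fin]; omega⟩
  let k₀ : Fin (Fintype.card (Fin N)) := ⟨N - 1, by rw [Fintype.card_fin]; omega⟩
  have h1 : hM.eigenvalues₀ k₁ = 0 := le_antisymm (not_lt.1 hle) (h0 _)
  have h2 : hM.eigenvalues₀ k₀ = 0 := le_antisymm
    ((hM.eigenvalues₀_antitone (Fin.mk_le_mk.2 (by omega : N - 2 ≤ N - 1))).trans h1.le) (h0 _)
  have hne : e k₁ ≠ e k₀ := fun h => by
    have h' : N - 2 = N - 1 := Fin.mk.inj (e.injective h)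
    omega
  have hconst : ∀ k, hM.eigenvalues₀ k = 0 → ∀ i j, hM.eigenvectorBasis (e k) i =
      hM.eigenvectorBasis (e k) j := fun k hk =>
    hker _ (by rw [← eigenvalues_eq_inner, hev, hk])
  have hzero : ∀ k, hM.eigenvalues₀ k = 0 →
      hM.eigenvectorBasis (e k) ⟨0, by omega⟩ ≠ 0 := by
    intro k hk h
    have hn := hM.eigenvectorBasis.norm_eq_one (e k)
    have : hM.eigenvectorBasis (e k) = 0 := by
      ext i
      rw [hconst k hk i ⟨0, by omega⟩, h]
      rfl
    rw [this, norm_zero] at hn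
    exact zero_ne_one hn
  have horth := hM.eigenvectorBasis.inner_eq_zero hne
  rw [inner_eq_sum, Finset.sum_congr rfl fun i _ => by
    rw [hconst k₁ h1 i ⟨0, by omega⟩, hconst k₀ h2 i ⟨0, by omega⟩]] at horth
  rw [Finset.sum_const, Finset.card_univ, nsmul_eq_mul] at horth
  have hN0 : (Fintype.card (Fin N) : ℝ) ≠ 0 :=
    Nat.cast_ne_zero.2 (by rw [Fintype.card_fin]; omega)
  exact mul_ne_zero hN0 (mul_ne_zero (hzero k₁ h1) (hzero k₀ h2)) horth

include hone hpos hker in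
-- The constant vector is killed by `M`, hence orthogonal to every eigenvector with eigenvalue at
-- least λ₂ > 0, hence a multiple of the last one. A vector of zero sum is then orthogonal to that
-- one and expands over eigenvalues at least λ₂.
theorem lambda2_mul_le (u : EuclideanSpace ℝ (Fin N)) (hu : ∑ i, u i = 0) :
    lambda2 hN hM * ‖u‖ ^ 2 ≤ inner ℝ u (opE M u) := by
  have hpos2 := lambda2_pos hN hM hpos hker
  let e : Fin (Fintype.card (Fin N)) ≃ Fin N := Fintype.equivOfCardEq (Fintype.card_fin _)
  have hev : ∀ k, hM.eigenvalues (e k) = hM.eigenvalues₀ k := fun k => by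
    simp [Matrix.IsHermitian.eigenvalues, e]
  let k₀ : Fin (Fintype.card (Fin N)) := ⟨N - 1, by rw [Fintype.card_fin]; omega⟩
  have hge : ∀ i, i ≠ e k₀ → lambda2 hN hM ≤ hM.eigenvalues i := by
    intro i hi
    obtain ⟨k, rfl⟩ := e.surjective i
    rw [hev]
    refine hM.eigenvalues₀_antitone (Fin.le_def.2 ?_)
    have h1 : k.1 < N := by simpa using k.2
    have h2 : k.1 ≠ N - 1 := fun h => hi (congrArg e (Fin.ext h))
    show k.1 ≤ N - 2
    omega
  have hone_orth : ∀ i, i ≠ e k₀ → inner ℝ (hM.eigenvectorBasis i) (toE fun _ => (1 : ℝ)) = 0 := by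
    intro i hi
    have h1 : inner ℝ (opE M (hM.eigenvectorBasis i)) (toE fun _ => (1 : ℝ)) = 0 := by
      rw [← inner_opE_comm hM, hone, inner_zero_right]
    rw [opE_eigenvectorBasis, real_inner_smul_left] at h1
    exact (mul_eq_zero.1 h1).resolve_left (hpos2.trans_le (hge i hi)).ne'
  have hexp : (inner ℝ (hM.eigenvectorBasis (e k₀)) (toE fun _ => (1 : ℝ)) : ℝ) •
      hM.eigenvectorBasis (e k₀) = toE fun _ => (1 : ℝ) := by
    rw [← hM.eigenvectorBasis.sum_repr' (toE fun _ => (1 : ℝ))]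
    rw [Finset.sum_eq_single (e k₀) (fun i _ hi => by rw [hone_orth i hi, zero_smul]) (by simp)]
    rw [real_inner_smul_right, real_inner_self_eq_norm_sq, hM.eigenvectorBasis.norm_eq_one]
    simp
  have hu0 : inner ℝ (hM.eigenvectorBasis (e k₀)) u = 0 := by
    have h1 : inner ℝ (toE fun _ => (1 : ℝ)) u = 0 := by
      rw [inner_eq_sum]
      simpa using hu
    rw [← hexp, real_inner_smul_left] at h1
    refine (mul_eq_zero.1 h1).resolve_left fun h => ?_
    rw [h, zero_smul] at hexp
    have h3 : (0 : ℝ) = 1 := congrArg (fun w : EuclideanSpace ℝ (Fin N) => w ⟨0, by omega⟩) hexp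
    exact zero_ne_one h3
  rw [inner_opE_eq_sum_eigenvalues hM, ← OrthonormalBasis.sum_sq_inner_right hM.eigenvectorBasis,
    Finset.mul_sum]
  refine Finset.sum_le_sum fun i _ => ?_
  by_cases hi : i = e k₀
  · rw [hi, hu0]
    simp
  · exact mul_le_mul_of_nonneg_right (hge i hi) (sq_nonneg _)

end Gap

theorem inner_opE_symPart (M : Matrix (Fin N) (Fin N) ℝ) (u : EuclideanSpace ℝ (Fin N)) :
    inner ℝ u (opE (symPart M) u) = inner ℝ u (opE M u) := by
  have h : ∑ i, ∑ j, u i * u j * M j i = ∑ i, ∑ j, u i * u j * M i j := by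
    rw [Finset.sum_comm]
    exact Finset.sum_congr rfl fun i _ => Finset.sum_congr rfl fun j _ => by ring
  rw [inner_opE, inner_opE]
  calc ∑ i, ∑ j, u i * u j * symPart M i j
      = (1 / 2) * (∑ i, ∑ j, u i * u j * M i j) + (1 / 2) * ∑ i, ∑ j, u i * u j * M j i := by
        simp only [Finset.mul_sum, ← Finset.sum_add_distrib]
        refine Finset.sum_congr rfl fun i _ => Finset.sum_congr rfl fun j _ => ?_
        simp [symPart]
        ring
    _ = _ := by rw [h]; ring

/-! ### The quadratic form of a balanced Laplacian -/

section Balanced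

variable {B : Matrix (Fin N) (Fin N) ℝ}

/-- Balance makes ∑ b_ij u_j² equal to ∑ b_ij u_i², which completes the squares. -/
theorem inner_opE_laplacian (hB : Balanced B) (u : EuclideanSpace ℝ (Fin N)) :
    inner ℝ u (opE (laplacian B) u) = (1 / 2) * ∑ i, ∑ j, B i j * (u i - u j) ^ 2 := by
  have h1 : inner ℝ u (opE (laplacian B) u) =
      ∑ i, ∑ j, B i j * u i ^ 2 - ∑ i, ∑ j, B i j * (u i * u j) := by
    rw [inner_eq_sum, ← Finset.sum_sub_distrib]
    refine Finset.sum_congr rfl fun i _ => ?_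
    show u i * (laplacian B).mulVec u i = _
    rw [laplacian_mulVec, Finset.mul_sum, ← Finset.sum_sub_distrib]
    exact Finset.sum_congr rfl fun j _ => by ring
  have h2 : ∑ i, ∑ j, B i j * u j ^ 2 = ∑ i, ∑ j, B i j * u i ^ 2 := by
    rw [Finset.sum_comm]
    refine Finset.sum_congr rfl fun i _ => ?_
    rw [← Finset.sum_mul, ← Finset.sum_mul]
    have : ∑ j, B i j = ∑ j, B j i := hB i
    rw [this]
  have h3 : ∑ i, ∑ j, B i j * (u i - u j) ^ 2 = ∑ i, ∑ j, B i j * u i ^ 2 -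
      2 * ∑ i, ∑ j, B i j * (u i * u j) + ∑ i, ∑ j, B i j * u j ^ 2 := by
    simp only [Finset.mul_sum, ← Finset.sum_sub_distrib, ← Finset.sum_add_distrib]
    exact Finset.sum_congr rfl fun i _ => Finset.sum_congr rfl fun j _ => by ring
  rw [h1, h3, h2]
  ring

theorem inner_opE_laplacian_nonneg (hB : Balanced B) (h0 : ∀ i j, 0 ≤ B i j)
    (u : EuclideanSpace ℝ (Fin N)) : 0 ≤ inner ℝ u (opE (laplacian B) u) := by
  rw [inner_opE_laplacian hB]
  exact mul_nonneg (by norm_num) (Finset.sum_nonneg fun i _ => Finset.sum_nonneg fun j _ =>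
    mul_nonneg (h0 i j) (sq_nonneg _))

/-- All terms of the sum of squares vanish, so `u` agrees at the ends of every edge, and directed
paths carry the value at the root to all nodes. -/
theorem eq_of_inner_opE_laplacian_eq_zero (hB : Balanced B) (h0 : ∀ i j, 0 ≤ B i j)
    (htree : HasSpanningTree (laplacianEdge (laplacian B))) (u : EuclideanSpace ℝ (Fin N))
    (hu : inner ℝ u (opE (laplacian B) u) = 0) (i j : Fin N) : u i = u j := by
  rw [inner_opE_laplacian hB] at hu
  have hu' : ∑ i, ∑ j, B i j * (u i - u j) ^ 2 = 0 := by linarith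
  have hterm : ∀ i j, B i j * (u i - u j) ^ 2 = 0 := by
    intro i j
    have hnn : ∀ i j, 0 ≤ B i j * (u i - u j) ^ 2 := fun i j =>
      mul_nonneg (h0 i j) (sq_nonneg _)
    rw [Finset.sum_eq_zero_iff_of_nonneg fun i _ => Finset.sum_nonneg fun j _ => hnn i j] at hu'
    exact (Finset.sum_eq_zero_iff_of_nonneg fun j _ => hnn i j).1 (hu' i (Finset.mem_univ i)) j
      (Finset.mem_univ j)
  obtain ⟨T, r, hT, -, -, hreach⟩ := htree
  have hroot : ∀ i, u i = u r := by
    intro i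
    induction hreach i with
    | refl => rfl
    | tail _ hstep ih =>
      obtain ⟨hne, hL⟩ := hT _ _ hstep
      rw [laplacian, Matrix.sub_apply, Matrix.diagonal_apply_ne' _ hne, zero_sub,
        neg_ne_zero] at hL
      have := pow_eq_zero_iff (two_ne_zero) |>.1 ((mul_eq_zero.1 (hterm _ _)).resolve_left hL)
      rw [← ih]
      linarith
  rw [hroot i, hroot j]

/-- Row sums always vanish; balance makes the column sums vanish too. -/
theorem opE_symPart_laplacian_one (hB : Balanced B) :
    opE (symPart (laplacian B)) (toE fun _ => 1) = 0 := by
  ext i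
  have h1 : ∑ j, laplacian B i j = 0 := by
    simp [laplacian, Finset.sum_sub_distrib, Matrix.diagonal_apply, degIn]
  have h2 : ∑ j, laplacian B j i = 0 := by
    rw [sum_laplacian_col, hB i, sub_self]
  rw [opE_apply]
  simp only [symPart, Matrix.smul_apply, Matrix.add_apply, Matrix.transpose_apply, smul_eq_mul,
    mul_one, ← Finset.mul_sum, Finset.sum_add_distrib, h1, h2]
  simp

end Balanced

end Spectral

/-! ### Mean matrices -/

section Mean

variable {N : ℕ} {Ω : Type*} [MeasurableSpace Ω] {μ : Measure Ω}
  {A : Ω → Matrix (Fin N) (Fin N) ℝ}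

theorem integrable_laplacian (hA : ∀ i j, Integrable (fun ω => A ω i j) μ) (i j : Fin N) :
    Integrable (fun ω => laplacian (A ω) i j) μ := by
  by_cases h : i = j
  · subst h
    simp only [laplacian, Matrix.sub_apply, Matrix.diagonal_apply_eq, degIn]
    exact (integrable_finsetSum _ fun j _ => hA i j).sub (hA i i)
  · simp only [laplacian, Matrix.sub_apply, Matrix.diagonal_apply_ne _ h, zero_sub]
    exact (hA i j).neg

theorem meanMatrix_laplacian (hA : ∀ i j, Integrable (fun ω => A ω i j) μ) :
    (meanMatrix μ fun ω => laplacian (A ω)) = laplacian (meanMatrix μ A) := by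
  ext i j
  by_cases h : i = j
  · subst h
    simp only [meanMatrix, laplacian, Matrix.sub_apply, Matrix.diagonal_apply_eq, degIn,
      Matrix.of_apply]
    rw [integral_sub (integrable_finsetSum _ fun j _ => hA i j) (hA i i),
      integral_finsetSum _ fun j _ => hA i j]
  · simp only [meanMatrix, laplacian, Matrix.sub_apply, Matrix.diagonal_apply_ne _ h, zero_sub,
      Matrix.of_apply, integral_neg]

theorem meanSymLaplacian_eq (hA : ∀ i j, Integrable (fun ω => A ω i j) μ) :
    meanSymLaplacian μ A = symPart (laplacian (meanMatrix μ A)) := by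
  rw [← meanMatrix_laplacian hA]
  ext i j
  simp only [meanSymLaplacian, meanMatrix, symPart, Matrix.smul_apply, Matrix.add_apply,
    Matrix.transpose_apply, Matrix.of_apply, smul_eq_mul]
  rw [integral_const_mul,
    integral_add (integrable_laplacian hA i j) (integrable_laplacian hA j i)]

section Gap

variable (hA : ∀ i j, Integrable (fun ω => A ω i j) μ) (h0 : ∀ i j, 0 ≤ meanMatrix μ A i j)
  (hB : Balanced (meanMatrix μ A))
  (htree : HasSpanningTree (laplacianEdge (meanMatrix μ fun ω => laplacian (A ω))))
  (hN : 2 ≤ N)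

include hA h0 hB htree in
theorem lambda2_meanSymLaplacian_pos : 0 < lambda2 hN (meanSymLaplacian_isHermitian μ A) := by
  rw [meanMatrix_laplacian hA] at htree
  refine lambda2_pos hN _ (fun u => ?_) (fun u hu => ?_)
  · rw [meanSymLaplacian_eq hA, inner_opE_symPart]
    exact inner_opE_laplacian_nonneg hB h0 u
  · rw [meanSymLaplacian_eq hA, inner_opE_symPart] at hu
    exact eq_of_inner_opE_laplacian_eq_zero hB h0 htree u hu

include hA h0 hB htree in
theorem lambda2_meanSymLaplacian_mul_le (u : EuclideanSpace ℝ (Fin N)) (hu : ∑ i, u i = 0) :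
    lambda2 hN (meanSymLaplacian_isHermitian μ A) * ‖u‖ ^ 2 ≤
      inner ℝ u (opE (laplacian (meanMatrix μ A)) u) := by
  rw [meanMatrix_laplacian hA] at htree
  rw [← inner_opE_symPart, ← meanSymLaplacian_eq hA]
  refine lambda2_mul_le hN _ ?_ (fun u => ?_) (fun u hu => ?_) u hu
  · rw [meanSymLaplacian_eq hA]
    exact opE_symPart_laplacian_one hB
  · rw [meanSymLaplacian_eq hA, inner_opE_symPart]
    exact inner_opE_laplacian_nonneg hB h0 u
  · rw [meanSymLaplacian_eq hA, inner_opE_symPart] at hu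
    exact eq_of_inner_opE_laplacian_eq_zero hB h0 htree u hu

end Gap

end Mean

/-! ### Measurability -/

section Measurability

variable {N : ℕ}

instance matrixBorelSpace : BorelSpace (Matrix (Fin N) (Fin N) ℝ) :=
  inferInstanceAs (BorelSpace (Fin N → Fin N → ℝ))

theorem measurable_entry (i j : Fin N) :
    Measurable fun M : Matrix (Fin N) (Fin N) ℝ => M i j :=
  (measurable_pi_apply j).comp
    (measurable_pi_apply (X := fun _ : Fin N => Fin N → ℝ) i)

theorem measurable_coord {ι : Type*} [Fintype ι] (i : ι) :
    Measurable fun u : EuclideanSpace ℝ ι => u i :=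
  (EuclideanSpace.proj (𝕜 := ℝ) i).continuous.measurable

theorem measurable_toE : Measurable (toE : (Fin N → ℝ) → EuclideanSpace ℝ (Fin N)) :=
  WithLp.measurable_toLp 2 _

theorem measurable_laplacian_entry (i j : Fin N) :
    Measurable fun M : Matrix (Fin N) (Fin N) ℝ => laplacian M i j := by
  by_cases h : i = j
  · subst h
    simp only [laplacian, Matrix.sub_apply, Matrix.diagonal_apply_eq, degIn]
    exact (Finset.measurable_fun_sum _ fun j _ => measurable_entry i j).sub (measurable_entry i i)
  · simp only [laplacian, Matrix.sub_apply, Matrix.diagonal_apply_ne _ h, zero_sub]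
    exact (measurable_entry i j).neg

theorem measurable_laplacian :
    Measurable (laplacian : Matrix (Fin N) (Fin N) ℝ → Matrix (Fin N) (Fin N) ℝ) :=
  measurable_pi_lambda (X := fun _ : Fin N => Fin N → ℝ) _ fun i =>
    measurable_pi_lambda _ fun j => measurable_laplacian_entry i j

theorem measurable_norm2 : Measurable (norm2 : Matrix (Fin N) (Fin N) ℝ → ℝ) := by
  let T : Matrix (Fin N) (Fin N) ℝ →ₗ[ℝ]
      (EuclideanSpace ℝ (Fin N) →L[ℝ] EuclideanSpace ℝ (Fin N)) :=
    { toFun := fun M => opE M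
      map_add' := fun M M' => map_add _ M M'
      map_smul' := fun r M => map_smul _ r M }
  exact (continuous_norm.comp (LinearMap.continuous_of_finiteDimensional T)).measurable

theorem measurable_degIn_sub_degOut (i : Fin N) :
    Measurable fun M : Matrix (Fin N) (Fin N) ℝ => degIn M i - degOut M i :=
  (Finset.measurable_fun_sum _ fun j _ => measurable_entry i j).sub
    (Finset.measurable_fun_sum _ fun j _ => measurable_entry j i)

theorem measurable_edgeWeight : Measurable (edgeWeight : Matrix (Fin N) (Fin N) ℝ → ℝ) := by
  refine Measurable.mul ?_ (Measurable.iSup fun p => (measurable_entry p.1 p.2).pow_const 2)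
  simp only [edges, Finset.card_filter, Nat.cast_sum, Nat.cast_ite, Nat.cast_one, Nat.cast_zero]
  refine Finset.measurable_fun_sum _ fun p _ => Measurable.ite ?_ measurable_const measurable_const
  exact (measurable_entry p.2 p.1) (measurableSet_singleton 0).compl

theorem measurable_opE_laplacian {α : Type*} {m : MeasurableSpace α}
    {B : α → Matrix (Fin N) (Fin N) ℝ} {u : α → EuclideanSpace ℝ (Fin N)} (hB : Measurable B)
    (hu : Measurable u) : Measurable fun a => opE (laplacian (B a)) (u a) := by
  have h : (fun a => opE (laplacian (B a)) (u a)) =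
      fun a => toE fun i => ∑ j, laplacian (B a) i j * u a j := rfl
  rw [h]
  refine measurable_toE.comp (measurable_pi_lambda _ fun i =>
    Finset.measurable_fun_sum _ fun j _ => ?_)
  exact ((measurable_laplacian_entry i j).comp hB).mul ((measurable_coord j).comp hu)

theorem measurable_noise_coeff {f : Fin N → Fin N → ℝ → ℝ} (hf : ∀ j i, Measurable (f j i))
    (i j : Fin N) :
    Measurable fun q : Matrix (Fin N) (Fin N) ℝ × (Fin N → ℝ) =>
      q.1 i j * f j i (q.2 j - q.2 i) :=
  ((measurable_entry i j).comp measurable_fst).mul ((hf j i).comp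
    (((measurable_pi_apply j).comp measurable_snd).sub
      ((measurable_pi_apply i).comp measurable_snd)))

theorem measurable_noise {f : Fin N → Fin N → ℝ → ℝ} (hf : ∀ j i, Measurable (f j i)) :
    Measurable fun q : (Matrix (Fin N) (Fin N) ℝ × (Fin N → ℝ)) ×
      EuclideanSpace ℝ (Fin N × Fin N) => noise f q.1.1 q.1.2 q.2 := by
  refine measurable_pi_lambda _ fun i => Finset.measurable_fun_sum _ fun j _ => ?_
  exact ((measurable_noise_coeff hf i j).comp measurable_fst).mul
    ((measurable_coord (j, i)).comp measurable_snd)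

theorem measurable_energy : Measurable (energy : (Fin N → ℝ) → ℝ) :=
  ((((opE (projMatrix N)).continuous.measurable).comp measurable_toE).norm).pow_const 2

/-- The σ-algebra is arbitrary so that the state can be shown adapted to both filtrations. -/
theorem measurable_state {Ω : Type*} {m : MeasurableSpace Ω} {c : ℕ → ℝ}
    {f : Fin N → Fin N → ℝ → ℝ} {A : ℕ → Ω → Matrix (Fin N) (Fin N) ℝ}
    {ξ : ℕ → Ω → EuclideanSpace ℝ (Fin N × Fin N)} {X0 : Fin N → ℝ}
    (hf : ∀ j i, Measurable (f j i)) (k : ℕ) (hA : ∀ j < k, Measurable (A j))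
    (hξ : ∀ j < k, Measurable (ξ j)) : Measurable fun ω => state c f A ξ X0 k ω := by
  induction k with
  | zero => exact measurable_const
  | succ k ih =>
    have hx := ih (fun j hj => hA j (hj.trans k.lt_succ_self))
      fun j hj => hξ j (hj.trans k.lt_succ_self)
    have h : ∀ ω, state c f A ξ X0 (k + 1) ω = WithLp.ofLp
        (toE (state c f A ξ X0 k ω) - c k • opE (laplacian (A k ω)) (toE (state c f A ξ X0 k ω)) +
          c k • toE (noise f (A k ω) (state c f A ξ X0 k ω) (ξ k ω))) := fun ω => by
      rw [← toE_state_succ]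
    simp_rw [h]
    refine (WithLp.measurable_ofLp 2 _).comp ?_
    have hAk := hA k k.lt_succ_self
    refine ((measurable_toE.comp hx).sub (Measurable.const_smul
      (measurable_opE_laplacian hAk (measurable_toE.comp hx)) (c k))).add ?_
    exact (measurable_toE.comp ((measurable_noise hf).comp
      ((hAk.prodMk hx).prodMk (hξ k k.lt_succ_self)))).const_smul (c k)

end Measurability

/-! ### Filtrations -/

section Filtrations

variable {Ω E F : Type*} {mΩ : MeasurableSpace Ω} [MeasurableSpace E] [MeasurableSpace F]

/-- The σ-algebra generated by a whole process. -/
abbrev sigmaAll (Y : ℕ → Ω → E) : MeasurableSpace Ω :=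
  MeasurableSpace.comap (fun ω k => Y k ω) inferInstance

theorem measurable_sigmaAll (Y : ℕ → Ω → E) (k : ℕ) : Measurable[sigmaAll Y] (Y k) :=
  (measurable_pi_apply k).comp (comap_measurable fun ω k => Y k ω)

theorem sigmaAll_le {Y : ℕ → Ω → E} (hY : ∀ k, Measurable (Y k)) : sigmaAll Y ≤ mΩ :=
  (measurable_pi_lambda _ hY).comap_le

theorem measurable_past (Z : ℕ → Ω → F) {j k : ℕ} (h : j < k) : Measurable[past Z k] (Z j) :=
  (comap_measurable (Z j)).mono
    (le_iSup₂ (f := fun j (_ : j ∈ Finset.range k) => MeasurableSpace.comap (Z j) inferInstance)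
      j (Finset.mem_range.2 h)) le_rfl

theorem past_le_iff {Z : ℕ → Ω → F} {k : ℕ} {m : MeasurableSpace Ω} :
    past Z k ≤ m ↔ ∀ j < k, Measurable[m] (Z j) := by
  simp only [past, iSup_le_iff, Finset.mem_range, measurable_iff_comap_le]

theorem past_le_sigmaAll (Z : ℕ → Ω → F) (k : ℕ) : past Z k ≤ sigmaAll Z :=
  past_le_iff.2 fun j _ => measurable_sigmaAll Z j

/-- The filtration that knows all of the process `Y`, and `Z 0, …, Z (k - 1)` at time `k`. -/
def jointFiltration {Y : ℕ → Ω → E} {Z : ℕ → Ω → F} (hY : ∀ k, Measurable (Y k))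
    (hZ : ∀ k, Measurable (Z k)) : Filtration ℕ mΩ where
  seq k := sigmaAll Y ⊔ past Z k
  mono' _ _ hij := sup_le_sup_left
    (past_le_iff.2 fun _ hl => measurable_past Z (hl.trans_le hij)) _
  le' _ := sup_le (sigmaAll_le hY) (past_le_iff.2 fun j _ => hZ j)

theorem measurable_jointFiltration_left {Y : ℕ → Ω → E} {Z : ℕ → Ω → F}
    (hY : ∀ k, Measurable (Y k)) (hZ : ∀ k, Measurable (Z k)) (j k : ℕ) :
    Measurable[jointFiltration hY hZ k] (Y j) :=
  (measurable_sigmaAll Y j).mono le_sup_left le_rfl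

theorem measurable_jointFiltration_right {Y : ℕ → Ω → E} {Z : ℕ → Ω → F}
    (hY : ∀ k, Measurable (Y k)) (hZ : ∀ k, Measurable (Z k)) {j k : ℕ} (h : j < k) :
    Measurable[jointFiltration hY hZ k] (Z j) :=
  (measurable_past Z h).mono le_sup_right le_rfl

end Filtrations

/-! ### Moments of the algorithm -/

section Model

variable {Ω : Type*} {mΩ : MeasurableSpace Ω} {μ : Measure Ω} {N : ℕ}
  {A : ℕ → Ω → Matrix (Fin N) (Fin N) ℝ} {ξ : ℕ → Ω → EuclideanSpace ℝ (Fin N × Fin N)}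
  {f : Fin N → Fin N → ℝ → ℝ} {σ b : Fin N → Fin N → ℝ} {β : ℝ}

theorem lapSq_nonneg (B : Ω → Matrix (Fin N) (Fin N) ℝ) : 0 ≤ lapSq μ B :=
  integral_nonneg fun _ => sq_nonneg _

theorem rho1_nonneg (B : Ω → Matrix (Fin N) (Fin N) ℝ) : 0 ≤ rho1 μ B :=
  integral_nonneg fun _ => edgeWeight_nonneg _

theorem memLp_coord {ι : Type*} [Fintype ι] {u : Ω → EuclideanSpace ℝ ι} (hu : MemLp u 2 μ)
    (i : ι) : MemLp (fun ω => u ω i) 2 μ :=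
  hu.of_le ((measurable_coord i).comp_aemeasurable hu.1.aemeasurable).aestronglyMeasurable
    (ae_of_all _ fun ω => by simpa using abs_apply_le_norm (u ω) i)

/-- The standing assumptions on the graph flow, the noise and the intensity functions. -/
structure Model (μ : Measure Ω) (A : ℕ → Ω → Matrix (Fin N) (Fin N) ℝ)
    (ξ : ℕ → Ω → EuclideanSpace ℝ (Fin N × Fin N)) (f : Fin N → Fin N → ℝ → ℝ)
    (σ b : Fin N → Fin N → ℝ) (β : ℝ) : Prop where
  flow : IIDBalancedFlow μ A
  growth : IntensityGrowth f σ b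
  noiseMDS : NoiseMDS μ ξ β
  indep : FlowNoiseIndep μ A ξ
  lapInt : Integrable (fun ω => norm2 (laplacian (A 0 ω)) ^ 2) μ
  loopInt : ∀ i, Integrable (fun ω => A 0 ω i i ^ 2) μ

namespace Model

variable (h : Model μ A ξ f σ b β)

include h

theorem measurable_flow (k : ℕ) : Measurable (A k) := h.flow.1 k

theorem measurable_noise (k : ℕ) : Measurable (ξ k) := (h.noiseMDS.2 k).1

theorem measurable_intensity (j i : Fin N) : Measurable (f j i) := (h.growth j i).1

/-- The filtration that knows the graph flow and the past noise. -/
def noiseFiltration : Filtration ℕ mΩ :=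
  jointFiltration h.measurable_flow h.measurable_noise

/-- The filtration that knows the noise and the past graphs. -/
def flowFiltration : Filtration ℕ mΩ :=
  jointFiltration h.measurable_noise h.measurable_flow

theorem measurable_state_noiseFiltration (c : ℕ → ℝ) (X0 : Fin N → ℝ) (k : ℕ) :
    Measurable[h.noiseFiltration k] fun ω => state c f A ξ X0 k ω :=
  measurable_state h.measurable_intensity k
    (fun j _ => measurable_jointFiltration_left h.measurable_flow h.measurable_noise j k)
    (fun _ hj => measurable_jointFiltration_right h.measurable_flow h.measurable_noise hj)

theorem measurable_state_flowFiltration (c : ℕ → ℝ) (X0 : Fin N → ℝ) (k : ℕ) :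
    Measurable[h.flowFiltration k] fun ω => state c f A ξ X0 k ω :=
  measurable_state h.measurable_intensity k
    (fun _ hj => measurable_jointFiltration_right h.measurable_noise h.measurable_flow hj)
    (fun j _ => measurable_jointFiltration_left h.measurable_noise h.measurable_flow j k)

theorem measurable_state (c : ℕ → ℝ) (X0 : Fin N → ℝ) (k : ℕ) :
    Measurable fun ω => state c f A ξ X0 k ω :=
  Consensus.measurable_state h.measurable_intensity k (fun j _ => h.measurable_flow j)
    fun j _ => h.measurable_noise j

variable [IsProbabilityMeasure μ]

/-- A(k) is independent of the past graphs, and together with them it is independent of the whole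
noise process; `indep_sup_of_indep_sup` regroups these facts. -/
theorem indep_flow (k : ℕ) :
    Indep (MeasurableSpace.comap (A k) inferInstance) (h.flowFiltration k) μ := by
  have hle : ∀ j, MeasurableSpace.comap (A j) inferInstance ≤ mΩ :=
    fun j => (h.measurable_flow j).comap_le
  have h1 : Indep (MeasurableSpace.comap (A k) inferInstance) (past A k) μ := by
    have hd : Disjoint ({k} : Set ℕ) (Finset.range k : Set ℕ) := by simp
    simpa [past] using indep_iSup_of_disjoint hle ((iIndepFun_iff_iIndep _ _ _).1 h.flow.2.1) hd
  have h2 : Indep (sigmaAll A) (sigmaAll ξ) μ := (IndepFun_iff_Indep _ _ _).1 h.indep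
  have h3 : Indep (MeasurableSpace.comap (A k) inferInstance ⊔ past A k) (sigmaAll ξ) μ :=
    indep_of_indep_of_le_left h2
      (sup_le (measurable_sigmaAll A k).comap_le (past_le_sigmaAll A k))
  have h4 := indep_sup_of_indep_sup (hle k) (past_le_iff.2 fun j _ => h.measurable_flow j)
    (sigmaAll_le h.measurable_noise) h1 h3
  rw [sup_comm] at h4
  exact h4

theorem indepFun_flow (k : ℕ) {E : Type*} [MeasurableSpace E] {g : Ω → E}
    (hg : Measurable[h.flowFiltration k] g) : IndepFun (A k) g μ :=
  indepFun_of_indep (h.indep_flow k) (comap_measurable (A k)) hg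

/-- Adding the independent graph flow to the past of the noise changes no conditional expectation of
a noise functional, so the martingale difference property survives in the larger filtration. -/
theorem condExp_noiseFiltration (k : ℕ) {g : Ω → ℝ} (hg : Measurable[sigmaAll ξ] g)
    (hgi : Integrable g μ) : μ[g | h.noiseFiltration k] =ᵐ[μ] μ[g | past ξ k] :=
  condExp_sup_of_indep (sigmaAll_le h.measurable_flow) (sigmaAll_le h.measurable_noise)
    (past_le_sigmaAll ξ k) ((IndepFun_iff_Indep _ _ _).1 h.indep) hg.stronglyMeasurable hgi

omit [IsProbabilityMeasure μ] in
theorem memLp_noise (k : ℕ) : MemLp (ξ k) 2 μ :=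
  (memLp_two_iff_integrable_sq_norm (h.measurable_noise k).aestronglyMeasurable).2
    (h.noiseMDS.2 k).2.2.2.1

omit [IsProbabilityMeasure μ] in
theorem memLp_noise_coord (k : ℕ) (p : Fin N × Fin N) : MemLp (fun ω => ξ k ω p) 2 μ :=
  memLp_coord (h.memLp_noise k) p

theorem condExp_noise_coord (k : ℕ) (p : Fin N × Fin N) :
    μ[fun ω => ξ k ω p | h.noiseFiltration k] =ᵐ[μ] 0 := by
  obtain ⟨-, hint, hmds, -, -⟩ := h.noiseMDS.2 k
  refine (h.condExp_noiseFiltration k ((measurable_coord p).comp (measurable_sigmaAll ξ k))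
    ((h.memLp_noise_coord k p).integrable (by norm_num))).trans ?_
  refine (ContinuousLinearMap.comp_condExp_comm hint
    (EuclideanSpace.proj (𝕜 := ℝ) p)).symm.trans ?_
  filter_upwards [hmds] with ω hω
  simp [hω]

theorem condExp_sq_noise_le (k : ℕ) :
    ∀ᵐ ω ∂μ, (μ[fun ω => ‖ξ k ω‖ ^ 2 | h.noiseFiltration k]) ω ≤ β := by
  obtain ⟨-, -, -, hint, hle⟩ := h.noiseMDS.2 k
  filter_upwards [h.condExp_noiseFiltration k (g := fun ω => ‖ξ k ω‖ ^ 2)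
      ((measurable_norm.comp (measurable_sigmaAll ξ k)).pow_const 2) hint,
    hle] with ω h1 h2
  rw [h1]
  exact h2

/-! Moments of the graphs. -/

omit [IsProbabilityMeasure μ] in
theorem integrable_flow_comp {u : Matrix (Fin N) (Fin N) ℝ → ℝ} (hu : Measurable u)
    (hi : Integrable (fun ω => u (A 0 ω)) μ) (k : ℕ) :
    Integrable (fun ω => u (A k ω)) μ ∧ ∫ ω, u (A k ω) ∂μ = ∫ ω, u (A 0 ω) ∂μ :=
  have hid := (h.flow.2.2.1 k).comp hu
  ⟨hid.integrable_iff.2 hi, hid.integral_eq⟩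

omit [IsProbabilityMeasure μ] in
theorem integrable_norm2_sq (k : ℕ) : Integrable (fun ω => norm2 (laplacian (A k ω)) ^ 2) μ :=
  (h.integrable_flow_comp (u := fun M => norm2 (laplacian M) ^ 2)
    ((measurable_norm2.comp measurable_laplacian).pow_const 2) h.lapInt k).1

omit [IsProbabilityMeasure μ] in
theorem integral_norm2_sq (k : ℕ) :
    ∫ ω, norm2 (laplacian (A k ω)) ^ 2 ∂μ = lapSq μ (A 0) :=
  (h.integrable_flow_comp (u := fun M => norm2 (laplacian M) ^ 2)
    ((measurable_norm2.comp measurable_laplacian).pow_const 2) h.lapInt k).2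

omit [IsProbabilityMeasure μ] in
theorem integrable_edgeWeight_zero : Integrable (fun ω => edgeWeight (A 0 ω)) μ := by
  refine ((h.lapInt.add (integrable_finsetSum Finset.univ fun i _ => h.loopInt i)).const_mul
    ((N : ℝ) ^ 2)).mono' (measurable_edgeWeight.comp (h.measurable_flow 0)).aestronglyMeasurable
    (ae_of_all _ fun ω => ?_)
  rw [Real.norm_of_nonneg (edgeWeight_nonneg _)]
  simpa using edgeWeight_le (A 0 ω)

omit [IsProbabilityMeasure μ] in
theorem integrable_edgeWeight (k : ℕ) : Integrable (fun ω => edgeWeight (A k ω)) μ :=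
  (h.integrable_flow_comp measurable_edgeWeight h.integrable_edgeWeight_zero k).1

omit [IsProbabilityMeasure μ] in
theorem integral_edgeWeight (k : ℕ) : ∫ ω, edgeWeight (A k ω) ∂μ = rho1 μ (A 0) :=
  (h.integrable_flow_comp measurable_edgeWeight h.integrable_edgeWeight_zero k).2

omit [IsProbabilityMeasure μ] in
theorem integrable_sq_degIn_sub_degOut_zero (i : Fin N) :
    Integrable (fun ω => (degIn (A 0 ω) i - degOut (A 0 ω) i) ^ 2) μ := by
  refine (h.lapInt.const_mul ((N : ℝ) ^ 2)).mono'
    (((measurable_degIn_sub_degOut i).comp (h.measurable_flow 0)).pow_const 2).aestronglyMeasurable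
    (ae_of_all _ fun ω => ?_)
  rw [Real.norm_of_nonneg (sq_nonneg _)]
  exact sq_degIn_sub_degOut_le (A 0 ω) i

omit [IsProbabilityMeasure μ] in
theorem integrable_sum_sq_degIn_sub_degOut (k : ℕ) :
    Integrable (fun ω => ∑ i, (degIn (A k ω) i - degOut (A k ω) i) ^ 2) μ ∧
      ∫ ω, ∑ i, (degIn (A k ω) i - degOut (A k ω) i) ^ 2 ∂μ ≤ N * rho2 μ (A 0) := by
  have h1 := fun i => h.integrable_flow_comp ((measurable_degIn_sub_degOut i).pow_const 2)
    (h.integrable_sq_degIn_sub_degOut_zero i) k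
  refine ⟨integrable_finsetSum _ fun i _ => (h1 i).1, ?_⟩
  rw [integral_finsetSum _ fun i _ => (h1 i).1]
  have h2 : ∀ i ∈ Finset.univ, ∫ ω, (degIn (A k ω) i - degOut (A k ω) i) ^ 2 ∂μ ≤
      rho2 μ (A 0) := fun i _ => by
    rw [(h1 i).2]
    exact le_ciSup (f := fun i => ∫ ω, (degIn (A 0 ω) i - degOut (A 0 ω) i) ^ 2 ∂μ)
      (Set.finite_range _).bddAbove i
  simpa using Finset.sum_le_card_nsmul _ _ _ h2

omit [IsProbabilityMeasure μ] in
theorem integral_laplacian_entry (k : ℕ) (i j : Fin N) :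
    Integrable (fun ω => laplacian (A k ω) i j) μ ∧
      ∫ ω, laplacian (A k ω) i j ∂μ = laplacian (meanMatrix μ (A 0)) i j := by
  have h1 := h.integrable_flow_comp (measurable_laplacian_entry i j)
    (integrable_laplacian h.flow.2.2.2.1 i j) k
  refine ⟨h1.1, h1.2.trans ?_⟩
  rw [← meanMatrix_laplacian h.flow.2.2.2.1]
  rfl

/-- Independence gives integrability of the product from mere integrability of the factors. A second
moment of L(k) therefore suffices throughout, with no fourth moments. -/
theorem integral_mul_flow (k : ℕ)
    {u : Matrix (Fin N) (Fin N) ℝ → ℝ} (hu : Measurable u)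
    (hui : Integrable (fun ω => u (A k ω)) μ) {g : Ω → ℝ} (hg : Measurable[h.flowFiltration k] g)
    (hgi : Integrable g μ) :
    Integrable (fun ω => u (A k ω) * g ω) μ ∧
      ∫ ω, u (A k ω) * g ω ∂μ = (∫ ω, u (A k ω) ∂μ) * ∫ ω, g ω ∂μ := by
  have hind : IndepFun (fun ω => u (A k ω)) g μ :=
    (h.indepFun_flow k hg).comp hu measurable_id
  exact ⟨hind.integrable_mul hui hgi, hind.integral_mul_eq_mul_integral hui.1 hgi.1⟩

/-! ### Random Laplacians acting on vectors determined before the current graph -/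

section FlowMoments

variable {k : ℕ} {u v : Ω → EuclideanSpace ℝ (Fin N)}
  (hu : Measurable[h.flowFiltration k] u) (hu2 : MemLp u 2 μ)
  (hv : Measurable[h.flowFiltration k] v) (hv2 : MemLp v 2 μ)

include hu

omit [IsProbabilityMeasure μ] in
theorem measurable_opE_laplacian_apply : Measurable fun ω => opE (laplacian (A k ω)) (u ω) :=
  measurable_opE_laplacian (h.measurable_flow k) (hu.mono (h.flowFiltration.le k) le_rfl)

include hu2

theorem integral_norm_sq_opE_laplacian_le :
    MemLp (fun ω => opE (laplacian (A k ω)) (u ω)) 2 μ ∧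
      ∫ ω, ‖opE (laplacian (A k ω)) (u ω)‖ ^ 2 ∂μ ≤ lapSq μ (A 0) * ∫ ω, ‖u ω‖ ^ 2 ∂μ := by
  have hm := h.measurable_opE_laplacian_apply hu
  have h1 := h.integral_mul_flow k (u := fun M => norm2 (laplacian M) ^ 2)
    ((measurable_norm2.comp measurable_laplacian).pow_const 2) (h.integrable_norm2_sq k)
    (g := fun ω => ‖u ω‖ ^ 2) ((measurable_norm.comp hu).pow_const 2) hu2.integrable_norm_pow'
  have hle : ∀ ω, ‖opE (laplacian (A k ω)) (u ω)‖ ^ 2 ≤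
      norm2 (laplacian (A k ω)) ^ 2 * ‖u ω‖ ^ 2 := fun ω => by
    rw [← mul_pow]
    exact pow_le_pow_left₀ (norm_nonneg _) (norm_opE_le _ _) 2
  have hi : Integrable (fun ω => ‖opE (laplacian (A k ω)) (u ω)‖ ^ 2) μ :=
    h1.1.mono' (hm.norm.pow_const 2).aestronglyMeasurable (ae_of_all _ fun ω => by
      rw [Real.norm_of_nonneg (sq_nonneg _)]
      exact hle ω)
  refine ⟨(memLp_two_iff_integrable_sq_norm hm.aestronglyMeasurable).2 hi, ?_⟩
  rw [← h.integral_norm2_sq k, ← h1.2]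
  exact integral_mono hi h1.1 hle

theorem integral_sq_sum_opE_laplacian_le :
    MemLp (fun ω => ∑ i, opE (laplacian (A k ω)) (u ω) i) 2 μ ∧
      ∫ ω, (∑ i, opE (laplacian (A k ω)) (u ω) i) ^ 2 ∂μ ≤
        N * rho2 μ (A 0) * ∫ ω, ‖u ω‖ ^ 2 ∂μ := by
  have hL := (h.integral_norm_sq_opE_laplacian_le hu hu2).1
  have hS : MemLp (fun ω => ∑ i, opE (laplacian (A k ω)) (u ω) i) 2 μ :=
    memLp_finsetSum _ fun i _ => memLp_coord hL i
  have hd := h.integrable_sum_sq_degIn_sub_degOut k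
  have h1 := h.integral_mul_flow k
    (u := fun M => ∑ i, (degIn M i - degOut M i) ^ 2)
    (Finset.measurable_fun_sum _ fun i _ => (measurable_degIn_sub_degOut i).pow_const 2) hd.1
    (g := fun ω => ‖u ω‖ ^ 2) ((measurable_norm.comp hu).pow_const 2) hu2.integrable_norm_pow'
  refine ⟨hS, (integral_mono hS.integrable_sq h1.1 fun ω => sq_sum_opE_laplacian_le _ _).trans ?_⟩
  rw [h1.2]
  exact mul_le_mul_of_nonneg_right hd.2 (integral_nonneg fun _ => sq_nonneg _)

include hv hv2

/-- Expand in entries: the products u_i v_j are H_k-measurable and come out, while the entries of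
L(k) are independent of H_k and become their means. Both the spectral gap and the martingale
property of 1ᵀLX rest on this. -/
theorem condExp_inner_opE_laplacian :
    Integrable (fun ω => inner ℝ (u ω) (opE (laplacian (A k ω)) (v ω))) μ ∧
      μ[fun ω => inner ℝ (u ω) (opE (laplacian (A k ω)) (v ω)) | h.flowFiltration k] =ᵐ[μ]
        fun ω => inner ℝ (u ω) (opE (laplacian (meanMatrix μ (A 0))) (v ω)) := by
  have huv : ∀ i j, Measurable[h.flowFiltration k] fun ω => u ω i * v ω j := fun i j =>
    ((measurable_coord i).comp hu).mul ((measurable_coord j).comp hv)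
  have huvi : ∀ i j, Integrable (fun ω => u ω i * v ω j) μ := fun i j =>
    (memLp_coord hu2 i).integrable_mul (memLp_coord hv2 j)
  have hterm : ∀ i j, Integrable ((fun ω => u ω i * v ω j) * fun ω => laplacian (A k ω) i j) μ := by
    intro i j
    have := (h.integral_mul_flow k (measurable_laplacian_entry i j)
      (h.integral_laplacian_entry k i j).1 (huv i j) (huvi i j)).1
    refine this.congr (ae_of_all _ fun ω => ?_)
    exact mul_comm _ _
  have hce : ∀ i j, μ[(fun ω => u ω i * v ω j) * fun ω => laplacian (A k ω) i j |
      h.flowFiltration k] =ᵐ[μ] fun ω => u ω i * v ω j * laplacian (meanMatrix μ (A 0)) i j := by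
    intro i j
    have h1 := condExp_mul_of_stronglyMeasurable_left (huv i j).stronglyMeasurable (hterm i j)
      (h.integral_laplacian_entry k i j).1
    have h2 : μ[fun ω => laplacian (A k ω) i j | h.flowFiltration k] =ᵐ[μ]
        fun _ => ∫ ω, laplacian (A k ω) i j ∂μ :=
      condExp_indep_eq (h.measurable_flow k).comap_le (h.flowFiltration.le k)
        ((measurable_laplacian_entry i j).comp (comap_measurable (A k))).stronglyMeasurable
        (h.indep_flow k)
    filter_upwards [h1, h2] with ω e1 e2
    rw [e1, Pi.mul_apply, e2, (h.integral_laplacian_entry k i j).2]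
  have hsum : (fun ω => inner ℝ (u ω) (opE (laplacian (A k ω)) (v ω))) =
      ∑ i, ∑ j, (fun ω => u ω i * v ω j) * fun ω => laplacian (A k ω) i j := by
    ext ω
    simp [inner_opE, Finset.sum_apply]
  rw [hsum]
  refine ⟨integrable_finsetSum' _ fun i _ => integrable_finsetSum' _ fun j _ => hterm i j, ?_⟩
  refine (condExp_finsetSum (fun i _ => integrable_finsetSum' _ fun j _ => hterm i j) _).trans ?_
  have h3 : ∀ᵐ ω ∂μ, ∀ i, (μ[∑ j, (fun ω => u ω i * v ω j) * fun ω => laplacian (A k ω) i j |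
      h.flowFiltration k]) ω = ∑ j, u ω i * v ω j * laplacian (meanMatrix μ (A 0)) i j := by
    refine ae_all_iff.2 fun i => ?_
    filter_upwards [condExp_finsetSum (fun j (_ : j ∈ Finset.univ) => hterm i j)
      (h.flowFiltration k), ae_all_iff.2 fun j => hce i j] with ω e1 e2
    rw [e1, Finset.sum_apply]
    exact Finset.sum_congr rfl fun j _ => e2 j
  filter_upwards [h3] with ω hω
  rw [Finset.sum_apply, inner_opE]
  exact Finset.sum_congr rfl fun i _ => hω i

theorem integral_inner_opE_laplacian :
    ∫ ω, inner ℝ (u ω) (opE (laplacian (A k ω)) (v ω)) ∂μ =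
      ∫ ω, inner ℝ (u ω) (opE (laplacian (meanMatrix μ (A 0))) (v ω)) ∂μ := by
  rw [← integral_condExp (h.flowFiltration.le k)]
  exact integral_congr_ae (h.condExp_inner_opE_laplacian hu hu2 hv hv2).2

end FlowMoments

end Model

end Model

namespace Model

variable {Ω : Type*} {mΩ : MeasurableSpace Ω} {μ : Measure Ω} {N : ℕ}
  {A : ℕ → Ω → Matrix (Fin N) (Fin N) ℝ} {ξ : ℕ → Ω → EuclideanSpace ℝ (Fin N × Fin N)}
  {f : Fin N → Fin N → ℝ → ℝ} {σ b : Fin N → Fin N → ℝ} {β : ℝ}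
  [IsProbabilityMeasure μ] (h : Model μ A ξ f σ b β)

include h

/-! ### Moments and conditional mean of the noise vector -/

section NoiseMoments

variable {k : ℕ} {x : Ω → Fin N → ℝ}

omit [IsProbabilityMeasure μ] in
theorem measurable_toE_noise (hxG : Measurable[h.noiseFiltration k] x) :
    Measurable fun ω => toE (noise f (A k ω) (x ω) (ξ k ω)) := by
  have hx' : Measurable x := hxG.mono (h.noiseFiltration.le k) le_rfl
  exact measurable_toE.comp ((Consensus.measurable_noise h.measurable_intensity).comp
    (((h.measurable_flow k).prodMk hx').prodMk (h.measurable_noise k)))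

variable (hxH : Measurable[h.flowFiltration k] x)
  (hxG : Measurable[h.noiseFiltration k] x) (hx : Integrable (fun ω => energy (x ω)) μ)

include hxH hxG hx

theorem integral_edgeWeight_mul_le :
    Integrable (fun ω => edgeWeight (A k ω) *
      ((4 * maxPair σ ^ 2 * energy (x ω) + 2 * maxPair b ^ 2) * ‖ξ k ω‖ ^ 2)) μ ∧
    ∫ ω, edgeWeight (A k ω) *
      ((4 * maxPair σ ^ 2 * energy (x ω) + 2 * maxPair b ^ 2) * ‖ξ k ω‖ ^ 2) ∂μ ≤
      rho1 μ (A 0) * (β * (4 * maxPair σ ^ 2 * ∫ ω, energy (x ω) ∂μ + 2 * maxPair b ^ 2)) := by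
  have hK : ∀ {m : MeasurableSpace Ω}, Measurable[m] x →
      Measurable[m] fun ω => 4 * maxPair σ ^ 2 * energy (x ω) + 2 * maxPair b ^ 2 :=
    fun hm => ((measurable_energy.comp hm).const_mul _).add_const _
  have hKi : Integrable (fun ω => 4 * maxPair σ ^ 2 * energy (x ω) + 2 * maxPair b ^ 2) μ :=
    (hx.const_mul _).add (integrable_const _)
  -- The state factor is G_k-measurable, so the noise factor contributes at most β.
  have h1 := integral_mul_le_of_condExp_le (h.noiseFiltration.le k) h.noiseMDS.1.le
    (fun ω => sq_nonneg ‖ξ k ω‖) ((h.measurable_noise k).norm.pow_const 2)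
    (h.noiseMDS.2 k).2.2.2.1 (h.condExp_sq_noise_le k) (hK hxG) (fun ω => by
      have := energy_nonneg (x ω)
      positivity) hKi
  have hξH : Measurable[h.flowFiltration k] fun ω => ‖ξ k ω‖ ^ 2 :=
    (measurable_norm.comp (measurable_jointFiltration_left h.measurable_noise h.measurable_flow
      k k)).pow_const 2
  -- H_k contains the whole noise, so the product of state and noise factors is independent of the
  -- edge weight of A(k).
  have h2 := h.integral_mul_flow k measurable_edgeWeight (h.integrable_edgeWeight k)
    ((hK hxH).mul hξH) h1.1
  refine ⟨h2.1, h2.2.trans_le ?_⟩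
  rw [h.integral_edgeWeight k]
  refine mul_le_mul_of_nonneg_left (h1.2.trans (le_of_eq ?_)) (rho1_nonneg _)
  rw [integral_add (hx.const_mul _) (integrable_const _), integral_const_mul]
  simp

theorem memLp_noise_term (i j : Fin N) :
    MemLp (fun ω => A k ω i j * f j i (x ω j - x ω i) * ξ k ω (j, i)) 2 μ := by
  have hx' : Measurable x := hxG.mono (h.noiseFiltration.le k) le_rfl
  have hm : Measurable fun ω => A k ω i j * f j i (x ω j - x ω i) * ξ k ω (j, i) :=
    ((measurable_noise_coeff h.measurable_intensity i j).comp
      ((h.measurable_flow k).prodMk hx')).mul ((measurable_coord (j, i)).comp (h.measurable_noise k))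
  rw [memLp_two_iff_integrable_sq hm.aestronglyMeasurable]
  refine (h.integral_edgeWeight_mul_le hxH hxG hx).1.mono' (hm.pow_const 2).aestronglyMeasurable
    (ae_of_all _ fun ω => ?_)
  rw [Real.norm_of_nonneg (sq_nonneg _)]
  exact sq_noise_term_le_edgeWeight h.growth (A k ω) (x ω) (ξ k ω) i j

theorem memLp_noise_apply (i : Fin N) : MemLp (fun ω => noise f (A k ω) (x ω) (ξ k ω) i) 2 μ :=
  memLp_finsetSum _ fun j _ => h.memLp_noise_term hxH hxG hx i j

theorem integral_norm_sq_noise_le :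
    MemLp (fun ω => toE (noise f (A k ω) (x ω) (ξ k ω))) 2 μ ∧
    ∫ ω, ‖toE (noise f (A k ω) (x ω) (ξ k ω))‖ ^ 2 ∂μ ≤
      rho1 μ (A 0) * (β * (4 * maxPair σ ^ 2 * ∫ ω, energy (x ω) ∂μ + 2 * maxPair b ^ 2)) := by
  have hm := h.measurable_toE_noise hxG
  have h1 := h.integral_edgeWeight_mul_le hxH hxG hx
  have hle := fun ω => norm_sq_noise_le h.growth (A k ω) (x ω) (ξ k ω)
  have hi : Integrable (fun ω => ‖toE (noise f (A k ω) (x ω) (ξ k ω))‖ ^ 2) μ :=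
    h1.1.mono' (hm.norm.pow_const 2).aestronglyMeasurable (ae_of_all _ fun ω => by
      rw [Real.norm_of_nonneg (sq_nonneg _)]
      exact hle ω)
  exact ⟨(memLp_two_iff_integrable_sq_norm hm.aestronglyMeasurable).2 hi,
    (integral_mono hi h1.1 hle).trans h1.2⟩

theorem integral_sq_sum_noise_le :
    MemLp (fun ω => ∑ i, noise f (A k ω) (x ω) (ξ k ω) i) 2 μ ∧
    ∫ ω, (∑ i, noise f (A k ω) (x ω) (ξ k ω) i) ^ 2 ∂μ ≤
      rho1 μ (A 0) * (β * (4 * maxPair σ ^ 2 * ∫ ω, energy (x ω) ∂μ + 2 * maxPair b ^ 2)) := by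
  have hS : MemLp (fun ω => ∑ i, noise f (A k ω) (x ω) (ξ k ω) i) 2 μ :=
    memLp_finsetSum _ fun i _ => h.memLp_noise_apply hxH hxG hx i
  have h1 := h.integral_edgeWeight_mul_le hxH hxG hx
  exact ⟨hS, (integral_mono hS.integrable_sq h1.1 fun ω =>
    sq_sum_noise_le h.growth (A k ω) (x ω) (ξ k ω)).trans h1.2⟩

/-- G_k knows A(k), so every coefficient u_i a_ij f_ji comes out of the conditional expectation and
leaves E[ξ_ji | G_k] = 0. -/
theorem condExp_inner_noise {u : Ω → EuclideanSpace ℝ (Fin N)}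
    (hu : Measurable[h.noiseFiltration k] u) (hu2 : MemLp u 2 μ) :
    Integrable (fun ω => inner ℝ (u ω) (toE (noise f (A k ω) (x ω) (ξ k ω)))) μ ∧
    μ[fun ω => inner ℝ (u ω) (toE (noise f (A k ω) (x ω) (ξ k ω))) | h.noiseFiltration k]
      =ᵐ[μ] 0 := by
  have hAG : Measurable[h.noiseFiltration k] (A k) :=
    measurable_jointFiltration_left h.measurable_flow h.measurable_noise k k
  have hcoef : ∀ i j, Measurable[h.noiseFiltration k] fun ω =>
      u ω i * (A k ω i j * f j i (x ω j - x ω i)) := fun i j =>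
    ((measurable_coord i).comp hu).mul
      ((measurable_noise_coeff h.measurable_intensity i j).comp (hAG.prodMk hxG))
  have hterm : ∀ i j, Integrable ((fun ω => u ω i * (A k ω i j * f j i (x ω j - x ω i))) *
      fun ω => ξ k ω (j, i)) μ := by
    intro i j
    refine ((memLp_coord hu2 i).integrable_mul (h.memLp_noise_term hxH hxG hx i j)).congr
      (ae_of_all _ fun ω => ?_)
    simp only [Pi.mul_apply]
    ring
  have hce : ∀ i j, μ[(fun ω => u ω i * (A k ω i j * f j i (x ω j - x ω i))) *
      fun ω => ξ k ω (j, i) | h.noiseFiltration k] =ᵐ[μ] 0 := by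
    intro i j
    have h1 := condExp_mul_of_stronglyMeasurable_left (hcoef i j).stronglyMeasurable (hterm i j)
      ((h.memLp_noise_coord k (j, i)).integrable (by norm_num))
    filter_upwards [h1, h.condExp_noise_coord k (j, i)] with ω e1 e2
    rw [e1, Pi.mul_apply, e2]
    simp
  have hsum : (fun ω => inner ℝ (u ω) (toE (noise f (A k ω) (x ω) (ξ k ω)))) =
      ∑ p : Fin N × Fin N, (fun ω => u ω p.1 * (A k ω p.1 p.2 * f p.2 p.1 (x ω p.2 - x ω p.1))) *
        fun ω => ξ k ω (p.2, p.1) := by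
    ext ω
    rw [inner_eq_sum, Finset.sum_apply, Fintype.sum_prod_type]
    refine Finset.sum_congr rfl fun i _ => ?_
    show u ω i * noise f (A k ω) (x ω) (ξ k ω) i = _
    rw [noise, Finset.mul_sum]
    refine Finset.sum_congr rfl fun j _ => ?_
    simp only [Pi.mul_apply]
    ring
  rw [hsum]
  refine ⟨integrable_finsetSum' _ fun p _ => hterm p.1 p.2, ?_⟩
  filter_upwards [condExp_finsetSum (s := (Finset.univ : Finset (Fin N × Fin N))) (fun p _ => hterm p.1 p.2)
    (h.noiseFiltration k), ae_all_iff.2 fun p : Fin N × Fin N => hce p.1 p.2]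
    with ω e1 e2
  rw [e1, Finset.sum_apply]
  exact Finset.sum_eq_zero fun p _ => e2 p

end NoiseMoments

/-! ### Square integrability of the states and the one-step recursion -/

section State

variable (c : ℕ → ℝ) (X0 : Fin N → ℝ)

theorem memLp_toE_state (k : ℕ) : MemLp (fun ω => toE (state c f A ξ X0 k ω)) 2 μ := by
  induction k with
  | zero => exact (memLp_const (toE X0) : MemLp (fun _ => toE X0) 2 μ)
  | succ k ih =>
    have hH := h.measurable_state_flowFiltration c X0 k
    have hG := h.measurable_state_noiseFiltration c X0 k
    have hen : Integrable (fun ω => energy (state c f A ξ X0 k ω)) μ :=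
      ((opE (projMatrix N)).comp_memLp' ih).integrable_norm_pow'
    have h1 := (h.integral_norm_sq_opE_laplacian_le (measurable_toE.comp hH) ih).1
    have h2 := (h.integral_norm_sq_noise_le hH hG hen).1
    refine ((ih.sub (h1.const_smul (c k))).add (h2.const_smul (c k))).congr_norm
      (measurable_toE.comp (h.measurable_state c X0 (k + 1))).aestronglyMeasurable
      (ae_of_all _ fun ω => ?_)
    exact congrArg norm (toE_state_succ c f A ξ X0 k ω).symm

theorem memLp_clm_state (Q : EuclideanSpace ℝ (Fin N) →L[ℝ] EuclideanSpace ℝ (Fin N)) (k : ℕ) :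
    MemLp (fun ω => Q (toE (state c f A ξ X0 k ω))) 2 μ :=
  Q.comp_memLp' (h.memLp_toE_state c X0 k)

theorem integrable_energy (k : ℕ) : Integrable (fun ω => energy (state c f A ξ X0 k ω)) μ :=
  (h.memLp_clm_state c X0 (opE (projMatrix N)) k).integrable_norm_pow'

/-- The martingale part of the one-step change of the squared norm of the averaged state. -/
theorem condExp_inner_step {Q : EuclideanSpace ℝ (Fin N) →L[ℝ] EuclideanSpace ℝ (Fin N)} (k : ℕ) :
    Measurable[h.noiseFiltration (k + 1)] (fun ω => inner ℝ
      (Q (toE (state c f A ξ X0 k ω)) -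
        c k • Q (opE (laplacian (A k ω)) (Q (toE (state c f A ξ X0 k ω)))))
      (toE (noise f (A k ω) (state c f A ξ X0 k ω) (ξ k ω)))) ∧
    Integrable (fun ω => inner ℝ
      (Q (toE (state c f A ξ X0 k ω)) -
        c k • Q (opE (laplacian (A k ω)) (Q (toE (state c f A ξ X0 k ω)))))
      (toE (noise f (A k ω) (state c f A ξ X0 k ω) (ξ k ω)))) μ ∧
    μ[fun ω => inner ℝ
      (Q (toE (state c f A ξ X0 k ω)) -
        c k • Q (opE (laplacian (A k ω)) (Q (toE (state c f A ξ X0 k ω)))))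
      (toE (noise f (A k ω) (state c f A ξ X0 k ω) (ξ k ω))) | h.noiseFiltration k] =ᵐ[μ] 0 := by
  have hH := h.measurable_state_flowFiltration c X0 k
  have hG := h.measurable_state_noiseFiltration c X0 k
  have hQ : ∀ {m : MeasurableSpace Ω} {v : Ω → EuclideanSpace ℝ (Fin N)}, Measurable[m] v →
      Measurable[m] fun ω => Q (v ω) := fun hv => Q.continuous.measurable.comp hv
  have hQH := hQ (measurable_toE.comp hH)
  have hAG : ∀ l, Measurable[h.noiseFiltration l] (A k) :=
    measurable_jointFiltration_left h.measurable_flow h.measurable_noise k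
  have hu : ∀ l, Measurable[h.noiseFiltration l] (fun ω => state c f A ξ X0 k ω) →
      Measurable[h.noiseFiltration l] fun ω => Q (toE (state c f A ξ X0 k ω)) -
        c k • Q (opE (laplacian (A k ω)) (Q (toE (state c f A ξ X0 k ω)))) := fun l hl =>
    (hQ (measurable_toE.comp hl)).sub
      ((hQ (measurable_opE_laplacian (hAG l) (hQ (measurable_toE.comp hl)))).const_smul (c k))
  have hu2 : MemLp (fun ω => Q (toE (state c f A ξ X0 k ω)) -
      c k • Q (opE (laplacian (A k ω)) (Q (toE (state c f A ξ X0 k ω))))) 2 μ :=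
    (h.memLp_clm_state c X0 Q k).sub ((Q.comp_memLp'
      (h.integral_norm_sq_opE_laplacian_le hQH (h.memLp_clm_state c X0 Q k)).1).const_smul (c k))
  refine ⟨?_, h.condExp_inner_noise hH hG (h.integrable_energy c X0 k) (hu k hG) hu2⟩
  have hG' : Measurable[h.noiseFiltration (k + 1)] fun ω => state c f A ξ X0 k ω :=
    hG.mono (h.noiseFiltration.mono k.le_succ) le_rfl
  refine (hu (k + 1) hG').inner (measurable_toE.comp
    ((Consensus.measurable_noise h.measurable_intensity).comp (((hAG (k + 1)).prodMk hG').prodMk ?_)))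
  exact measurable_jointFiltration_right h.measurable_flow h.measurable_noise k.lt_succ_self

/-- The recursive bound for the second moment of the averaged state. -/
theorem integral_norm_sq_succ_le {Q : EuclideanSpace ℝ (Fin N) →L[ℝ] EuclideanSpace ℝ (Fin N)}
    (hQ : IsAveraging Q) (k : ℕ) :
    ∫ ω, ‖Q (toE (state c f A ξ X0 (k + 1) ω))‖ ^ 2 ∂μ ≤
      ∫ ω, ‖Q (toE (state c f A ξ X0 k ω))‖ ^ 2 ∂μ -
      2 * c k * ∫ ω, inner ℝ (Q (toE (state c f A ξ X0 k ω)))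
        (opE (laplacian (meanMatrix μ (A 0))) (Q (toE (state c f A ξ X0 k ω)))) ∂μ +
      c k ^ 2 * (lapSq μ (A 0) * ∫ ω, ‖Q (toE (state c f A ξ X0 k ω))‖ ^ 2 ∂μ) +
      c k ^ 2 * (rho1 μ (A 0) * (β * (4 * maxPair σ ^ 2 *
        ∫ ω, energy (state c f A ξ X0 k ω) ∂μ + 2 * maxPair b ^ 2))) := by
  have hH := h.measurable_state_flowFiltration c X0 k
  have hG := h.measurable_state_noiseFiltration c X0 k
  have hu : Measurable[h.flowFiltration k] fun ω => Q (toE (state c f A ξ X0 k ω)) :=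
    Q.continuous.measurable.comp (measurable_toE.comp hH)
  have hu2 := h.memLp_clm_state c X0 Q k
  have i1 : Integrable (fun ω => ‖Q (toE (state c f A ξ X0 k ω))‖ ^ 2) μ := hu2.integrable_norm_pow'
  have i2 := (h.condExp_inner_opE_laplacian hu hu2 hu hu2).1
  have e2 := h.integral_inner_opE_laplacian hu hu2 hu hu2
  obtain ⟨mL, eL⟩ := h.integral_norm_sq_opE_laplacian_le hu hu2
  have i3 : Integrable (fun ω =>
      ‖Q (opE (laplacian (A k ω)) (Q (toE (state c f A ξ X0 k ω))))‖ ^ 2) μ :=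
    (Q.comp_memLp' mL).integrable_norm_pow'
  have e3 := (integral_mono i3 mL.integrable_norm_pow' fun ω =>
    pow_le_pow_left₀ (norm_nonneg _) (hQ.norm_le _) 2).trans eL
  obtain ⟨mW, eW⟩ := h.integral_norm_sq_noise_le hH hG (h.integrable_energy c X0 k)
  have i4 : Integrable (fun ω =>
      ‖Q (toE (noise f (A k ω) (state c f A ξ X0 k ω) (ξ k ω)))‖ ^ 2) μ :=
    (Q.comp_memLp' mW).integrable_norm_pow'
  have e4 := (integral_mono i4 mW.integrable_norm_pow' fun ω =>
    pow_le_pow_left₀ (norm_nonneg _) (hQ.norm_le _) 2).trans eW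
  obtain ⟨-, i5, c5⟩ := h.condExp_inner_step c X0 (Q := Q) k
  -- The term linear in the noise has zero conditional mean, so it drops out of the expected
  -- expansion.
  have e5 := integral_condExp (μ := μ) (h.noiseFiltration.le k) (f := fun ω => inner ℝ
      (Q (toE (state c f A ξ X0 k ω)) -
        c k • Q (opE (laplacian (A k ω)) (Q (toE (state c f A ξ X0 k ω)))))
      (toE (noise f (A k ω) (state c f A ξ X0 k ω) (ξ k ω))))
  rw [integral_congr_ae c5] at e5
  simp_rw [toE_state_succ, hQ.norm_sq_step]
  have j2 : Integrable (fun ω => ‖Q (toE (state c f A ξ X0 k ω))‖ ^ 2 - 2 * c k *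
      inner ℝ (Q (toE (state c f A ξ X0 k ω)))
        (opE (laplacian (A k ω)) (Q (toE (state c f A ξ X0 k ω))))) μ :=
    i1.sub (i2.const_mul _)
  have j3 : Integrable (fun ω => ‖Q (toE (state c f A ξ X0 k ω))‖ ^ 2 - 2 * c k *
      inner ℝ (Q (toE (state c f A ξ X0 k ω)))
        (opE (laplacian (A k ω)) (Q (toE (state c f A ξ X0 k ω)))) + c k ^ 2 *
      ‖Q (opE (laplacian (A k ω)) (Q (toE (state c f A ξ X0 k ω))))‖ ^ 2) μ :=
    j2.add (i3.const_mul _)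
  have j4 : Integrable (fun ω => ‖Q (toE (state c f A ξ X0 k ω))‖ ^ 2 - 2 * c k *
      inner ℝ (Q (toE (state c f A ξ X0 k ω)))
        (opE (laplacian (A k ω)) (Q (toE (state c f A ξ X0 k ω)))) + c k ^ 2 *
      ‖Q (opE (laplacian (A k ω)) (Q (toE (state c f A ξ X0 k ω))))‖ ^ 2 + c k ^ 2 *
      ‖Q (toE (noise f (A k ω) (state c f A ξ X0 k ω) (ξ k ω)))‖ ^ 2) μ :=
    j3.add (i4.const_mul _)
  rw [integral_add j4 (i5.const_mul _), integral_add j3 (i4.const_mul _),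
    integral_add j2 (i3.const_mul _), integral_sub i1 (i2.const_mul _), integral_const_mul,
    integral_const_mul, integral_const_mul, integral_const_mul, ← e5, e2]
  have := mul_le_mul_of_nonneg_left e3 (sq_nonneg (c k))
  have := mul_le_mul_of_nonneg_left e4 (sq_nonneg (c k))
  simp only [Pi.zero_apply, integral_zero, mul_zero, add_zero]
  linarith

end State

end Model

section Analysis

theorem ae_summable_of_summable_integral_norm {Ω : Type*} {mΩ : MeasurableSpace Ω} {μ : Measure Ω}
    {g : ℕ → Ω → ℝ} {s : ℕ → ℝ} (hg : ∀ k, Integrable (g k) μ) (hs : Summable s)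
    (hle : ∀ k, ∫ ω, ‖g k ω‖ ∂μ ≤ s k) : ∀ᵐ ω ∂μ, Summable fun k => g k ω := by
  have hs0 : ∀ k, 0 ≤ s k := fun k => (integral_nonneg fun _ => norm_nonneg _).trans (hle k)
  have hm : ∀ k, AEMeasurable (fun ω => ‖g k ω‖ₑ) μ := fun k => (hg k).1.enorm
  have hfin : ∫⁻ ω, ∑' k, ‖g k ω‖ₑ ∂μ ≠ ⊤ := by
    rw [lintegral_tsum hm]
    refine ne_top_of_le_ne_top (b := ∑' k, ENNReal.ofReal (s k)) ?_ (ENNReal.tsum_le_tsum fun k => ?_)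
    · rw [← ENNReal.ofReal_tsum_of_nonneg hs0 hs]
      exact ENNReal.ofReal_ne_top
    · rw [← ofReal_integral_norm_eq_lintegral_enorm (hg k)]
      exact ENNReal.ofReal_le_ofReal (hle k)
  filter_upwards [ae_lt_top' (AEMeasurable.tsum hm) hfin] with ω hω
  exact Summable.of_nnnorm (ENNReal.tsum_coe_ne_top_iff_summable.1 hω.ne)

theorem isLittleO_average_of_summable {c d : ℕ → ℝ} (hc : ∀ k, 0 < c k) (hanti : Antitone c)
    (h0 : Tendsto c atTop (𝓝 0)) (hd : ∀ k, 0 ≤ d k) (hs : Summable fun k => c k * d k ^ 2) :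
    (fun n : ℕ => (1 / (n : ℝ)) * ∑ k ∈ Finset.range (n + 1), d k) =o[atTop]
      fun n : ℕ => 1 / Real.sqrt (c n * n) := by
  have hK := tendsto_mul_sum_of_summable hc hanti h0 (fun k => sq_nonneg (d k)) hs
  -- The factor 2 absorbs (n + 1)/n: there are n + 1 summands but the divisor is n.
  have hlim : Tendsto (fun n => Real.sqrt (2 * (c n * ∑ k ∈ Finset.range (n + 1), d k ^ 2)))
      atTop (𝓝 0) := by
    have h1 := hK.const_mul 2
    rw [mul_zero] at h1
    have h2 := (Real.continuous_sqrt.tendsto 0).comp h1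
    rwa [Real.sqrt_zero] at h2
  have hpos : ∀ n : ℕ, 1 ≤ n → 0 < Real.sqrt (c n * n) := fun n hn =>
    Real.sqrt_pos.2 (mul_pos (hc n) (by exact_mod_cast hn))
  rw [isLittleO_iff_tendsto']
  · refine squeeze_zero' ?_ ?_ hlim
    · refine .of_forall fun n => ?_
      have := Finset.sum_nonneg fun k (_ : k ∈ Finset.range (n + 1)) => hd k
      positivity
    · filter_upwards [eventually_ge_atTop 1] with n hn
      have hn1 : (1 : ℝ) ≤ n := by exact_mod_cast hn
      have hS := Finset.sum_nonneg fun k (_ : k ∈ Finset.range (n + 1)) => hd k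
      rw [div_div_eq_mul_div, div_one]
      refine Real.le_sqrt_of_sq_le ?_
      rw [mul_pow, mul_pow, Real.sq_sqrt (mul_pos (hc n) (by linarith)).le]
      have hcs : (∑ k ∈ Finset.range (n + 1), d k) ^ 2 ≤
          ((n : ℝ) + 1) * ∑ k ∈ Finset.range (n + 1), d k ^ 2 := by
        simpa using sq_sum_le_card_mul_sum_sq (s := Finset.range (n + 1)) (f := d)
      have hQ := Finset.sum_nonneg fun k (_ : k ∈ Finset.range (n + 1)) => sq_nonneg (d k)
      have hcn := hc n
      calc (1 / (n : ℝ)) ^ 2 * (∑ k ∈ Finset.range (n + 1), d k) ^ 2 * (c n * n)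
          ≤ (1 / (n : ℝ)) ^ 2 * (((n : ℝ) + 1) * ∑ k ∈ Finset.range (n + 1), d k ^ 2) *
              (c n * n) := by gcongr
        _ = (((n : ℝ) + 1) / n) * (c n * ∑ k ∈ Finset.range (n + 1), d k ^ 2) := by
            field_simp
        _ ≤ 2 * (c n * ∑ k ∈ Finset.range (n + 1), d k ^ 2) := by
            refine mul_le_mul_of_nonneg_right ?_ (mul_nonneg hcn.le hQ)
            rw [div_le_iff₀ (by linarith)]
            linarith
  · filter_upwards [eventually_ge_atTop 1] with n hn h
    exact absurd h (one_div_pos.2 (hpos n hn)).ne'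

/-! ### Consequences of the energy recursion -/

section Recursion

variable {c v : ℕ → ℝ} {l M e : ℝ} (hc : ∀ k, 0 < c k) (hcs : Summable fun k => c k ^ 2)
  (hv : ∀ k, 0 ≤ v k)
  (h : ∀ k, v (k + 1) ≤ v k - 2 * c k * (l * v k) + c k ^ 2 * (M * v k) + c k ^ 2 * e)

include hc hcs hv h

/-- Telescoping the recursion bounds 2l ∑ c v by v 0 plus a convergent series, once M v is replaced
by M q. -/
theorem summable_mul_of_recursion (hl : 0 < l) (hM : 0 ≤ M) (he : 0 ≤ e) {q : ℝ}
    (hq : ∀ k, v k ≤ q) : Summable fun k => c k * v k := by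
  have hq0 : 0 ≤ q := (hv 0).trans (hq 0)
  have key : ∀ n, ∑ k ∈ Finset.range n, 2 * l * (c k * v k) ≤
      v 0 - v n + ∑ k ∈ Finset.range n, c k ^ 2 * (M * q + e) := by
    intro n
    induction n with
    | zero => simp
    | succ n ih =>
      rw [Finset.sum_range_succ, Finset.sum_range_succ]
      have h1 : c n ^ 2 * (M * v n) ≤ c n ^ 2 * (M * q) := by
        have := hq n
        gcongr
      linarith [h n]
  have h2 : Summable fun k => 2 * l * (c k * v k) := by
    refine summable_of_sum_range_le (c := v 0 + ∑' k, c k ^ 2 * (M * q + e))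
      (fun k => by have := hc k; have := hv k; positivity) fun n => (key n).trans ?_
    have := (hcs.mul_right (M * q + e)).sum_le_tsum (Finset.range n)
      fun k _ => by positivity
    linarith [hv n]
  exact (summable_mul_left_iff (by positivity : 2 * l ≠ 0)).1 h2

/-- Without the negative drift, `v` increases by at most a summable amount, hence converges; ∑ c v <
∞ and ∑ c = ∞ then identify the limit. -/
theorem tendsto_zero_of_recursion (hdiv : Tendsto (fun n => ∑ k ∈ Finset.range n, c k) atTop atTop)
    (hl : 0 < l) (hM : 0 ≤ M) (he : 0 ≤ e) {q : ℝ} (hq : ∀ k, v k ≤ q) :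
    Tendsto v atTop (𝓝 0) := by
  have hq0 : 0 ≤ q := (hv 0).trans (hq 0)
  obtain ⟨L, hL⟩ := exists_tendsto_of_le_add_summable (v := v)
    (e := fun k => c k ^ 2 * (M * q + e)) (fun k => by positivity) (hcs.mul_right _) hv
    fun k => by
      have h1 : c k ^ 2 * (M * v k) ≤ c k ^ 2 * (M * q) := by
        have := hq k
        gcongr
      have h2 : 0 ≤ 2 * c k * (l * v k) := by
        have := hc k
        have := hv k
        positivity
      linarith [h k]
  have := eq_zero_of_tendsto_of_summable_mul hc hdiv hv
    (summable_mul_of_recursion hc hcs hv h hl hM he hq) hL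
  rwa [this] at hL

/-- Multiply the recursion by c k and telescope c k * v k; monotonicity of the gains absorbs the
cubic term as M c³v ≤ M c(0) c²v. -/
theorem tsum_sq_mul_le_of_recursion (hanti : Antitone c) (hM : 0 ≤ M) (he : 0 ≤ e)
    (hlt : M * c 0 < 2 * l) :
    ∑' k, c k ^ 2 * v k ≤ (c 0 * v 0 + e * ∑' k, c k ^ 3) / (2 * l - M * c 0) := by
  have hc3 : Summable fun k => c k ^ 3 := by
    refine (hcs.mul_left (c 0)).of_nonneg_of_le (fun k => (pow_pos (hc k) 3).le) fun k => ?_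
    have h1 := hanti (Nat.zero_le k)
    have h2 := hc k
    calc c k ^ 3 = c k * c k ^ 2 := by ring
      _ ≤ _ := by gcongr
  have key : ∀ n, ∑ k ∈ Finset.range n, (2 * l - M * c 0) * (c k ^ 2 * v k) ≤
      c 0 * v 0 - c n * v n + ∑ k ∈ Finset.range n, e * c k ^ 3 := by
    intro n
    induction n with
    | zero => simp
    | succ n ih =>
      rw [Finset.sum_range_succ, Finset.sum_range_succ]
      have h0 := hc n
      have h1 : c (n + 1) * v (n + 1) ≤ c n * v (n + 1) :=
        mul_le_mul_of_nonneg_right (hanti n.le_succ) (hv _)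
      have h2 := mul_le_mul_of_nonneg_left (h n) h0.le
      have h3 : M * c n * (c n ^ 2 * v n) ≤ M * c 0 * (c n ^ 2 * v n) := by
        have := hanti (Nat.zero_le n)
        have := hv n
        gcongr
      nlinarith
  rw [le_div_iff₀ (by linarith), mul_comm, ← tsum_mul_left]
  refine Real.tsum_le_of_sum_range_le (fun k => ?_) fun n => (key n).trans ?_
  · exact mul_nonneg (by linarith) (mul_nonneg (sq_nonneg _) (hv k))
  · have h1 := (hc3.mul_left e).sum_le_tsum (Finset.range n)
      fun k _ => mul_nonneg he (pow_pos (hc k) 3).le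
    rw [tsum_mul_left] at h1
    have := mul_nonneg (hc n).le (hv n)
    linarith

end Recursion

end Analysis

namespace Model

variable {Ω : Type*} {mΩ : MeasurableSpace Ω} {μ : Measure Ω} {N : ℕ}
  {A : ℕ → Ω → Matrix (Fin N) (Fin N) ℝ} {ξ : ℕ → Ω → EuclideanSpace ℝ (Fin N × Fin N)}
  {f : Fin N → Fin N → ℝ → ℝ} {σ b : Fin N → Fin N → ℝ} {β : ℝ}
  [IsProbabilityMeasure μ] (h : Model μ A ξ f σ b β) {c : ℕ → ℝ} (X0 : Fin N → ℝ)

/-! ### Mean-square consensus -/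

omit [IsProbabilityMeasure μ] in
theorem integrable_inner_of_memLp {u v : Ω → EuclideanSpace ℝ (Fin N)} (hu : MemLp u 2 μ)
    (hv : MemLp v 2 μ) : Integrable (fun ω => inner ℝ (u ω) (v ω)) μ := by
  simp_rw [inner_eq_sum]
  exact integrable_finsetSum _ fun i _ => (memLp_coord hu i).integrable_mul (memLp_coord hv i)

section MeanSquare

variable (hN : 2 ≤ N) (hc : GainSums c)
  (htree : HasSpanningTree (laplacianEdge (meanMatrix μ fun ω => laplacian (A 0 ω))))

include h

omit [IsProbabilityMeasure μ] in
theorem energyRate_nonneg : 0 ≤ lapSq μ (A 0) + 4 * rho1 μ (A 0) * β * maxPair σ ^ 2 := by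
  have := lapSq_nonneg (μ := μ) (A 0)
  have := rho1_nonneg (μ := μ) (A 0)
  have := h.noiseMDS.1
  positivity

omit [IsProbabilityMeasure μ] in
theorem energyNoise_nonneg : 0 ≤ 2 * β * rho1 μ (A 0) * maxPair b ^ 2 := by
  have := rho1_nonneg (μ := μ) (A 0)
  have := h.noiseMDS.1
  positivity

include hN htree

omit [IsProbabilityMeasure μ] in
theorem lambda2_pos : 0 < lambda2 hN (meanSymLaplacian_isHermitian μ (A 0)) :=
  lambda2_meanSymLaplacian_pos h.flow.2.2.2.1 h.flow.2.2.2.2.1 h.flow.2.2.2.2.2 htree hN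

include hc

/-- The coordinates of PX sum to zero, so the spectral gap of the mean Laplacian turns the drift
into −2cλ₂ E V. -/
theorem integral_energy_succ_le (k : ℕ) :
    ∫ ω, energy (state c f A ξ X0 (k + 1) ω) ∂μ ≤ ∫ ω, energy (state c f A ξ X0 k ω) ∂μ -
      2 * c k * (lambda2 hN (meanSymLaplacian_isHermitian μ (A 0)) *
        ∫ ω, energy (state c f A ξ X0 k ω) ∂μ) +
      c k ^ 2 * ((lapSq μ (A 0) + 4 * rho1 μ (A 0) * β * maxPair σ ^ 2) *
        ∫ ω, energy (state c f A ξ X0 k ω) ∂μ) +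
      c k ^ 2 * (2 * β * rho1 μ (A 0) * maxPair b ^ 2) := by
  have hN0 : N ≠ 0 := by omega
  have h1 := h.integral_norm_sq_succ_le c X0 (isAveraging_projMatrix hN0) k
  have hm := h.memLp_clm_state c X0 (opE (projMatrix N)) k
  have h2 : lambda2 hN (meanSymLaplacian_isHermitian μ (A 0)) *
      ∫ ω, energy (state c f A ξ X0 k ω) ∂μ ≤
      ∫ ω, inner ℝ (opE (projMatrix N) (toE (state c f A ξ X0 k ω)))
        (opE (laplacian (meanMatrix μ (A 0)))
          (opE (projMatrix N) (toE (state c f A ξ X0 k ω)))) ∂μ := by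
    rw [← integral_const_mul]
    refine integral_mono ((h.integrable_energy c X0 k).const_mul _)
      (integrable_inner_of_memLp hm
        ((opE (laplacian (meanMatrix μ (A 0)))).comp_memLp' hm)) fun ω => ?_
    have h0 := lambda2_meanSymLaplacian_mul_le h.flow.2.2.2.1 h.flow.2.2.2.2.1 h.flow.2.2.2.2.2
      htree hN (opE (projMatrix N) (toE (state c f A ξ X0 k ω))) (sum_opE_projMatrix hN0 _)
    rwa [← energy_eq] at h0
  have h3 := mul_le_mul_of_nonneg_left h2 (mul_pos two_pos (hc.1 k)).le
  have h4 : ∀ k, ∫ ω, ‖opE (projMatrix N) (toE (state c f A ξ X0 k ω))‖ ^ 2 ∂μ =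
      ∫ ω, energy (state c f A ξ X0 k ω) ∂μ := fun _ => rfl
  rw [h4 k, h4 (k + 1)] at h1
  linarith

theorem integral_energy_le (k : ℕ) :
    ∫ ω, energy (state c f A ξ X0 k ω) ∂μ ≤
      qv c (lapSq μ (A 0)) (rho1 μ (A 0)) β (maxPair σ) (maxPair b) X0 := by
  have hM := h.energyRate_nonneg
  have he := h.energyNoise_nonneg
  have hv : ∀ k, 0 ≤ ∫ ω, energy (state c f A ξ X0 k ω) ∂μ := fun k =>
    integral_nonneg fun ω => energy_nonneg _
  have key := le_exp_of_recursive_bound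
    (v := fun k => ∫ ω, energy (state c f A ξ X0 k ω) ∂μ)
    (a := fun k => c k ^ 2 * (lapSq μ (A 0) + 4 * rho1 μ (A 0) * β * maxPair σ ^ 2))
    (e := fun k => c k ^ 2 * (2 * β * rho1 μ (A 0) * maxPair b ^ 2))
    (fun k => mul_nonneg (sq_nonneg _) hM) (fun k => mul_nonneg (sq_nonneg _) he)
    (hc.2.2.mul_right _) (hc.2.2.mul_right _) hv (fun k => by
      have h1 := h.integral_energy_succ_le X0 hN hc htree k
      have h2 := mul_nonneg (mul_pos two_pos (hc.1 k)).le
        (mul_nonneg (h.lambda2_pos hN htree).le (hv k))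
      linarith) k
  refine key.trans (le_of_eq ?_)
  simp only [tsum_mul_right, qv, gainSq, state, integral_const, probReal_univ, one_smul]
  ring

theorem summable_gain_mul_energy :
    Summable fun k => c k * ∫ ω, energy (state c f A ξ X0 k ω) ∂μ :=
  summable_mul_of_recursion hc.1 hc.2.2 (fun _ => integral_nonneg fun _ => energy_nonneg _)
    (h.integral_energy_succ_le X0 hN hc htree) (h.lambda2_pos hN htree) h.energyRate_nonneg
    h.energyNoise_nonneg (h.integral_energy_le X0 hN hc htree)

theorem summable_gain_sq_mul_energy :
    Summable fun k => c k ^ 2 * ∫ ω, energy (state c f A ξ X0 k ω) ∂μ :=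
  (hc.2.2.mul_right (qv c (lapSq μ (A 0)) (rho1 μ (A 0)) β (maxPair σ) (maxPair b) X0)
    ).of_nonneg_of_le
    (fun _ => mul_nonneg (sq_nonneg _) (integral_nonneg fun _ => energy_nonneg _))
    fun k => mul_le_mul_of_nonneg_left (h.integral_energy_le X0 hN hc htree k) (sq_nonneg _)

theorem tendsto_integral_energy :
    Tendsto (fun k => ∫ ω, energy (state c f A ξ X0 k ω) ∂μ) atTop (𝓝 0) :=
  tendsto_zero_of_recursion hc.1 hc.2.2 (fun _ => integral_nonneg fun _ => energy_nonneg _)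
    (h.integral_energy_succ_le X0 hN hc htree) hc.2.1 (h.lambda2_pos hN htree)
    h.energyRate_nonneg h.energyNoise_nonneg (h.integral_energy_le X0 hN hc htree)

theorem gainEnergy_le (hanti : Antitone c)
    (hlt : c 0 < 2 * lambda2 hN (meanSymLaplacian_isHermitian μ (A 0)) /
      (lapSq μ (A 0) + 4 * maxPair σ ^ 2 * β * rho1 μ (A 0))) :
    gainEnergy μ c (state c f A ξ X0) ≤
      (c 0 * (∫ ω, energy (state c f A ξ X0 0 ω) ∂μ) +
        2 * maxPair b ^ 2 * β * rho1 μ (A 0) * ∑' k, c k ^ 3) /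
      (2 * lambda2 hN (meanSymLaplacian_isHermitian μ (A 0)) -
        (lapSq μ (A 0) + 4 * maxPair σ ^ 2 * β * rho1 μ (A 0)) * c 0) := by
  have hM : lapSq μ (A 0) + 4 * maxPair σ ^ 2 * β * rho1 μ (A 0) =
      lapSq μ (A 0) + 4 * rho1 μ (A 0) * β * maxPair σ ^ 2 := by ring
  have he : 2 * maxPair b ^ 2 * β * rho1 μ (A 0) = 2 * β * rho1 μ (A 0) * maxPair b ^ 2 := by ring
  rw [hM] at hlt ⊢
  rw [he]
  refine tsum_sq_mul_le_of_recursion hc.1 hc.2.2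
    (fun k => integral_nonneg fun ω => energy_nonneg _)
    (h.integral_energy_succ_le X0 hN hc htree) hanti h.energyRate_nonneg h.energyNoise_nonneg ?_
  -- If the denominator in the gain condition is zero, division cannot be undone, but the product
  -- form then only says λ₂ > 0.
  rcases h.energyRate_nonneg.eq_or_lt with h0 | h0
  · rw [← h0, zero_mul]
    exact mul_pos two_pos (h.lambda2_pos hN htree)
  · rwa [lt_div_iff₀ h0, mul_comm] at hlt

/-- For the unprojected state the mean drift is only known to be nonpositive; Grönwall still
applies, because the noise intensity depends on the energy alone, which is bounded by `qv`. -/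
theorem integral_norm_sq_state_le (k : ℕ) :
    ∫ ω, ‖toE (state c f A ξ X0 k ω)‖ ^ 2 ∂μ ≤
      qx c (lapSq μ (A 0)) (rho1 μ (A 0)) β (maxPair σ) (maxPair b) X0 := by
  set q := qv c (lapSq μ (A 0)) (rho1 μ (A 0)) β (maxPair σ) (maxPair b) X0 with hq
  have hβ := h.noiseMDS.1
  have hρ := rho1_nonneg (μ := μ) (A 0)
  have hL := lapSq_nonneg (μ := μ) (A 0)
  have hq0 : 0 ≤ q := (integral_nonneg fun ω => energy_nonneg _).trans
    (h.integral_energy_le X0 hN hc htree 0)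
  have hv : ∀ k, 0 ≤ ∫ ω, ‖toE (state c f A ξ X0 k ω)‖ ^ 2 ∂μ := fun k =>
    integral_nonneg fun ω => sq_nonneg _
  have key := le_exp_of_recursive_bound
    (v := fun k => ∫ ω, ‖toE (state c f A ξ X0 k ω)‖ ^ 2 ∂μ)
    (a := fun k => c k ^ 2 * lapSq μ (A 0))
    (e := fun k => c k ^ 2 * (rho1 μ (A 0) * (β * (4 * maxPair σ ^ 2 * q + 2 * maxPair b ^ 2))))
    (fun k => by positivity) (fun k => by positivity)
    (hc.2.2.mul_right _) (hc.2.2.mul_right _) hv (fun k => by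
      have h1 := h.integral_norm_sq_succ_le c X0 (isAveraging_id (N := N)) k
      simp only [ContinuousLinearMap.id_apply] at h1
      have h2 : 0 ≤ ∫ ω, inner ℝ (toE (state c f A ξ X0 k ω))
          (opE (laplacian (meanMatrix μ (A 0))) (toE (state c f A ξ X0 k ω))) ∂μ :=
        integral_nonneg fun ω =>
          inner_opE_laplacian_nonneg h.flow.2.2.2.2.2 h.flow.2.2.2.2.1 _
      have h3 := mul_nonneg (mul_pos two_pos (hc.1 k)).le h2
      have h4 : c k ^ 2 * (rho1 μ (A 0) * (β * (4 * maxPair σ ^ 2 *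
          ∫ ω, energy (state c f A ξ X0 k ω) ∂μ + 2 * maxPair b ^ 2))) ≤
          c k ^ 2 * (rho1 μ (A 0) * (β * (4 * maxPair σ ^ 2 * q + 2 * maxPair b ^ 2))) := by
        have := h.integral_energy_le X0 hN hc htree k
        gcongr
      linarith) k
  refine key.trans (le_of_eq ?_)
  simp only [tsum_mul_right, qx, gainSq, state, integral_const, probReal_univ, one_smul]
  ring

end MeanSquare

/-! ### Almost sure consensus -/

section AlmostSure

variable (hN : 2 ≤ N) (hc : GainSums c)
  (htree : HasSpanningTree (laplacianEdge (meanMatrix μ fun ω => laplacian (A 0 ω))))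

include h hN hc htree

theorem ae_summable_gain_mul_energy :
    ∀ᵐ ω ∂μ, Summable fun k => c k * energy (state c f A ξ X0 k ω) := by
  refine ae_summable_of_summable_integral_norm (fun k => (h.integrable_energy c X0 k).const_mul _)
    (h.summable_gain_mul_energy X0 hN hc htree) fun k => le_of_eq ?_
  rw [← integral_const_mul]
  refine integral_congr_ae (ae_of_all _ fun ω => ?_)
  exact Real.norm_of_nonneg (mul_nonneg (hc.1 k).le (energy_nonneg _))

/-- The increment of V splits into a martingale difference `m` and a remainder `r` that needs no
cancellation: ∑ E|r| already converges because ∑ c E V does. -/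
theorem ae_tendsto_energy :
    ∀ᵐ ω ∂μ, Tendsto (fun k => energy (state c f A ξ X0 k ω)) atTop (𝓝 0) := by
  set P := opE (projMatrix N) with hP
  have hQ : IsAveraging P := isAveraging_projMatrix (by omega)
  set m : ℕ → Ω → ℝ := fun k ω => 2 * c k * inner ℝ
      (P (toE (state c f A ξ X0 k ω)) -
        c k • P (opE (laplacian (A k ω)) (P (toE (state c f A ξ X0 k ω)))))
      (toE (noise f (A k ω) (state c f A ξ X0 k ω) (ξ k ω))) with hm
  have hmi : ∀ k, Integrable (m k) μ := fun k =>
    ((h.condExp_inner_step c X0 (Q := P) k).2.1).const_mul _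
  have hVi : ∀ k, Integrable (fun ω => energy (state c f A ξ X0 k ω)) μ :=
    h.integrable_energy c X0
  set r : ℕ → Ω → ℝ := fun k ω => energy (state c f A ξ X0 (k + 1) ω) -
    energy (state c f A ξ X0 k ω) - m k ω with hr
  have hri : ∀ k, Integrable (r k) μ := fun k => ((hVi (k + 1)).sub (hVi k)).sub (hmi k)
  set v : ℕ → ℝ := fun k => ∫ ω, energy (state c f A ξ X0 k ω) ∂μ with hv
  -- The four terms bound, in order, the drift, ‖LPX‖², and the energy-dependent and constant parts
  -- of the noise.
  set s : ℕ → ℝ := fun k => 2 * (1 + lapSq μ (A 0)) * (c k * v k) +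
    lapSq μ (A 0) * (c k ^ 2 * v k) + (rho1 μ (A 0) * (β * (4 * maxPair σ ^ 2))) *
      (c k ^ 2 * v k) + (rho1 μ (A 0) * (β * (2 * maxPair b ^ 2))) * c k ^ 2 with hs
  have hss : Summable s :=
    ((((h.summable_gain_mul_energy X0 hN hc htree).mul_left _).add
      ((h.summable_gain_sq_mul_energy X0 hN hc htree).mul_left _)).add
      ((h.summable_gain_sq_mul_energy X0 hN hc htree).mul_left _)).add (hc.2.2.mul_left _)
  have hrs : ∀ k, ∫ ω, ‖r k ω‖ ∂μ ≤ s k := by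
    intro k
    have hck := hc.1 k
    have hH := h.measurable_state_flowFiltration c X0 k
    have hG := h.measurable_state_noiseFiltration c X0 k
    have hu : Measurable[h.flowFiltration k] fun ω => P (toE (state c f A ξ X0 k ω)) :=
      P.continuous.measurable.comp (measurable_toE.comp hH)
    have hu2 := h.memLp_clm_state c X0 P k
    obtain ⟨mL, eL⟩ := h.integral_norm_sq_opE_laplacian_le hu hu2
    obtain ⟨mW, eW⟩ := h.integral_norm_sq_noise_le hH hG (hVi k)
    have hVH : Measurable[h.flowFiltration k] fun ω => energy (state c f A ξ X0 k ω) :=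
      measurable_energy.comp hH
    obtain ⟨iB, eB⟩ := h.integral_mul_flow k (u := fun M => 1 + norm2 (laplacian M) ^ 2)
      (((measurable_norm2.comp measurable_laplacian).pow_const 2).const_add 1)
      ((integrable_const 1).add (h.integrable_norm2_sq k)) hVH (hVi k)
    rw [integral_add (integrable_const 1) (h.integrable_norm2_sq k), h.integral_norm2_sq k] at eB
    have hpt : ∀ ω, ‖r k ω‖ ≤ 2 * c k * ((1 + norm2 (laplacian (A k ω)) ^ 2) *
        energy (state c f A ξ X0 k ω)) +
        c k ^ 2 * ‖opE (laplacian (A k ω)) (P (toE (state c f A ξ X0 k ω)))‖ ^ 2 +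
        c k ^ 2 * ‖toE (noise f (A k ω) (state c f A ξ X0 k ω) (ξ k ω))‖ ^ 2 := by
      intro ω
      have hstep := hQ.norm_sq_step (A k ω) (c k) (toE (state c f A ξ X0 k ω))
        (toE (noise f (A k ω) (state c f A ξ X0 k ω) (ξ k ω)))
      rw [← toE_state_succ] at hstep
      have hreq : r k ω = - 2 * c k * inner ℝ (P (toE (state c f A ξ X0 k ω)))
          (opE (laplacian (A k ω)) (P (toE (state c f A ξ X0 k ω)))) +
          c k ^ 2 * ‖P (opE (laplacian (A k ω)) (P (toE (state c f A ξ X0 k ω))))‖ ^ 2 +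
          c k ^ 2 * ‖P (toE (noise f (A k ω) (state c f A ξ X0 k ω) (ξ k ω)))‖ ^ 2 := by
        simp only [hr, hm, energy_eq, ← hP]
        rw [hstep]
        ring
      have h1 : |inner ℝ (P (toE (state c f A ξ X0 k ω)))
          (opE (laplacian (A k ω)) (P (toE (state c f A ξ X0 k ω))))| ≤
          (1 + norm2 (laplacian (A k ω)) ^ 2) * energy (state c f A ξ X0 k ω) := by
        refine (abs_real_inner_le_norm _ _).trans ?_
        have h2 := norm_opE_le (laplacian (A k ω)) (P (toE (state c f A ξ X0 k ω)))
        -- Bounding ‖L‖ by 1 + ‖L‖² makes the second moment of L sufficient.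
        have h3 : norm2 (laplacian (A k ω)) ≤ 1 + norm2 (laplacian (A k ω)) ^ 2 := by
          nlinarith [sq_nonneg (norm2 (laplacian (A k ω)) - 1)]
        calc _ ≤ ‖P (toE (state c f A ξ X0 k ω))‖ *
              (norm2 (laplacian (A k ω)) * ‖P (toE (state c f A ξ X0 k ω))‖) :=
              mul_le_mul_of_nonneg_left h2 (norm_nonneg _)
          _ = norm2 (laplacian (A k ω)) * energy (state c f A ξ X0 k ω) := by
              rw [energy_eq]; ring
          _ ≤ _ := mul_le_mul_of_nonneg_right h3 (energy_nonneg _)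
      have h4 := pow_le_pow_left₀ (norm_nonneg _)
        (hQ.norm_le (opE (laplacian (A k ω)) (P (toE (state c f A ξ X0 k ω))))) 2
      have h5 := pow_le_pow_left₀ (norm_nonneg _)
        (hQ.norm_le (toE (noise f (A k ω) (state c f A ξ X0 k ω) (ξ k ω)))) 2
      rw [hreq, Real.norm_eq_abs]
      refine (abs_add_le _ _).trans (add_le_add ((abs_add_le _ _).trans (add_le_add ?_ ?_)) ?_)
      · rw [abs_mul, abs_of_neg (by linarith : -2 * c k < 0)]
        have := mul_le_mul_of_nonneg_left h1 (mul_pos two_pos hck).le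
        linarith
      · rw [abs_of_nonneg (by positivity)]
        gcongr
      · rw [abs_of_nonneg (by positivity)]
        gcongr
    have iL : Integrable (fun ω => c k ^ 2 *
        ‖opE (laplacian (A k ω)) (P (toE (state c f A ξ X0 k ω)))‖ ^ 2) μ :=
      mL.integrable_norm_pow'.const_mul _
    have iW : Integrable (fun ω => c k ^ 2 *
        ‖toE (noise f (A k ω) (state c f A ξ X0 k ω) (ξ k ω))‖ ^ 2) μ :=
      mW.integrable_norm_pow'.const_mul _
    have iBL : Integrable (fun ω => 2 * c k * ((1 + norm2 (laplacian (A k ω)) ^ 2) *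
        energy (state c f A ξ X0 k ω)) +
        c k ^ 2 * ‖opE (laplacian (A k ω)) (P (toE (state c f A ξ X0 k ω)))‖ ^ 2) μ :=
      (iB.const_mul _).add iL
    refine (integral_mono (hri k).norm (iBL.add iW) hpt).trans ?_
    simp only [Pi.add_apply]
    rw [integral_add iBL iW, integral_add (iB.const_mul _) iL, integral_const_mul,
      integral_const_mul, integral_const_mul, eB]
    have e1 := mul_le_mul_of_nonneg_left eL (sq_nonneg (c k))
    have e2 := mul_le_mul_of_nonneg_left eW (sq_nonneg (c k))
    have e3 : ∫ ω, ‖P (toE (state c f A ξ X0 k ω))‖ ^ 2 ∂μ = v k := rfl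
    rw [e3] at e1
    simp only [integral_const, probReal_univ, one_smul, hs]
    calc _ ≤ 2 * c k * ((1 + lapSq μ (A 0)) * v k) + c k ^ 2 * (lapSq μ (A 0) * v k) +
          c k ^ 2 * (rho1 μ (A 0) * (β * (4 * maxPair σ ^ 2 * v k + 2 * maxPair b ^ 2))) :=
          add_le_add (add_le_add le_rfl e1) e2
      _ = _ := by ring
  have hsum : ∀ n ω, energy (state c f A ξ X0 n ω) = energy (state c f A ξ X0 0 ω) +
      ∑ k ∈ Finset.range n, r k ω + ∑ k ∈ Finset.range n, m k ω := by
    intro n ω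
    induction n with
    | zero => simp
    | succ n ih =>
      rw [Finset.sum_range_succ, Finset.sum_range_succ]
      simp only [hr] at ih ⊢
      linarith
  set q := qv c (lapSq μ (A 0)) (rho1 μ (A 0)) β (maxPair σ) (maxPair b) X0 with hq
  have hq' : ∀ k, v k ≤ q := h.integral_energy_le X0 hN hc htree
  -- The martingale equals V(n) − V(0) − ∑ r, and each of these is bounded in L¹.
  have hbdd : ∀ n, ∫ ω, |∑ k ∈ Finset.range n, m k ω| ∂μ ≤ q + q + ∑' k, s k := by
    intro n
    have hrn : Integrable (fun ω => ∑ k ∈ Finset.range n, ‖r k ω‖) μ :=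
      integrable_finsetSum _ fun k _ => (hri k).norm
    have hVV : Integrable (fun ω => energy (state c f A ξ X0 n ω) +
        energy (state c f A ξ X0 0 ω)) μ := (hVi n).add (hVi 0)
    have hle : ∀ ω, |∑ k ∈ Finset.range n, m k ω| ≤ energy (state c f A ξ X0 n ω) +
        energy (state c f A ξ X0 0 ω) + ∑ k ∈ Finset.range n, ‖r k ω‖ := by
      intro ω
      have h1 := hsum n ω
      have h2 : |∑ k ∈ Finset.range n, r k ω| ≤ ∑ k ∈ Finset.range n, ‖r k ω‖ :=
        Finset.abs_sum_le_sum_abs _ _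
      have h3 := energy_nonneg (state c f A ξ X0 n ω)
      have h4 := energy_nonneg (state c f A ξ X0 0 ω)
      rw [abs_le] at h2 ⊢
      constructor <;> linarith [h2.1, h2.2]
    refine (integral_mono (integrable_finsetSum _ fun k _ => hmi k).abs (hVV.add hrn) hle).trans ?_
    simp only [Pi.add_apply]
    rw [integral_add hVV hrn, integral_add (hVi n) (hVi 0),
      integral_finsetSum _ fun k _ => (hri k).norm]
    refine add_le_add (add_le_add (hq' n) (hq' 0)) ?_
    exact (Finset.sum_le_sum fun k _ => hrs k).trans (hss.sum_le_tsum _ fun k _ =>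
      (integral_nonneg fun _ => norm_nonneg _).trans (hrs k))
  obtain ⟨Z, -, hZ⟩ := exists_tendsto_sum_of_integral_abs_le (𝒢 := h.noiseFiltration) (D := m)
    (fun k => ((h.condExp_inner_step c X0 (Q := P) k).1.const_mul _).stronglyMeasurable) hmi
    (fun k => by
      refine (condExp_smul (2 * c k) _ _).trans ?_
      filter_upwards [(h.condExp_inner_step c X0 (Q := P) k).2.2] with ω hω
      rw [Pi.smul_apply, hω, Pi.zero_apply, smul_zero]) hbdd
  filter_upwards [hZ, ae_summable_of_summable_integral_norm hri hss hrs,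
    h.ae_summable_gain_mul_energy X0 hN hc htree] with ω h1 h2 h3
  have hlim : Tendsto (fun n => energy (state c f A ξ X0 n ω)) atTop
      (𝓝 (energy (state c f A ξ X0 0 ω) + ∑' k, r k ω + Z ω)) := by
    refine Tendsto.congr (fun n => (hsum n ω).symm) ?_
    exact (h2.hasSum.tendsto_sum_nat.const_add _).add h1
  have h0 := eq_zero_of_tendsto_of_summable_mul hc.1 hc.2.1 (fun k => energy_nonneg _) h3 hlim
  rwa [h0] at hlim

end AlmostSure

end Model

namespace Model

variable {Ω : Type*} {mΩ : MeasurableSpace Ω} {μ : Measure Ω} {N : ℕ}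
  {A : ℕ → Ω → Matrix (Fin N) (Fin N) ℝ} {ξ : ℕ → Ω → EuclideanSpace ℝ (Fin N × Fin N)}
  {f : Fin N → Fin N → ℝ → ℝ} {σ b : Fin N → Fin N → ℝ} {β : ℝ}
  [IsProbabilityMeasure μ] (h : Model μ A ξ f σ b β) {c : ℕ → ℝ} (X0 : Fin N → ℝ)

/-! ### The average of the states -/

section Average

omit [IsProbabilityMeasure μ] in
-- The two sums are kept apart because they are martingales for different filtrations.
theorem average_state_eq (n : ℕ) (ω : Ω) :
    (1 / (N : ℝ)) * ∑ i, state c f A ξ X0 n ω i = (1 / (N : ℝ)) * ∑ i, X0 i +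
      (∑ k ∈ Finset.range n, -(c k / N) *
        ∑ i, opE (laplacian (A k ω)) (toE (state c f A ξ X0 k ω)) i +
      ∑ k ∈ Finset.range n, c k / N * ∑ i, noise f (A k ω) (state c f A ξ X0 k ω) (ξ k ω) i) := by
  induction n with
  | zero => simp [state]
  | succ n ih =>
    have hi : ∀ i, state c f A ξ X0 (n + 1) ω i = state c f A ξ X0 n ω i -
        c n * opE (laplacian (A n ω)) (toE (state c f A ξ X0 n ω)) i +
        c n * noise f (A n ω) (state c f A ξ X0 n ω) (ξ n ω) i := fun i =>
      congrArg (fun u : EuclideanSpace ℝ (Fin N) => u i) (toE_state_succ c f A ξ X0 n ω)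
    rw [Finset.sum_congr rfl fun i _ => hi i, Finset.sum_add_distrib, Finset.sum_sub_distrib,
      ← Finset.mul_sum, ← Finset.mul_sum, mul_add, mul_sub, ih, Finset.sum_range_succ,
      Finset.sum_range_succ]
    ring

omit [IsProbabilityMeasure μ] in
-- The deviation is the i-th coordinate of PX plus the errors of the two partial sums, and (p + q +
-- r)² ≤ 3(p² + q² + r²).
theorem sq_state_sub_le (a z₁ z₂ : ℝ) (n : ℕ) (ω : Ω) (s₁ s₂ : ℝ)
    (hs : (1 / (N : ℝ)) * ∑ i, state c f A ξ X0 n ω i = a + (s₁ + s₂)) (i : Fin N) :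
    (state c f A ξ X0 n ω i - (a + (z₁ + z₂))) ^ 2 ≤
      3 * energy (state c f A ξ X0 n ω) + 3 * (s₁ - z₁) ^ 2 + 3 * (s₂ - z₂) ^ 2 := by
  have h1 := opE_projMatrix_apply (toE (state c f A ξ X0 n ω)) i
  have h2 : opE (projMatrix N) (toE (state c f A ξ X0 n ω)) i ^ 2 ≤
      energy (state c f A ξ X0 n ω) := by
    rw [energy_eq, ← sq_abs]
    exact pow_le_pow_left₀ (abs_nonneg _) (abs_apply_le_norm _ _) 2
  set d := opE (projMatrix N) (toE (state c f A ξ X0 n ω)) i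
  have h3 : state c f A ξ X0 n ω i - (a + (z₁ + z₂)) = d + (s₁ - z₁) + (s₂ - z₂) := by
    have : d = state c f A ξ X0 n ω i - (a + (s₁ + s₂)) := by rw [h1, ← hs]
    linarith
  rw [h3]
  nlinarith [sq_nonneg (d - (s₁ - z₁)), sq_nonneg (d - (s₂ - z₂)),
    sq_nonneg ((s₁ - z₁) - (s₂ - z₂))]

include h

/-- 1ᵀLX weights the states by in-degree minus out-degree of A(k). These weights are independent of
H_k and have mean zero by balance. -/
theorem flow_average_diff (k : ℕ) :
    Measurable[h.flowFiltration (k + 1)] (fun ω => -(c k / N) *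
      ∑ i, opE (laplacian (A k ω)) (toE (state c f A ξ X0 k ω)) i) ∧
    MemLp (fun ω => -(c k / N) *
      ∑ i, opE (laplacian (A k ω)) (toE (state c f A ξ X0 k ω)) i) 2 μ ∧
    μ[fun ω => -(c k / N) * ∑ i, opE (laplacian (A k ω)) (toE (state c f A ξ X0 k ω)) i |
      h.flowFiltration k] =ᵐ[μ] 0 ∧
    ∫ ω, (-(c k / N) * ∑ i, opE (laplacian (A k ω)) (toE (state c f A ξ X0 k ω)) i) ^ 2 ∂μ ≤
      (c k / N) ^ 2 * (N * rho2 μ (A 0) * ∫ ω, ‖toE (state c f A ξ X0 k ω)‖ ^ 2 ∂μ) := by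
  have hH := h.measurable_state_flowFiltration c X0 k
  have hH' : Measurable[h.flowFiltration (k + 1)] fun ω => state c f A ξ X0 k ω :=
    hH.mono (h.flowFiltration.mono k.le_succ) le_rfl
  have hu : Measurable[h.flowFiltration k] fun ω => toE (state c f A ξ X0 k ω) :=
    measurable_toE.comp hH
  have hu2 := h.memLp_toE_state c X0 k
  have h1 := h.integral_sq_sum_opE_laplacian_le hu hu2
  refine ⟨?_, h1.1.const_mul _, ?_, ?_⟩
  · refine Measurable.const_mul (Finset.measurable_fun_sum _ fun i _ =>
      (measurable_coord i).comp (measurable_opE_laplacian ?_ (measurable_toE.comp hH'))) _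
    exact measurable_jointFiltration_right h.measurable_noise h.measurable_flow k.lt_succ_self
  · have h2 := (h.condExp_inner_opE_laplacian (u := fun _ => toE fun _ => (1 : ℝ))
      measurable_const (memLp_const _) hu hu2).2
    have hone : ∀ w : EuclideanSpace ℝ (Fin N), inner ℝ (toE fun _ => (1 : ℝ)) w = ∑ i, w i :=
      fun w => by rw [inner_eq_sum]; simp
    simp only [hone] at h2
    refine (condExp_smul (-(c k / N)) _ _).trans ?_
    filter_upwards [h2] with ω hω
    rw [Pi.smul_apply, hω, sum_opE_laplacian]
    simp [sub_eq_zero.2 (h.flow.2.2.2.2.2 _)]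
  · simp_rw [mul_pow, neg_sq]
    rw [integral_const_mul]
    exact mul_le_mul_of_nonneg_left h1.2 (sq_nonneg _)

theorem noise_average_diff (k : ℕ) :
    Measurable[h.noiseFiltration (k + 1)] (fun ω => c k / N *
      ∑ i, noise f (A k ω) (state c f A ξ X0 k ω) (ξ k ω) i) ∧
    MemLp (fun ω => c k / N *
      ∑ i, noise f (A k ω) (state c f A ξ X0 k ω) (ξ k ω) i) 2 μ ∧
    μ[fun ω => c k / N * ∑ i, noise f (A k ω) (state c f A ξ X0 k ω) (ξ k ω) i |
      h.noiseFiltration k] =ᵐ[μ] 0 ∧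
    ∫ ω, (c k / N * ∑ i, noise f (A k ω) (state c f A ξ X0 k ω) (ξ k ω) i) ^ 2 ∂μ ≤
      (c k / N) ^ 2 * (rho1 μ (A 0) * (β * (4 * maxPair σ ^ 2 *
        ∫ ω, energy (state c f A ξ X0 k ω) ∂μ + 2 * maxPair b ^ 2))) := by
  have hH := h.measurable_state_flowFiltration c X0 k
  have hG := h.measurable_state_noiseFiltration c X0 k
  have hG' : Measurable[h.noiseFiltration (k + 1)] fun ω => state c f A ξ X0 k ω :=
    hG.mono (h.noiseFiltration.mono k.le_succ) le_rfl
  have h1 := h.integral_sq_sum_noise_le hH hG (h.integrable_energy c X0 k)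
  refine ⟨?_, h1.1.const_mul _, ?_, ?_⟩
  · refine Measurable.const_mul (Finset.measurable_fun_sum _ fun i _ =>
      (measurable_pi_apply i).comp ((Consensus.measurable_noise h.measurable_intensity).comp
        (((measurable_jointFiltration_left h.measurable_flow h.measurable_noise k (k + 1)).prodMk
          hG').prodMk ?_))) _
    exact measurable_jointFiltration_right h.measurable_flow h.measurable_noise k.lt_succ_self
  · have h2 := (h.condExp_inner_noise hH hG (h.integrable_energy c X0 k)
      (u := fun _ => toE fun _ => (1 : ℝ)) measurable_const (memLp_const _)).2
    have hone : ∀ w : Fin N → ℝ, inner ℝ (toE fun _ => (1 : ℝ)) (toE w) = ∑ i, w i :=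
      fun w => by rw [inner_eq_sum]; simp
    simp only [hone] at h2
    refine (condExp_smul (c k / N) _ _).trans ?_
    filter_upwards [h2] with ω hω
    rw [Pi.smul_apply, hω]
    simp
  · simp_rw [mul_pow]
    rw [integral_const_mul]
    exact mul_le_mul_of_nonneg_left h1.2 (sq_nonneg _)

/-- The limit is the initial average plus the limits of the flow and noise martingales. Since these
belong to different filtrations, their sum is estimated by (p + q)² ≤ 2p² + 2q²; this doubles each
contribution to the variance. -/
theorem exists_average_consensus (hN : 2 ≤ N) (hc : GainSums c)
    (htree : HasSpanningTree (laplacianEdge (meanMatrix μ fun ω => laplacian (A 0 ω)))) :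
    ∃ xs : Ω → ℝ, Measurable xs ∧ MemLp xs 2 μ ∧
      (∀ i, Tendsto (fun k => ∫ ω, (state c f A ξ X0 k ω i - xs ω) ^ 2 ∂μ) atTop (𝓝 0)) ∧
      (∀ᵐ ω ∂μ, ∀ i, Tendsto (fun k => state c f A ξ X0 k ω i) atTop (𝓝 (xs ω))) ∧
      ∫ ω, xs ω ∂μ = (1 / (N : ℝ)) * ∑ j, X0 j ∧
      variance xs μ ≤
        4 * gainSq c * β * maxPair b ^ 2 * rho1 μ (A 0) / (N : ℝ) ^ 2 +
        8 * gainEnergy μ c (state c f A ξ X0) * β * maxPair σ ^ 2 * rho1 μ (A 0) / (N : ℝ) ^ 2 +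
        2 * gainSq c * rho2 μ (A 0) *
          qx c (lapSq μ (A 0)) (rho1 μ (A 0)) β (maxPair σ) (maxPair b) X0 / (N : ℝ) := by
  have hN0 : (N : ℝ) ≠ 0 := Nat.cast_ne_zero.2 (by omega)
  set a := (1 / (N : ℝ)) * ∑ j, X0 j with ha
  set q := qx c (lapSq μ (A 0)) (rho1 μ (A 0)) β (maxPair σ) (maxPair b) X0 with hq
  have hρ₂ : 0 ≤ rho2 μ (A 0) := Real.iSup_nonneg fun i => integral_nonneg fun ω => sq_nonneg _
  have hsV := h.summable_gain_sq_mul_energy X0 hN hc htree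
  -- Each flow term is at most (c/N)² · Nρ̄₂q_x, which leaves a single N in the denominator.
  have hs₁ : HasSum (fun k => c k ^ 2 * (rho2 μ (A 0) * q / N))
      (gainSq c * (rho2 μ (A 0) * q / N)) := hc.2.2.hasSum.mul_right _
  have hs₂ : HasSum (fun k => c k ^ 2 * (∫ ω, energy (state c f A ξ X0 k ω) ∂μ) *
      (4 * β * maxPair σ ^ 2 * rho1 μ (A 0) / (N : ℝ) ^ 2) +
      c k ^ 2 * (2 * β * maxPair b ^ 2 * rho1 μ (A 0) / (N : ℝ) ^ 2))
      (gainEnergy μ c (state c f A ξ X0) * (4 * β * maxPair σ ^ 2 * rho1 μ (A 0) / (N : ℝ) ^ 2) +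
        gainSq c * (2 * β * maxPair b ^ 2 * rho1 μ (A 0) / (N : ℝ) ^ 2)) :=
    (hsV.hasSum.mul_right _).add (hc.2.2.hasSum.mul_right _)
  obtain ⟨Z₁, hm₁, hL₁, has₁, hlim₁, hmean₁, hsq₁⟩ := exists_tendsto_sum_of_summable_sq
    (𝒢 := h.flowFiltration) (D := fun k ω => -(c k / N) *
      ∑ i, opE (laplacian (A k ω)) (toE (state c f A ξ X0 k ω)) i)
    (fun k => (h.flow_average_diff X0 k).1.stronglyMeasurable)
    (fun k => (h.flow_average_diff X0 k).2.1) (fun k => (h.flow_average_diff X0 k).2.2.1)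
    hs₁.summable (fun k => (h.flow_average_diff X0 k).2.2.2.trans (by
      calc (c k / N) ^ 2 * (N * rho2 μ (A 0) * ∫ ω, ‖toE (state c f A ξ X0 k ω)‖ ^ 2 ∂μ)
          ≤ (c k / N) ^ 2 * (N * rho2 μ (A 0) * q) := by
            have := h.integral_norm_sq_state_le X0 hN hc htree k
            gcongr
        _ = _ := by field_simp))
  obtain ⟨Z₂, hm₂, hL₂, has₂, hlim₂, hmean₂, hsq₂⟩ := exists_tendsto_sum_of_summable_sq
    (𝒢 := h.noiseFiltration) (D := fun k ω => c k / N *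
      ∑ i, noise f (A k ω) (state c f A ξ X0 k ω) (ξ k ω) i)
    (fun k => (h.noise_average_diff X0 k).1.stronglyMeasurable)
    (fun k => (h.noise_average_diff X0 k).2.1) (fun k => (h.noise_average_diff X0 k).2.2.1)
    hs₂.summable (fun k => (h.noise_average_diff X0 k).2.2.2.trans (le_of_eq (by
      field_simp)))
  have hL₁₂ : MemLp (fun ω => Z₁ ω + Z₂ ω) 2 μ := hL₁.add hL₂
  have hxsL : MemLp (fun ω => a + (Z₁ ω + Z₂ ω)) 2 μ := (memLp_const a).add hL₁₂
  refine ⟨fun ω => a + (Z₁ ω + Z₂ ω), (hm₁.add hm₂).const_add a, hxsL, ?_, ?_, ?_, ?_⟩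
  · intro i
    have hV := h.tendsto_integral_energy X0 hN hc htree
    have hlim := ((hV.const_mul 3).add (hlim₁.const_mul 3)).add (hlim₂.const_mul 3)
    simp only [mul_zero, add_zero] at hlim
    refine squeeze_zero (fun k => integral_nonneg fun ω => sq_nonneg _) (fun k => ?_) hlim
    have i0 := (h.integrable_energy c X0 k).const_mul 3
    have i1 := ((memLp_finsetSum (Finset.range k) fun l _ =>
      (h.flow_average_diff (c := c) X0 l).2.1).sub hL₁).integrable_sq.const_mul 3
    have i2 := ((memLp_finsetSum (Finset.range k) fun l _ =>
      (h.noise_average_diff (c := c) X0 l).2.1).sub hL₂).integrable_sq.const_mul 3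
    simp only [Pi.sub_apply] at i1 i2
    have hxi : MemLp (fun ω => state c f A ξ X0 k ω i) 2 μ :=
      memLp_coord (h.memLp_toE_state c X0 k) i
    rw [← integral_const_mul, ← integral_const_mul, ← integral_const_mul, ← integral_add i0 i1,
      ← integral_add (i0.fun_add i1) i2]
    refine integral_mono (hxi.sub hxsL).integrable_sq ((i0.add i1).add i2) fun ω => ?_
    exact sq_state_sub_le X0 a _ _ k ω _ _ (average_state_eq X0 k ω) i
  · filter_upwards [has₁, has₂, h.ae_tendsto_energy X0 hN hc htree] with ω h1 h2 h3 i
    have h4 : Tendsto (fun k => opE (projMatrix N) (toE (state c f A ξ X0 k ω)) i)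
        atTop (𝓝 0) := by
      refine squeeze_zero_norm (fun k => ?_)
        (by simpa using (Real.continuous_sqrt.tendsto 0).comp h3)
      rw [Function.comp_apply, energy_eq, Real.sqrt_sq (norm_nonneg _)]
      exact abs_apply_le_norm _ _
    have h5 := h4.add ((h1.add h2).const_add a)
    rw [zero_add] at h5
    refine h5.congr fun k => ?_
    rw [opE_projMatrix_apply, ← average_state_eq X0 k ω]
    simp
  · have hi₁ := hL₁.integrable (by norm_num)
    have hi₂ := hL₂.integrable (by norm_num)
    rw [integral_add (integrable_const a) (hL₁₂.integrable (by norm_num)),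
      integral_add hi₁ hi₂, hmean₁, hmean₂]
    simp
  · rw [variance_const_add hL₁₂.1]
    refine (variance_le_expectation_sq hL₁₂.1).trans ?_
    have h1 : ∫ ω, (Z₁ ω + Z₂ ω) ^ 2 ∂μ ≤ 2 * ∫ ω, Z₁ ω ^ 2 ∂μ + 2 * ∫ ω, Z₂ ω ^ 2 ∂μ := by
      rw [← integral_const_mul, ← integral_const_mul,
        ← integral_add (hL₁.integrable_sq.const_mul 2) (hL₂.integrable_sq.const_mul 2)]
      refine integral_mono hL₁₂.integrable_sq
        ((hL₁.integrable_sq.const_mul 2).add (hL₂.integrable_sq.const_mul 2)) fun ω => ?_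
      show (Z₁ ω + Z₂ ω) ^ 2 ≤ 2 * Z₁ ω ^ 2 + 2 * Z₂ ω ^ 2
      nlinarith [sq_nonneg (Z₁ ω - Z₂ ω)]
    rw [hs₁.tsum_eq] at hsq₁
    rw [hs₂.tsum_eq] at hsq₂
    calc ∫ ω, (Z₁ ω + Z₂ ω) ^ 2 ∂μ ≤ _ := h1
      _ ≤ _ := add_le_add (mul_le_mul_of_nonneg_left hsq₁ two_pos.le)
        (mul_le_mul_of_nonneg_left hsq₂ two_pos.le)
      _ = _ := by ring

end Average

end Model

end Consensus

end

/-! ### The main theorem -/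

open Consensus in
theorem theorem4 {Ω : Type*} [MeasurableSpace Ω] (μ : Measure Ω) [IsProbabilityMeasure μ]
    {N : ℕ} (hN : 2 ≤ N)
    (A : ℕ → Ω → Matrix (Fin N) (Fin N) ℝ)
    (ξ : ℕ → Ω → EuclideanSpace ℝ (Fin N × Fin N))
    (f : Fin N → Fin N → ℝ → ℝ) (σ b : Fin N → Fin N → ℝ) (β : ℝ) (c : ℕ → ℝ)
    (hflow : IIDBalancedFlow μ A)
    (hf : IntensityGrowth f σ b) (hξ : NoiseMDS μ ξ β)
    (hc : GainSums c) (hc' : GainDecay c) (hind : FlowNoiseIndep μ A ξ)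
    (htree : HasSpanningTree (laplacianEdge (meanMatrix μ fun ω => laplacian (A 0 ω))))
    (hL : Integrable (fun ω => norm2 (laplacian (A 0 ω)) ^ 2) μ)
    -- self-loops do not enter the Laplacian; without self-loops this hypothesis is void
    (hloop : ∀ i, Integrable (fun ω => A 0 ω i i ^ 2) μ)
    (X0 : Fin N → ℝ) :
    -- the constants below are finite
    Integrable (fun ω => edgeWeight (A 0 ω)) μ ∧
    (∀ i, Integrable (fun ω => (degIn (A 0 ω) i - degOut (A 0 ω) i) ^ 2) μ) ∧
    (∀ k i, MemLp (fun ω => state c f A ξ X0 k ω i) 2 μ) ∧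
    (Summable fun k => c k ^ 2 * ∫ ω, energy (state c f A ξ X0 k ω) ∂μ) ∧
    -- average consensus, with a bound on the variance of the limit
    (∃ xs : Ω → ℝ, Measurable xs ∧ MemLp xs 2 μ ∧
      (∀ i, Tendsto (fun k => ∫ ω, (state c f A ξ X0 k ω i - xs ω) ^ 2 ∂μ) atTop (𝓝 0)) ∧
      (∀ᵐ ω ∂μ, ∀ i, Tendsto (fun k => state c f A ξ X0 k ω i) atTop (𝓝 (xs ω))) ∧
      ∫ ω, xs ω ∂μ = (1 / (N : ℝ)) * ∑ j, X0 j ∧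
      variance xs μ ≤
        4 * gainSq c * β * maxPair b ^ 2 * rho1 μ (A 0) / (N : ℝ) ^ 2 +
        8 * gainEnergy μ c (state c f A ξ X0) * β * maxPair σ ^ 2 * rho1 μ (A 0) / (N : ℝ) ^ 2 +
        2 * gainSq c * rho2 μ (A 0) *
          qx c (lapSq μ (A 0)) (rho1 μ (A 0)) β (maxPair σ) (maxPair b) X0 / (N : ℝ)) ∧
    -- convergence rate of the mean consensus error
    (∀ᵐ ω ∂μ, (fun n : ℕ => (1 / (n : ℝ)) *
        ∑ k ∈ Finset.range (n + 1), ‖consensusError (state c f A ξ X0 k ω)‖)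
      =o[atTop] fun n : ℕ => 1 / Real.sqrt (c n * n)) ∧
    -- bound for small initial gain
    (c 0 < 2 * lambda2 hN (meanSymLaplacian_isHermitian μ (A 0)) /
        (lapSq μ (A 0) + 4 * maxPair σ ^ 2 * β * rho1 μ (A 0)) →
      gainEnergy μ c (state c f A ξ X0) ≤
        (c 0 * (∫ ω, energy (state c f A ξ X0 0 ω) ∂μ) +
          2 * maxPair b ^ 2 * β * rho1 μ (A 0) * ∑' k, c k ^ 3) /
        (2 * lambda2 hN (meanSymLaplacian_isHermitian μ (A 0)) -
          (lapSq μ (A 0) + 4 * maxPair σ ^ 2 * β * rho1 μ (A 0)) * c 0)) := by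
  have h : Model μ A ξ f σ b β := ⟨hflow, hf, hξ, hind, hL, hloop⟩
  refine ⟨h.integrable_edgeWeight_zero, h.integrable_sq_degIn_sub_degOut_zero,
    fun k i => memLp_coord (h.memLp_toE_state c X0 k) i,
    h.summable_gain_sq_mul_energy X0 hN hc htree,
    h.exists_average_consensus X0 hN hc htree, ?_, h.gainEnergy_le X0 hN hc htree hc'.1⟩
  -- The energy is the squared norm of the consensus error, so ∑ c V < ∞ is the hypothesis of the
  -- rate lemma with d(k) = ‖δ(k)‖.
  filter_upwards [h.ae_summable_gain_mul_energy X0 hN hc htree] with ω hω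
  exact isLittleO_average_of_summable hc.1 hc'.1 hc'.2.1 (fun _ => norm_nonneg _) hω
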